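/- **Root system data.** Let $\Phi$ be an irreducible, reduced, simply-laced root system of rank $r$ with Weyl group $W$ and simple roots $\alpha_1,\dots,\alpha_r$; write $\sigma_i$ for the simple reflections, and call $i\neq j$ adjacent if $(\sigma_i\sigma_j)^3=1$. Assume the simple roots are numbered so that for each $j$ either all $i$ adjacent to $j$ satisfy $i<j$, or all of them satisfy $i>j$. Let $q$ be a prime power. For $x=(x_1,\dots,x_r)$ let $(\sigma_i x)_j$ be $1/(qx_j)$ if $j=i$, $x_ix_j\sqrt q$ if $j$ is adjacent to $i$, and $x_j$ otherwise; let $(\varepsilon_i x)_j$ be $-x_j$ if $j$ is adjacent to $i$ and $x_j$ otherwise. For $f\in\mathbb C(x_1,\dots,x_r)$ put $f_i^{\pm}(x)=\frac12(f(x)\pm f(\varepsilon_ix))$ and $$(f|\sigma_i)(x)=-\frac{1-qx_i}{qx_i(1-x_i)}f_i^+(\sigma_ix)+\frac1{x_i\sqrt q}f_i^-(\sigma_ix).$$ These formulas define actions of $W$ on $x$ and on $\mathbb C(x_1,\dots,x_r)$. For a positive root $\alpha=\sum k_i\alpha_i$ let $d(\alpha)=\sum k_i$ and $x^{2\alpha}=\prod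 x_i^{2k_i}$; put $\Delta(x)=\prod_{\alpha>0}(1-q^{d(\alpha)}x^{2\alpha})$, $j(w,x)=\Delta(x)/\Delta(wx)$, and $$f(x;q)=\Delta(x)^{-1}\sum_{w\in W}j(w,x)\,(1|w)(x)=\sum_{k_1,\dots,k_r\ge0}a(k_1,\dots,k_r;q)\,x_1^{k_1}\cdots x_r^{k_r},$$ the last being the power series expansion at the origin. **Arithmetic data.** Let $K$ be a number field with ring of integers $\mathcal O$, and $S_f$ a finite set of finite places of $K$ that contains all places above $2$ and for which the ring of $S_f$-integers is a principal ideal domain; $S$ consists of $S_f$ and the archimedean places. Let $\mathcal J(S)$ be the group of fractional ideals prime to $S_f$, $\mathcal I(S)$ the set of nonzero integral ideals prime to $S_f$, and $|I|$ the absolute norm. Let $C=\prod_{v\in S_f}P_v^{\max(\mathrm{ord}_v4,1)}$; $m\equiv1\bmod C$ means that $\mathrm{ord}_v(m-1)\ge\max(\mathrm{ord}_v4,1)$ for $v\in S_f$ and that $m$ is positive at all real places. Let $R_C=H_C\otimes\mathbb Z/2$, where $H_C$ is the narrow ray class group modulo $C$. Choose a finite set $\mathcal E_0$ of integral ideals prime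 to $S_f$ that represent generators of the factors of a decomposition of $R_C$ as a product of cyclic groups; for each $E_0\in\mathcal E_0$ choose $m_{E_0}\in K^\times$ that generates the same $S_f$-integral ideal as $E_0$; choose a full set $\mathcal E\ni\mathcal O$ of representatives of $R_C$ of the form $E=\prod E_0^{n_{E_0}}$, and put $m_E=\prod m_{E_0}^{n_{E_0}}$. For each prime $P\notin S$ choose a decomposition $P=(m)EG^2$ with $m\equiv1\bmod C$, $E\in\mathcal E$, $G\in\mathcal J(S)$, put $g(P)=m\,m_E$, and extend $g$ multiplicatively to $\mathcal I(S)$. For coprime $I,J\in\mathcal I(S)$ let $(I/J)$ be the quadratic residue symbol $(g(I)/J)$. For $I\in\mathcal I(S)$ with squarefree part $I_0$ (so that $I=I_0I_1^2$), let $\chi_I$ be the primitive quadratic character attached to $K(\sqrt{g(I_0)})/K$; thus, for $P\notin S$, $\chi_I(P)=(g(I_0)/P)$ if $P\nmid I_0$, and $\chi_I(P)=0$ if $P\mid I_0$. The numbers $H(I_1,\dots,I_r)$, for $I_j\in\mathcal I(S)$, are determined by $H(P^{k_1},\dots,P^{k_r})=a(k_1,\dots,k_r;|P|)$ for primes $P\notin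 S$ and by $$H(I_1I_1',\dots,I_rI_r')=H(I_1,\dots,I_r)\,H(I_1',\dots,I_r')\prod_{\substack{i<j\\ i,j\text{ adjacent}}}\Big(\frac{I_i}{I_j'}\Big)\Big(\frac{I_i'}{I_j}\Big)\quad\text{if }(I_1\cdots I_r,\,I_1'\cdots I_r')=1.$$ Let $\psi$ be an idèle class character of $K$ of order dividing $2$, unramified outside $S$, regarded also as a function on $\mathcal I(S)$. Write $L^S(s,\psi\chi)=\prod_{P\notin S}(1-\psi(P)\chi(P)|P|^{-s})^{-1}$ for the partial $L$-function. **Proposition.** There is a function $C_3:\mathbb R\to\mathbb R$ depending only on $\Phi$ (with its numbered simple roots), such that the following holds for all data as above. Fix $j_0$ such that every $j$ adjacent to $j_0$ satisfies $j<j_0$, and fix ideals $I_j\in\mathcal I(S)$ for all $j\ne j_0$. Put $$N=\prod_{j\ne j_0}I_j,\qquad M=\prod_{j\text{ adjacent to }j_0}I_j=M_0M_1^2M_2^2,$$ where $M_0,M_1,M_2$ are integral ideals, $M_0$ is squarefree and $(M_0M_1,M_2)=1$. Then there are polynomials $F_P\in\mathbb C[X]$ for the primes $P\mid N$ such that the finite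 Euler product $Q(s)=\prod_{P\mid N}F_P(|P|^{-s})$ satisfies: 1. for $\mathrm{Re}\,s>1$, $$\sum_{I_{j_0}\in\mathcal I(S)}\frac{H(I_1,\dots,I_r)\,\psi(I_{j_0})}{|I_{j_0}|^{s}}=L^S(s,\psi\chi_M)\,Q(s),$$ with absolute convergence of the series and convergence of the Euler product; 2. $Q(s)=|M_1M_2|^{1-2s}\,Q(1-s)$ for all $s\in\mathbb C$; 3. for every real $C_2$ and every $s$ with $\mathrm{Re}\,s>C_2$, one has $|Q(s)|\le|N|^{C_3(C_2)}$. -/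

import Mathlib

open IsDedekindDomain NumberField
open scoped nonZeroDivisors

noncomputable section

namespace QuadWMDS

/-! ### Root systems -/

section RootSystem

variable {ι V V' : Type*} [Finite ι] [AddCommGroup V] [Module ℝ V] [AddCommGroup V'] [Module ℝ V']
  {P : RootPairing ι ℝ V V'} [P.IsCrystallographic] [P.IsReduced] (b : P.Base) {r : ℕ} (e : Fin r ≃ b.support)

/-- The simple reflection `σᵢ`, as an element of the Weyl group; the simple roots are numbered
by `e`. -/
def simpleReflection (i : Fin r) : P.weylGroup :=
  RootPairing.weylGroup.ofIdx P (e i)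

/-- Two indices `i ≠ j` are adjacent if `(σᵢ σⱼ)³ = 1`. -/
def Adj (i j : Fin r) : Prop :=
  i ≠ j ∧ (simpleReflection b e i * simpleReflection b e j) ^ 3 = 1

/-- The simple reflections generate the Weyl group. -/
theorem exists_word (w : P.weylGroup) :
    ∃ l : List (Fin r), (l.map (simpleReflection b e)).prod = w := by
  classical
  let T : Subgroup P.Aut :=
    Subgroup.closure (Set.range fun i : Fin r => RootPairing.Equiv.reflection P (e i : ι))
  have hsimple : ∀ i ∈ b.support, RootPairing.Equiv.reflection P i ∈ T := by
    intro i hi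
    refine Subgroup.subset_closure ⟨e.symm ⟨i, hi⟩, ?_⟩
    simp
  have hrefl : ∀ i j : ι, RootPairing.Equiv.reflection P (P.reflectionPerm j i) =
      RootPairing.Equiv.reflection P j * RootPairing.Equiv.reflection P i *
        RootPairing.Equiv.reflection P j := by
    intro i j
    apply RootPairing.Equiv.weightHom_injective P
    rw [map_mul, map_mul]
    change (RootPairing.Equiv.reflection P (P.reflectionPerm j i)).weightEquiv =
      (RootPairing.Equiv.reflection P j).weightEquiv *
        (RootPairing.Equiv.reflection P i).weightEquiv *
          (RootPairing.Equiv.reflection P j).weightEquiv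
    simp only [RootPairing.Equiv.reflection_weightEquiv]
    exact P.reflection_reflectionPerm
  have hall : ∀ i, RootPairing.Equiv.reflection P i ∈ T := by
    intro i
    refine b.induction_reflect i (p := fun i => RootPairing.Equiv.reflection P i ∈ T)
      ?_ hsimple ?_
    · intro i hi
      rw [hrefl]
      exact T.mul_mem (T.mul_mem hi hi) hi
    · intro i j hi hj
      rw [hrefl]
      exact T.mul_mem (T.mul_mem (hsimple j hj) hi) (hsimple j hj)
  have hw : (w : P.Aut) ∈ T := by
    have : P.weylGroup ≤ T := by
      refine (Subgroup.closure_le _).2 ?_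
      rintro _ ⟨i, rfl⟩
      exact hall i
    exact this w.2
  have key : ∀ g ∈ T, ∃ l : List (Fin r),
      (l.map fun i : Fin r => RootPairing.Equiv.reflection P (e i : ι)).prod = g := by
    intro g hg
    induction hg using Subgroup.closure_induction with
    | mem x hx => obtain ⟨i, rfl⟩ := hx; exact ⟨[i], by simp⟩
    | one => exact ⟨[], rfl⟩
    | mul x y _ _ hx hy =>
      obtain ⟨l, rfl⟩ := hx
      obtain ⟨l', rfl⟩ := hy
      exact ⟨l ++ l', by simp⟩
    | inv x _ hx =>
      obtain ⟨l, rfl⟩ := hx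
      refine ⟨l.reverse, ?_⟩
      rw [List.prod_inv_reverse, List.map_reverse, List.map_map]
      congr 2
      refine List.map_congr_left fun i _ => ?_
      simp
  obtain ⟨l, hl⟩ := key w hw
  refine ⟨l, Subtype.ext ?_⟩
  rw [← hl, ← Subgroup.coe_subtype, map_list_prod, List.map_map]
  rfl

/-- A word in the simple reflections representing `w`. -/
def word (w : P.weylGroup) : List (Fin r) := (exists_word b e w).choose

/-! ### The Weyl group action on rational functions -/

/-- The field `ℂ(x₁, …, x_r)` of rational functions. -/
abbrev RatFunc (r : ℕ) : Type := FractionRing (MvPolynomial (Fin r) ℂ)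

/-- The variable `xⱼ` as a rational function. -/
def var {r : ℕ} (j : Fin r) : RatFunc r :=
  algebraMap (MvPolynomial (Fin r) ℂ) (RatFunc r) (MvPolynomial.X j)

/-- The constant `q`. -/
def cq {r : ℕ} (q : ℕ) : RatFunc r := algebraMap ℂ (RatFunc r) (q : ℂ)

/-- The constant `√q`. -/
def csqrt {r : ℕ} (q : ℕ) : RatFunc r := algebraMap ℂ (RatFunc r) ((Real.sqrt q : ℝ) : ℂ)

/-- The rational function `f(y₁, …, y_r)` obtained from `f` by the substitution `xⱼ ↦ yⱼ`. -/
def subst {r : ℕ} (y : Fin r → RatFunc r) (f : RatFunc r) : RatFunc r :=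
  MvPolynomial.aeval y (IsFractionRing.num (MvPolynomial (Fin r) ℂ) f) /
    MvPolynomial.aeval y (IsFractionRing.den (MvPolynomial (Fin r) ℂ) f : MvPolynomial (Fin r) ℂ)

open Classical in
/-- The coordinates of `σᵢ x`. -/
def sigmaVec (q : ℕ) (i j : Fin r) : RatFunc r :=
  if j = i then 1 / (cq q * var j)
  else if Adj b e i j then var i * var j * csqrt q
  else var j

open Classical in
/-- The coordinates of `εᵢ x`. -/
def epsVec (i j : Fin r) : RatFunc r :=
  if Adj b e i j then -var j else var j

/-- `fᵢ⁺(x) = (f(x) + f(εᵢ x)) / 2`. -/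
def evenPart (i : Fin r) (f : RatFunc r) : RatFunc r := (f + subst (epsVec b e i) f) / 2

/-- `fᵢ⁻(x) = (f(x) - f(εᵢ x)) / 2`. -/
def oddPart (i : Fin r) (f : RatFunc r) : RatFunc r := (f - subst (epsVec b e i) f) / 2

/-- The action `f | σᵢ` of a simple reflection:
`(f|σᵢ)(x) = -(1 - q xᵢ) / (q xᵢ (1 - xᵢ)) fᵢ⁺(σᵢ x) + 1 / (xᵢ √q) fᵢ⁻(σᵢ x)`. -/
def slash (q : ℕ) (i : Fin r) (f : RatFunc r) : RatFunc r :=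
  -((1 - cq q * var i) / (cq q * var i * (1 - var i))) *
      subst (sigmaVec b e q i) (evenPart b e i f) +
    1 / (var i * csqrt q) * subst (sigmaVec b e q i) (oddPart b e i f)

/-- The right action `f | w = (⋯(f | σ_{i₁}) | ⋯) | σ_{iₖ}` for `w = σ_{i₁} ⋯ σ_{iₖ}`. -/
def slashW (q : ℕ) (w : P.weylGroup) (f : RatFunc r) : RatFunc r :=
  (word b e w).foldl (fun g i => slash b e q i g) f

/-- The rational function `f(w x)`, with `w x = σ_{i₁}(⋯(σ_{iₖ} x))` for
`w = σ_{i₁} ⋯ σ_{iₖ}`. -/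
def substW (q : ℕ) (w : P.weylGroup) (f : RatFunc r) : RatFunc r :=
  (word b e w).foldl (fun g i => subst (sigmaVec b e q i) g) f

open Classical in
/-- `Δ(x) = ∏_{α > 0} (1 - q^{d(α)} x^{2α})`, where `d(α)` is the height of `α`. -/
def Delta (q : ℕ) : RatFunc r :=
  ∏ᶠ (α : ι) (_ : b.IsPos α),
    (1 - cq q ^ b.height α *
      ∏ j : Fin r, var j ^ (2 * b.toWeightBasisInt.repr (P.rootSpanMem ℤ α) (e j)))

/-- `j(w, x) = Δ(x) / Δ(w x)`. -/
def cocycle (q : ℕ) (w : P.weylGroup) : RatFunc r :=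
  Delta b e q / substW b e q w (Delta b e q)

/-- `f₀(x) = ∑_w j(w, x) (1 | w)(x)`. -/
def invFunc₀ (q : ℕ) : RatFunc r :=
  ∑ᶠ w : P.weylGroup, cocycle b e q w * slashW b e q w 1

/-- The invariant rational function `f(x; q) = f₀(x) / Δ(x)`. -/
def invFunc (q : ℕ) : RatFunc r := invFunc₀ b e q / Delta b e q

end RootSystem

/-- `p` is the power series expansion of the rational function `f` at the origin: `f = n / d` with
`d(0) ≠ 0` and `d p = n`. -/
def IsExpansion {r : ℕ} (f : RatFunc r) (p : MvPowerSeries (Fin r) ℂ) : Prop :=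
  ∃ n d : MvPolynomial (Fin r) ℂ, MvPolynomial.constantCoeff d ≠ 0 ∧
    f = algebraMap _ (RatFunc r) n / algebraMap _ (RatFunc r) d ∧
    (d : MvPowerSeries (Fin r) ℂ) * p = n

open Classical in
/-- The coefficient `a(k₁, …, k_r; q)` of `x₁^{k₁} ⋯ x_r^{k_r}` in the power series expansion of
`f(x; q)` at the origin. -/
def coeff {ι V V' : Type*} [Finite ι] [AddCommGroup V] [Module ℝ V] [AddCommGroup V'] [Module ℝ V']
    {P : RootPairing ι ℝ V V'} [P.IsCrystallographic] [P.IsReduced] (b : P.Base) {r : ℕ} (e : Fin r ≃ b.support)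
    (q : ℕ) (k : Fin r → ℕ) : ℂ :=
  if h : ∃ p, IsExpansion (invFunc b e q) p then
    MvPowerSeries.coeff (Finsupp.equivFunOnFinite.symm k) h.choose
  else 0

/-! ### Ideals and quadratic residue symbols -/

section Arithmetic

variable (K : Type*) [Field K] [NumberField K]

/-- The finite places of `K`. -/
abbrev Pl : Type _ := HeightOneSpectrum (𝓞 K)

variable {K}

/-- The norm `|I|` of an integral ideal. -/
abbrev nrm (I : Ideal (𝓞 K)) : ℕ := Ideal.absNorm I

/-- The order of the prime `v` in a nonzero integral ideal. -/
def ord (v : Pl K) (I : Ideal (𝓞 K)) : ℕ := multiplicity v.asIdeal I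

/-- `𝓘(S)`: the nonzero integral ideals prime to `S`. -/
abbrev IntegralIdeals (S : Finset (Pl K)) : Type _ :=
  {I : Ideal (𝓞 K) // I ≠ ⊥ ∧ ∀ v ∈ S, ¬ v.asIdeal ∣ I}

/-- The group of nonzero fractional ideals of `K`. -/
abbrev FracIdeals (K : Type*) [Field K] [NumberField K] : Type _ := (FractionalIdeal (𝓞 K)⁰ K)ˣ

/-- Membership in `𝓙(S)`, the group of fractional ideals coprime to `S`. -/
def CoprimeTo (S : Finset (Pl K)) (I : FracIdeals K) : Prop :=
  ∀ v ∈ S, FractionalIdeal.count K v (I : FractionalIdeal (𝓞 K)⁰ K) = 0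

/-- `m ≡ 1 mod C` in the narrow sense, where `C = ∏_{v ∈ S} P_v ^ max(ord_v 4, 1)`: for `v ∈ S`,
`ord_v(m - 1) ≥ ord_v 4` and `ord_v(m - 1) ≥ 1`, and `m` is positive at all real places. -/
def IsOneMod (S : Finset (Pl K)) (m : Kˣ) : Prop :=
  (∀ v ∈ S, v.valuation K ((m : K) - 1) ≤ v.valuation K 4 ∧ v.valuation K ((m : K) - 1) < 1) ∧
    ∀ τ : K →+* ℝ, 0 < τ m

/-- `I = (m) J G²` with `m ≡ 1 mod C` and `G ∈ 𝓙(S)`. -/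
def IsDecomp (S : Finset (Pl K)) (I : FracIdeals K) (m : Kˣ) (J G : FracIdeals K) : Prop :=
  IsOneMod S m ∧ CoprimeTo S G ∧ I = toPrincipalIdeal (𝓞 K) K m * J * G ^ 2

/-- `I` and `J` have the same image in `R_C = H_C ⊗ ℤ/2`, where `H_C` is the narrow ray class group
modulo `C`. -/
def SameClass (S : Finset (Pl K)) (I J : FracIdeals K) : Prop :=
  ∃ (m : Kˣ) (G : FracIdeals K), IsDecomp S I m J G

/-- The prime ideal of `v`, as an element of the group of fractional ideals. -/
def primeFrac (v : Pl K) : FracIdeals K :=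
  FractionalIdeal.mk0 K ⟨v.asIdeal, mem_nonZeroDivisors_of_ne_zero v.ne_bot⟩

/-- The choices that enter the definition of the quadratic residue symbol. -/
structure SymbolChoices (K : Type*) [Field K] [NumberField K] (S : Finset (Pl K)) where
  /-- The number of cyclic factors of `R_C`. -/
  n : ℕ
  /-- The ideals in `𝓔₀`, which represent generators of the factors of a decomposition of `R_C` as a
  direct product of cyclic groups (of order two). -/
  E₀ : Fin n → FracIdeals K
  E₀_integral : ∀ i, (E₀ i : FractionalIdeal (𝓞 K)⁰ K) ≤ 1
  E₀_coprime : ∀ i, CoprimeTo S (E₀ i)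
  E₀_indep : ∀ k : Fin n → ℤ, SameClass S (∏ i, E₀ i ^ k i) 1 ↔ ∀ i, Even (k i)
  /-- The elements `m_{E₀}`: they generate the same `S`-integral ideal as `E₀`. -/
  m₀ : Fin n → Kˣ
  m₀_spec : ∀ i, ∀ v ∉ S,
    FractionalIdeal.count K v (toPrincipalIdeal (𝓞 K) K (m₀ i) : FractionalIdeal (𝓞 K)⁰ K) =
      FractionalIdeal.count K v (E₀ i : FractionalIdeal (𝓞 K)⁰ K)
  /-- The exponents of the elements `∏ E₀ ^ k` of the full set `𝓔` of representatives of `R_C`. -/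
  reps : Set (Fin n → ℤ)
  zero_mem_reps : 0 ∈ reps
  reps_spec : ∀ I, CoprimeTo S I → ∃! k, k ∈ reps ∧ SameClass S I (∏ i, E₀ i ^ k i)
  /-- A decomposition `P = (m) E G²`, with `E ∈ 𝓔`, of each prime ideal `P` outside `S`. -/
  decM : Pl K → Kˣ
  decE : Pl K → Fin n → ℤ
  decG : Pl K → FracIdeals K
  decE_mem : ∀ v ∉ S, decE v ∈ reps
  dec_spec : ∀ v ∉ S, IsDecomp S (primeFrac v) (decM v) (∏ i, E₀ i ^ decE v i) (decG v)

/-- `a` has even order at `v`. -/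
def EvenAt (v : Pl K) (a : Kˣ) : Prop := ∃ c : Kˣ, v.valuation K (a / c ^ 2 : K) = 1

/-- `a` is a square locally at `v` (for `v` not above `2`): `a` becomes `1` modulo `P_v` after division
by a square. -/
def SqAt (v : Pl K) (a : Kˣ) : Prop := ∃ c : Kˣ, v.valuation K (a / c ^ 2 - 1 : K) < 1

open Classical in
/-- The quadratic residue symbol `(a / P_v)` of the extension `K(√a) / K`, for `v` not above `2`: it
is `0` if `ord_v a` is odd (`v` ramifies); otherwise it is `1` or `-1` according as `a` is a square
locally at `v` (`v` splits) or not (`v` is inert). For a `v`-unit `a` this says whether `a` is a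
square modulo `P_v`. -/
def quadSym (a : Kˣ) (v : Pl K) : ℤ :=
  if EvenAt v a then if SqAt v a then 1 else -1 else 0

namespace SymbolChoices

variable {S : Finset (Pl K)} (D : SymbolChoices K S)

/-- The element `m m_E` attached to the chosen decomposition `P_v = (m) E G²`. -/
def elt (v : Pl K) : Kˣ := D.decM v * ∏ i, D.m₀ i ^ D.decE v i

/-- The element attached to an integral ideal `I` prime to `S`, such that `(I / J)` is the residue
symbol `(gen I / J)`. It is multiplicative in `I`, and up to squares it is `m m_E` for a
decomposition `I = (m) E G²` with `E ∈ 𝓔` (see `exists_decomp_gen`). -/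
def gen (I : Ideal (𝓞 K)) : Kˣ := ∏ᶠ v : Pl K, D.elt v ^ ord v I

/-- The element attached to the squarefree part `I₀` of `I = I₀ I₁²`. -/
def gen₀ (I : Ideal (𝓞 K)) : Kˣ := ∏ᶠ v : Pl K, D.elt v ^ (ord v I % 2)

/-- The quadratic residue symbol `(I / J)` of coprime integral ideals prime to `S`. -/
def symbol (I J : Ideal (𝓞 K)) : ℤ := ∏ᶠ v : Pl K, quadSym (D.gen I) v ^ ord v J

/-- The value at the prime `v ∉ S` of the (primitive) quadratic character `χ_I`, which is attached to
the squarefree part `I₀` of `I`; it vanishes at the primes dividing `I₀`, where `χ_I` ramifies. -/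
def chi (I : Ideal (𝓞 K)) (v : Pl K) : ℤ := quadSym (D.gen₀ I) v

end SymbolChoices

/-! ### Quadratic idèle class characters -/

/-- The idèle with component `x` at the finite place `v` and component `1` at all other places. -/
def localIdele (v : Pl K) (x : (v.adicCompletion K)ˣ) : (AdeleRing (𝓞 K) K)ˣ := by
  classical
  exact
  { val := ((1 : InfiniteAdeleRing K),
      (RestrictedProduct.mulSingle (fun w : Pl K => w.adicCompletionIntegers K) v
        (x : v.adicCompletion K) : FiniteAdeleRing (𝓞 K) K))
    inv := ((1 : InfiniteAdeleRing K),
      (RestrictedProduct.mulSingle (fun w : Pl K => w.adicCompletionIntegers K) v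
        ((x⁻¹ : (v.adicCompletion K)ˣ) : v.adicCompletion K) : FiniteAdeleRing (𝓞 K) K))
    val_inv := Prod.ext (one_mul _) (by
      refine (RestrictedProduct.mulSingle_mul _ v _ _).symm.trans ?_
      rw [Units.mul_inv]
      exact RestrictedProduct.mulSingle_one _ v)
    inv_val := Prod.ext (one_mul _) (by
      refine (RestrictedProduct.mulSingle_mul _ v _ _).symm.trans ?_
      rw [Units.inv_mul]
      exact RestrictedProduct.mulSingle_one _ v) }

/-- A quadratic idèle class character of `K` (a character of order dividing `2`) unramified
outside `S`. -/
structure QuadChar (K : Type*) [Field K] [NumberField K] (S : Finset (Pl K)) where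
  toHom : (AdeleRing (𝓞 K) K)ˣ →* ℂˣ
  continuous_toHom : Continuous toHom
  map_principal : ∀ a : Kˣ, toHom (Units.map (algebraMap K (AdeleRing (𝓞 K) K)) a) = 1
  map_sq : ∀ x, toHom x ^ 2 = 1
  unramified : ∀ v ∉ S, ∀ u : (v.adicCompletion K)ˣ,
    Valued.v (u : v.adicCompletion K) = 1 → toHom (localIdele v u) = 1

/-- An element of `K` of order one at `v`. -/
def uniformizer (v : Pl K) : K := (v.valuation_exists_uniformizer K).choose

theorem uniformizer_ne_zero (v : Pl K) : uniformizer v ≠ 0 :=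
  v.valuation_uniformizer_ne_zero K

namespace QuadChar

variable {S : Finset (Pl K)} (ψ : QuadChar K S)

/-- The value `ψ(P_v)` at a prime `v ∉ S`, namely the value at an idèle which is a uniformizer
at `v` and is trivial elsewhere. -/
def atPrime (v : Pl K) : ℂ :=
  ψ.toHom (localIdele v
    (Units.map (algebraMap K (v.adicCompletion K)) (Units.mk0 _ (uniformizer_ne_zero v))))

/-- The value `ψ(I)` at an integral ideal prime to `S`. -/
def atIdeal (I : Ideal (𝓞 K)) : ℂ := ∏ᶠ v : Pl K, ψ.atPrime v ^ ord v I

end QuadChar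

/-! ### The coefficients and the `L`-function -/

variable {S : Finset (Pl K)}

/-- The Euler factor at a prime `v ∉ S` of `L(s, ψ χ_M)`. -/
def eulerFactor (D : SymbolChoices K S) (ψ : QuadChar K S) (M : Ideal (𝓞 K)) (s : ℂ)
    (v : Pl K) : ℂ :=
  (1 - ψ.atPrime v * (D.chi M v : ℂ) * (nrm v.asIdeal : ℂ) ^ (-s))⁻¹

/-- The partial `L`-function `L^S(s, ψ χ_M)`, the places in `S` being removed. -/
def partialL (D : SymbolChoices K S) (ψ : QuadChar K S) (M : Ideal (𝓞 K)) (s : ℂ) : ℂ :=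
  ∏' v : {v : Pl K // v ∉ S}, eulerFactor D ψ M s v

open Classical in
/-- The product of `(P / P') ^ (ord_P I * ord_{P'} J)` over all pairs of distinct primes `P`, `P'`. For
coprime `I` and `J` this is `(I / J)` (see `cross_eq_symbol`). -/
def cross (D : SymbolChoices K S) (I J : Ideal (𝓞 K)) : ℂ :=
  ∏ᶠ (v : Pl K) (w : Pl K), if v = w then (1 : ℂ) else
    (D.symbol v.asIdeal w.asIdeal : ℂ) ^ (ord v I * ord w J)

variable {ι V V' : Type*} [Finite ι] [AddCommGroup V] [Module ℝ V] [AddCommGroup V'] [Module ℝ V']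
  {P : RootPairing ι ℝ V V'} [P.IsCrystallographic] [P.IsReduced]

open Classical in
/-- The coefficient `H(I₁, …, I_r)`. It is determined by `H(P^{k₁}, …, P^{k_r}) = a(k₁, …, k_r; |P|)`
(see `H_primePow`) and by the twisted multiplicativity
`H(I₁ I₁', …, I_r I_r') = H(I₁, …, I_r) H(I₁', …, I_r') ∏_{i < j adjacent} (I_i / I_j') (I_i' / I_j)`
for `(I₁ ⋯ I_r, I₁' ⋯ I_r') = 1` (see `H_mul`). Splitting the ideals into prime powers, these two
conditions say that `H(I₁, …, I_r)` is the product of the `a(ord_P I₁, …, ord_P I_r; |P|)` over the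
primes `P` dividing `I₁ ⋯ I_r`, times the product of all `(P / P') ^ (ord_P I_i * ord_{P'} I_j)` for
adjacent `i < j` and distinct primes `P`, `P'`. -/
def H (b : P.Base) {r : ℕ} (e : Fin r ≃ b.support)
    (D : SymbolChoices K S) (I : Fin r → Ideal (𝓞 K)) : ℂ :=
  (∏ᶠ (v : Pl K) (_ : ∃ i, ord v (I i) ≠ 0),
      coeff b e (nrm v.asIdeal) fun i => ord v (I i)) *
    ∏ i, ∏ j, if i < j ∧ Adj b e i j then cross D (I i) (I j) else 1

/-! ### Properties of the residue symbol and of the coefficients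

These facts confirm that the definitions of `gen`, `symbol` and `H` have the properties that
characterize them. -/

theorem ord_mul (v : Pl K) {I J : Ideal (𝓞 K)} (hI : I ≠ ⊥) (hJ : J ≠ ⊥) :
    ord v (I * J) = ord v I + ord v J := by
  refine multiplicity_mul v.prime (FiniteMultiplicity.of_prime_left v.prime ?_)
  exact mul_ne_zero hI hJ

theorem ord_ne_zero_iff (v : Pl K) {I : Ideal (𝓞 K)} :
    ord v I ≠ 0 ↔ v.asIdeal ∣ I := by
  unfold ord
  rw [Ne, multiplicity_eq_zero, not_not]

theorem ord_finite {I : Ideal (𝓞 K)} (hI : I ≠ ⊥) : {v : Pl K | ord v I ≠ 0}.Finite := by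
  refine (Ideal.finite_factors (R := 𝓞 K) hI).subset fun v hv => ?_
  exact (ord_ne_zero_iff v).1 hv

open Classical in
theorem ord_prime (v w : Pl K) : ord v w.asIdeal = if v = w then 1 else 0 := by
  split_ifs with h
  · subst h
    exact multiplicity_self
  · by_contra h0
    have := (ord_ne_zero_iff v).1 h0
    have h2 := (Ideal.dvd_iff_le.1 this)
    exact h (HeightOneSpectrum.ext ((w.isMaximal.eq_of_le v.isPrime.ne_top h2).symm))

theorem valuation_eq_count (v : Pl K) (x : Kˣ) :
    v.valuation K (x : K) = WithZero.exp
      (-FractionalIdeal.count K v (toPrincipalIdeal (𝓞 K) K x : FractionalIdeal (𝓞 K)⁰ K)) := by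
  obtain ⟨n, d, hd, hx⟩ := IsFractionRing.div_surjective (A := 𝓞 K) (x : K)
  have hd0 : d ≠ 0 := nonZeroDivisors.ne_zero hd
  have hn0 : n ≠ 0 := by
    rintro rfl
    exact x.ne_zero (by rw [← hx]; simp)
  have hI : (toPrincipalIdeal (𝓞 K) K x : FractionalIdeal (𝓞 K)⁰ K) ≠ 0 := Units.ne_zero _
  rw [FractionalIdeal.count_well_defined K v hI (a := d) (J := Ideal.span {n})]
  · rw [← hx, map_div₀, HeightOneSpectrum.valuation_of_algebraMap,
      HeightOneSpectrum.valuation_of_algebraMap, HeightOneSpectrum.intValuation_def,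
      HeightOneSpectrum.intValuation_def, if_neg hd0, if_neg hn0, ← WithZero.exp_sub]
    congr 1
    ring
  · rw [coe_toPrincipalIdeal, FractionalIdeal.coeIdeal_span_singleton,
      FractionalIdeal.spanSingleton_mul_spanSingleton, ← hx]
    congr 1
    field_simp

theorem EvenAt.mul {v : Pl K} {a b : Kˣ} (ha : EvenAt v a) (hb : EvenAt v b) :
    EvenAt v (a * b) := by
  obtain ⟨c, hc⟩ := ha
  obtain ⟨d, hd⟩ := hb
  refine ⟨c * d, ?_⟩
  have : ((a * b : Kˣ) : K) / ((c * d : Kˣ) : K) ^ 2 = (a / c ^ 2) * (b / d ^ 2) := by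
    push_cast; field_simp
  rw [this, map_mul, hc, hd, one_mul]

theorem SqAt.even {v : Pl K} {a : Kˣ} (ha : SqAt v a) : EvenAt v a := by
  obtain ⟨c, hc⟩ := ha
  refine ⟨c, ?_⟩
  have := Valuation.map_one_add_of_lt (v.valuation K) hc
  simpa using this

open Classical in
/-- The residue symbol at `v` is multiplicative on elements of even order at `v`. -/
theorem quadSym_mul {v : Pl K} {a b : Kˣ} (ha : EvenAt v a) (hb : EvenAt v b) :
    quadSym (a * b) v = quadSym a v * quadSym b v := by
  let k := 𝓞 K ⧸ v.asIdeal
  have : v.asIdeal.IsMaximal := v.isMaximal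
  let : Field k := Ideal.Quotient.field _
  have : Finite k := Ideal.finiteQuotientOfFreeOfNeBot _ v.ne_bot
  let : Fintype k := Fintype.ofFinite k
  have unit_of : ∀ y u : K, v.valuation K (y - u) < 1 → v.valuation K u = 1 →
      v.valuation K y = 1 := by
    intro y u h hu
    have := Valuation.map_add_eq_of_lt_right (v.valuation K) (x := y - u) (y := u) (by rwa [hu])
    rw [sub_add_cancel] at this
    rw [this, hu]
  have nz : ∀ (x : 𝓞 K) (u : K), v.valuation K (algebraMap (𝓞 K) K x - u) < 1 →
      v.valuation K u = 1 → (Ideal.Quotient.mk v.asIdeal x : k) ≠ 0 := by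
    intro x u h hu h0
    rw [Ideal.Quotient.eq_zero_iff_mem, ← HeightOneSpectrum.valuation_lt_one_iff_mem (K := K)] at h0
    exact h0.ne (unit_of _ _ h hu)
  -- every element of even order has a residue up to squares
  have res : ∀ a : Kˣ, EvenAt v a → ∃ (x : 𝓞 K) (c : Kˣ),
      v.valuation K (algebraMap (𝓞 K) K x - a / c ^ 2) < 1 ∧
      v.valuation K (a / c ^ 2 : K) = 1 := by
    rintro a ⟨c, hc⟩
    obtain ⟨x, hx⟩ := v.exists_valuation_sub_lt_of_integer (K := K) (x := (a / c ^ 2 : K))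
      hc.le 1
    exact ⟨x, c, by simpa using hx, hc⟩
  have crit : ∀ (a : Kˣ) (x : 𝓞 K) (c : Kˣ),
      v.valuation K (algebraMap (𝓞 K) K x - a / c ^ 2) < 1 →
      v.valuation K (a / c ^ 2 : K) = 1 →
      (SqAt v a ↔ IsSquare (Ideal.Quotient.mk v.asIdeal x : k)) := by
    intro a x c hx hc
    have hcK : (c : K) ≠ 0 := c.ne_zero
    constructor
    · rintro ⟨f, hf⟩
      have hfK : (f : K) ≠ 0 := f.ne_zero
      have hf1 : v.valuation K (a / f ^ 2 : K) = 1 := by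
        simpa using Valuation.map_one_add_of_lt (v.valuation K) hf
      set t : K := f / c with ht
      have hut : (a / c ^ 2 : K) = (a / f ^ 2) * t ^ 2 := by rw [ht]; field_simp
      have ht2 : v.valuation K t ^ 2 = 1 := by
        rw [hut, map_mul, hf1, one_mul, map_pow] at hc
        exact hc
      have ht1 : v.valuation K t = 1 := (pow_eq_one_iff_left two_ne_zero).1 ht2
      obtain ⟨y, hy⟩ := v.exists_valuation_sub_lt_of_integer (K := K) (x := t) ht1.le 1
      have hy' : v.valuation K (algebraMap (𝓞 K) K y - t) < 1 := by simpa using hy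
      refine ⟨Ideal.Quotient.mk v.asIdeal y, ?_⟩
      rw [← map_mul, Ideal.Quotient.mk_eq_mk_iff_sub_mem,
        ← HeightOneSpectrum.valuation_lt_one_iff_mem (K := K)]
      have h1 : v.valuation K ((a / c ^ 2 : K) - t ^ 2) < 1 := by
        have : (a / c ^ 2 : K) - t ^ 2 = (a / f ^ 2 - 1) * t ^ 2 := by rw [hut]; ring
        rw [this, map_mul, map_pow, ht2, mul_one]
        exact hf
      have h2 : v.valuation K (t ^ 2 - algebraMap (𝓞 K) K y ^ 2) < 1 := by
        have : t ^ 2 - algebraMap (𝓞 K) K y ^ 2 =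
            -(algebraMap (𝓞 K) K y - t) * (algebraMap (𝓞 K) K y + t) := by ring
        rw [this, map_mul, Valuation.map_neg]
        refine mul_lt_one_of_lt_of_le hy' ?_
        exact (Valuation.map_add _ _ _).trans (max_le (v.valuation_le_one y) ht1.le)
      have : algebraMap (𝓞 K) K (x - y * y) =
          ((algebraMap (𝓞 K) K x - a / c ^ 2) + ((a / c ^ 2 : K) - t ^ 2)) +
            (t ^ 2 - algebraMap (𝓞 K) K y ^ 2) := by
        rw [map_sub, map_mul]; ring
      change v.valuation K (algebraMap (𝓞 K) K (x - y * y)) < 1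
      rw [this]
      exact Valuation.map_add_lt _ (Valuation.map_add_lt _ hx h1) h2
    · rintro ⟨z, hz⟩
      obtain ⟨y, rfl⟩ := Ideal.Quotient.mk_surjective z
      rw [← map_mul, Ideal.Quotient.mk_eq_mk_iff_sub_mem,
        ← HeightOneSpectrum.valuation_lt_one_iff_mem (K := K)] at hz
      have h1 : v.valuation K (algebraMap (𝓞 K) K y ^ 2 - a / c ^ 2) < 1 := by
        have : algebraMap (𝓞 K) K y ^ 2 - a / c ^ 2 =
            -(algebraMap (𝓞 K) K (x - y * y)) + (algebraMap (𝓞 K) K x - a / c ^ 2) := by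
          rw [map_sub, map_mul]; ring
        rw [this]
        exact Valuation.map_add_lt _ (by rwa [Valuation.map_neg]) hx
      have h2 : v.valuation K (algebraMap (𝓞 K) K y ^ 2) = 1 := unit_of _ _ h1 hc
      have hy0 : algebraMap (𝓞 K) K y ≠ 0 := by
        intro h
        rw [h] at h2
        simp at h2
      refine ⟨c * Units.mk0 _ hy0, ?_⟩
      have : (a : K) / ((c * Units.mk0 _ hy0 : Kˣ) : K) ^ 2 - 1 =
          -(algebraMap (𝓞 K) K y ^ 2 - a / c ^ 2) / algebraMap (𝓞 K) K y ^ 2 := by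
        push_cast
        simp only [Units.val_mk0]
        field_simp
        ring
      rw [this, map_div₀, Valuation.map_neg, h2, div_one]
      exact h1
  obtain ⟨x, c, hx, hc⟩ := res a ha
  obtain ⟨y, d, hy, hd⟩ := res b hb
  have hab : ((a * b : Kˣ) : K) / ((c * d : Kˣ) : K) ^ 2 = (a / c ^ 2) * (b / d ^ 2) := by
    push_cast; field_simp
  have hxy := crit (a * b) (x * y) (c * d) (by
      have : algebraMap (𝓞 K) K (x * y) - ((a * b : Kˣ) : K) / ((c * d : Kˣ) : K) ^ 2 =
          (algebraMap (𝓞 K) K x - a / c ^ 2) * algebraMap (𝓞 K) K y +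
            (a / c ^ 2) * (algebraMap (𝓞 K) K y - b / d ^ 2) := by
        rw [hab, map_mul]; ring
      rw [this]
      refine Valuation.map_add_lt _ ?_ ?_
      · rw [map_mul]
        exact mul_lt_one_of_lt_of_le hx (v.valuation_le_one y)
      · rwa [map_mul, hc, one_mul]) (by rw [hab, map_mul, hc, hd, one_mul])
  unfold quadSym
  rw [if_pos ha, if_pos hb, if_pos (ha.mul hb)]
  simp only [crit a x c hx hc, crit b y d hy hd, hxy, map_mul]
  have hx0 : (Ideal.Quotient.mk v.asIdeal x : k) ≠ 0 := nz _ _ hx hc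
  have hy0 : (Ideal.Quotient.mk v.asIdeal y : k) ≠ 0 := nz _ _ hy hd
  by_cases h2 : ringChar k = 2
  · rw [if_pos (FiniteField.isSquare_of_char_two h2 _), if_pos (FiniteField.isSquare_of_char_two h2 _),
      if_pos (FiniteField.isSquare_of_char_two h2 _), one_mul]
  · have q := quadraticCharFun_mul (F := k) (Ideal.Quotient.mk v.asIdeal x) (Ideal.Quotient.mk v.asIdeal y)
    unfold quadraticCharFun at q
    rw [if_neg (mul_ne_zero hx0 hy0), if_neg hx0, if_neg hy0] at q
    convert q


theorem evenAt_one (v : Pl K) : EvenAt v (1 : Kˣ) := ⟨1, by simp⟩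

theorem quadSym_one (v : Pl K) : quadSym (1 : Kˣ) v = 1 := by
  unfold quadSym
  rw [if_pos (evenAt_one v), if_pos ⟨1, by simp⟩]

theorem quadSym_pow {v : Pl K} {a : Kˣ} (ha : EvenAt v a) (n : ℕ) :
    EvenAt v (a ^ n) ∧ quadSym (a ^ n) v = quadSym a v ^ n := by
  induction n with
  | zero => simp [evenAt_one, quadSym_one]
  | succ n ih => rw [pow_succ, pow_succ, quadSym_mul ih.1 ha, ih.2]; exact ⟨ih.1.mul ha, rfl⟩

theorem quadSym_prod {v : Pl K} {ι : Type*} (T : Finset ι) (a : ι → Kˣ)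
    (ha : ∀ i ∈ T, EvenAt v (a i)) :
    EvenAt v (∏ i ∈ T, a i) ∧ quadSym (∏ i ∈ T, a i) v = ∏ i ∈ T, quadSym (a i) v := by
  classical
  induction T using Finset.induction_on with
  | empty => simp [evenAt_one, quadSym_one]
  | insert i T hi ih =>
    have h1 := ha i (Finset.mem_insert_self _ _)
    have h2 := ih fun j hj => ha j (Finset.mem_insert_of_mem hj)
    rw [Finset.prod_insert hi, Finset.prod_insert hi, quadSym_mul h1 h2.1, h2.2]
    exact ⟨h1.mul h2.1, rfl⟩

theorem fracCount_mul (v : Pl K) (I J : FracIdeals K) :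
    FractionalIdeal.count K v ((I * J : FracIdeals K) : FractionalIdeal (𝓞 K)⁰ K) =
      FractionalIdeal.count K v (I : FractionalIdeal (𝓞 K)⁰ K) +
        FractionalIdeal.count K v (J : FractionalIdeal (𝓞 K)⁰ K) := by
  rw [Units.val_mul, FractionalIdeal.count_mul K v (Units.ne_zero _) (Units.ne_zero _)]

/-- The order at `v`, as a homomorphism from the group of fractional ideals. -/
def countHom (v : Pl K) : FracIdeals K →* Multiplicative ℤ where
  toFun I := Multiplicative.ofAdd
    (FractionalIdeal.count K v (I : FractionalIdeal (𝓞 K)⁰ K))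
  map_one' := by rw [Units.val_one, FractionalIdeal.count_one]; rfl
  map_mul' I J := by rw [fracCount_mul]; rfl

namespace SymbolChoices

/-- `elt v` generates the prime ideal of `v` up to squares and ideals supported on `S`. -/
theorem evenAt_elt (D : SymbolChoices K S) {v w : Pl K} (hv : v ∉ S) (hw : w ∉ S) (hvw : w ≠ v) :
    EvenAt w (D.elt v) := by
  have hm₀ : ∀ i, countHom w (toPrincipalIdeal (𝓞 K) K (D.m₀ i)) = countHom w (D.E₀ i) :=
    fun i => congrArg Multiplicative.ofAdd (D.m₀_spec i w hw)
  have h1 := congrArg (countHom w) (D.dec_spec v hv).2.2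
  have h2 : countHom w (toPrincipalIdeal (𝓞 K) K (D.elt v)) * countHom w (D.decG v) ^ 2 = 1 := by
    have h3 : countHom w (primeFrac v) = 1 := by
      change Multiplicative.ofAdd (FractionalIdeal.count K w
        ((primeFrac v : FracIdeals K) : FractionalIdeal (𝓞 K)⁰ K)) = _
      rw [primeFrac, FractionalIdeal.coe_mk0]
      rw [FractionalIdeal.count_maximal_coprime K w hvw.symm]
      rfl
    rw [← h3, h1, elt]
    simp only [map_mul, map_prod, map_zpow, map_pow, hm₀]
  have h4 : FractionalIdeal.count K w
      (toPrincipalIdeal (𝓞 K) K (D.elt v) : FractionalIdeal (𝓞 K)⁰ K) =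
      -2 * FractionalIdeal.count K w (D.decG v : FractionalIdeal (𝓞 K)⁰ K) := by
    have := congrArg Multiplicative.toAdd h2
    simp only [toAdd_mul, toAdd_pow, toAdd_one] at this
    change FractionalIdeal.count K w _ + 2 • FractionalIdeal.count K w _ = 0 at this
    rw [two_nsmul] at this
    linarith
  refine ⟨(Units.mk0 _ (uniformizer_ne_zero w)) ^
    (-FractionalIdeal.count K w (D.decG v : FractionalIdeal (𝓞 K)⁰ K)), ?_⟩
  have hu : w.valuation K (uniformizer w) = WithZero.exp (-1 : ℤ) :=
    (w.valuation_exists_uniformizer K).choose_spec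
  rw [map_div₀, valuation_eq_count, h4, map_pow, Units.val_zpow_eq_zpow_val, map_zpow₀,
    Units.val_mk0, hu, ← WithZero.exp_zsmul, ← WithZero.exp_nsmul, ← WithZero.exp_sub,
    ← WithZero.exp_zero]
  congr 1
  simp only [smul_eq_mul, nsmul_eq_mul]
  push_cast
  ring

end SymbolChoices

theorem gen_eq_prod (D : SymbolChoices K S) {I : Ideal (𝓞 K)} {T : Finset (Pl K)}
    (hT : ∀ v, ord v I ≠ 0 → v ∈ T) : D.gen I = ∏ v ∈ T, D.elt v ^ ord v I := by
  refine finprod_eq_prod_of_mulSupport_subset _ fun v hv => hT v fun h => hv ?_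
  simp only [h, pow_zero]

theorem symbol_prime (D : SymbolChoices K S) (v w : Pl K) :
    D.symbol v.asIdeal w.asIdeal = quadSym (D.elt v) w := by
  have hg : D.gen v.asIdeal = D.elt v := by
    rw [gen_eq_prod D (T := {v}) (fun u hu => by
      rw [ord_prime] at hu; simpa using hu)]
    simp [ord_prime]
  unfold SymbolChoices.symbol
  rw [hg, finprod_eq_prod_of_mulSupport_subset (s := {w})]
  · simp [ord_prime]
  · intro u hu
    by_contra h
    apply hu
    have : u ≠ w := by simpa using h
    simp [ord_prime, this]

open Classical in
theorem cross_eq_prod (D : SymbolChoices K S) {I J : Ideal (𝓞 K)} {T : Finset (Pl K)}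
    (hI : ∀ v, ord v I ≠ 0 → v ∈ T) (hJ : ∀ v, ord v J ≠ 0 → v ∈ T) :
    cross D I J = ∏ v ∈ T, ∏ w ∈ T, if v = w then (1 : ℂ) else
      (D.symbol v.asIdeal w.asIdeal : ℂ) ^ (ord v I * ord w J) := by
  unfold cross
  rw [finprod_eq_prod_of_mulSupport_subset (s := T)]
  · refine Finset.prod_congr rfl fun v _ => ?_
    rw [finprod_eq_prod_of_mulSupport_subset (s := T)]
    · intro w hw
      refine hJ w fun h => hw ?_
      simp [h]
  · intro v hv
    refine hI v fun h => hv ?_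
    simp [h]

/-- For coprime ideals `I`, `J` prime to `S`, `(I / J)` is the product of the symbols of the primes
in `I` and `J`. -/
theorem cross_eq_symbol (D : SymbolChoices K S) {I J : Ideal (𝓞 K)} (hI0 : I ≠ ⊥) (hJ0 : J ≠ ⊥)
    (hI : ∀ v ∈ S, ord v I = 0) (hJ : ∀ v ∈ S, ord v J = 0)
    (hIJ : ∀ v, ord v I = 0 ∨ ord v J = 0) :
    cross D I J = (D.symbol I J : ℂ) := by
  classical
  let T : Finset (Pl K) := (ord_finite hI0).toFinset ∪ (ord_finite hJ0).toFinset
  have hTI : ∀ v, ord v I ≠ 0 → v ∈ T := fun v hv => by simp [T, hv]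
  have hTJ : ∀ v, ord v J ≠ 0 → v ∈ T := fun v hv => by simp [T, hv]
  rw [cross_eq_prod D hTI hTJ, Finset.prod_comm]
  unfold SymbolChoices.symbol
  rw [finprod_eq_prod_of_mulSupport_subset (s := T)]
  · push_cast
    refine Finset.prod_congr rfl fun w _ => ?_
    by_cases hw : ord w J = 0
    · simp [hw]
    have hwI : ord w I = 0 := (hIJ w).resolve_right hw
    have hwS : w ∉ S := fun h => hw (hJ w h)
    have hev : ∀ v ∈ T, EvenAt w (D.elt v ^ ord v I) := by
      intro v _
      by_cases hv : ord v I = 0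
      · rw [hv, pow_zero]; exact evenAt_one w
      · have hvS : v ∉ S := fun h => hv (hI v h)
        have hwv : w ≠ v := fun h => hv (h ▸ hwI)
        exact (quadSym_pow (D.evenAt_elt hvS hwS hwv) _).1
    rw [gen_eq_prod D hTI, (quadSym_prod T _ hev).2]
    push_cast
    rw [← Finset.prod_pow]
    refine Finset.prod_congr rfl fun v _ => ?_
    by_cases hv : ord v I = 0
    · simp [hv, quadSym_one]
    · have hvS : v ∉ S := fun h => hv (hI v h)
      have hwv : w ≠ v := fun h => hv (h ▸ hwI)
      rw [if_neg hwv.symm, (quadSym_pow (D.evenAt_elt hvS hwS hwv) _).2, ← symbol_prime, pow_mul]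
      push_cast
      rfl
  · intro w hw
    refine hTJ w fun h => hw ?_
    simp [h]

theorem cross_mul (D : SymbolChoices K S) {I J I' J' : Ideal (𝓞 K)} (hI : I ≠ ⊥) (hJ : J ≠ ⊥)
    (hI' : I' ≠ ⊥) (hJ' : J' ≠ ⊥) :
    cross D (I * I') (J * J') =
      cross D I J * cross D I' J' * (cross D I J' * cross D I' J) := by
  classical
  let T : Finset (Pl K) := (ord_finite hI).toFinset ∪ (ord_finite hJ).toFinset ∪
    ((ord_finite hI').toFinset ∪ (ord_finite hJ').toFinset)
  have h1 : ∀ v, ord v I ≠ 0 → v ∈ T := fun v hv => by simp [T, hv]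
  have h2 : ∀ v, ord v J ≠ 0 → v ∈ T := fun v hv => by simp [T, hv]
  have h3 : ∀ v, ord v I' ≠ 0 → v ∈ T := fun v hv => by simp [T, hv]
  have h4 : ∀ v, ord v J' ≠ 0 → v ∈ T := fun v hv => by simp [T, hv]
  have h5 : ∀ v, ord v (I * I') ≠ 0 → v ∈ T := fun v hv => by
    rw [ord_mul v hI hI'] at hv
    by_cases h : ord v I = 0
    · exact h3 v (by omega)
    · exact h1 v h
  have h6 : ∀ v, ord v (J * J') ≠ 0 → v ∈ T := fun v hv => by
    rw [ord_mul v hJ hJ'] at hv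
    by_cases h : ord v J = 0
    · exact h4 v (by omega)
    · exact h2 v h
  rw [cross_eq_prod D h5 h6, cross_eq_prod D h1 h2, cross_eq_prod D h3 h4, cross_eq_prod D h1 h4,
    cross_eq_prod D h3 h2]
  simp only [← Finset.prod_mul_distrib]
  refine Finset.prod_congr rfl fun v _ => Finset.prod_congr rfl fun w _ => ?_
  rw [ord_mul v hI hI', ord_mul w hJ hJ']
  split_ifs
  · simp
  · simp only [← pow_add]
    congr 1
    ring

theorem ord_coprime {r : ℕ} {I I' : Fin r → IntegralIdeals S}
    (h : IsCoprime (∏ i, (I i : Ideal (𝓞 K))) (∏ i, (I' i : Ideal (𝓞 K)))) (v : Pl K)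
    (i j : Fin r) : ord v (I i : Ideal (𝓞 K)) = 0 ∨ ord v (I' j : Ideal (𝓞 K)) = 0 := by
  by_contra! hc
  have h1 := ((ord_ne_zero_iff v).1 hc.1).trans
    (Finset.dvd_prod_of_mem (fun i => (I i : Ideal (𝓞 K))) (Finset.mem_univ i))
  have h2 := ((ord_ne_zero_iff v).1 hc.2).trans
    (Finset.dvd_prod_of_mem (fun i => (I' i : Ideal (𝓞 K))) (Finset.mem_univ j))
  exact v.prime.not_isUnit (h.isUnit_of_dvd' h1 h2)

theorem ord_of_mem (I : IntegralIdeals S) : ∀ v ∈ S, ord v (I : Ideal (𝓞 K)) = 0 := by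
  intro v hv
  by_contra h
  exact I.2.2 v hv ((ord_ne_zero_iff v).1 h)

open Classical in
/-- The twisted multiplicativity of the coefficients. -/
theorem H_mul (b : P.Base) {r : ℕ} (e : Fin r ≃ b.support) (D : SymbolChoices K S)
    (I I' : Fin r → IntegralIdeals S)
    (h : IsCoprime (∏ i, (I i : Ideal (𝓞 K))) (∏ i, (I' i : Ideal (𝓞 K)))) :
    H b e D (fun i => (I i : Ideal (𝓞 K)) * (I' i : Ideal (𝓞 K))) =
      H b e D (fun i => (I i : Ideal (𝓞 K))) * H b e D (fun i => (I' i : Ideal (𝓞 K))) *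
        ∏ i, ∏ j, if i < j ∧ Adj b e i j then
          (D.symbol (I i : Ideal (𝓞 K)) (I' j : Ideal (𝓞 K)) : ℂ) *
            (D.symbol (I' i : Ideal (𝓞 K)) (I j : Ideal (𝓞 K)) : ℂ)
        else 1 := by
  have hI : ∀ i, (I i : Ideal (𝓞 K)) ≠ ⊥ := fun i => (I i).2.1
  have hI' : ∀ i, (I' i : Ideal (𝓞 K)) ≠ ⊥ := fun i => (I' i).2.1
  have hfin : ∀ I : Fin r → Ideal (𝓞 K), (∀ i, I i ≠ ⊥) →
      {v : Pl K | ∃ i, ord v (I i) ≠ 0}.Finite := by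
    intro I hI
    rw [Set.ofPred_exists]
    exact Set.finite_iUnion fun i => ord_finite (hI i)
  unfold H
  have hA : (∏ᶠ (v : Pl K) (_ : ∃ i, ord v ((I i : Ideal (𝓞 K)) * (I' i : Ideal (𝓞 K))) ≠ 0),
      coeff b e (nrm v.asIdeal) fun i => ord v ((I i : Ideal (𝓞 K)) * (I' i : Ideal (𝓞 K)))) =
      (∏ᶠ (v : Pl K) (_ : ∃ i, ord v (I i : Ideal (𝓞 K)) ≠ 0),
        coeff b e (nrm v.asIdeal) fun i => ord v (I i : Ideal (𝓞 K))) *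
      (∏ᶠ (v : Pl K) (_ : ∃ i, ord v (I' i : Ideal (𝓞 K)) ≠ 0),
        coeff b e (nrm v.asIdeal) fun i => ord v (I' i : Ideal (𝓞 K))) := by
    rw [← finprod_mul_distrib]
    · refine finprod_congr fun v => ?_
      simp only [ord_mul v (hI _) (hI' _)]
      by_cases h1 : ∃ i, ord v (I i : Ideal (𝓞 K)) ≠ 0
      · have h2 : ∀ j, ord v (I' j : Ideal (𝓞 K)) = 0 := by
          obtain ⟨i, hi⟩ := h1
          exact fun j => (ord_coprime h v i j).resolve_left hi
        simp [h2]
      · push Not at h1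
        simp [h1]
    · refine (hfin _ hI).subset fun v hv => ?_
      by_contra hc
      exact hv (by dsimp only; rw [finprod_eq_if, if_neg (by exact hc)])
    · refine (hfin _ hI').subset fun v hv => ?_
      by_contra hc
      exact hv (by dsimp only; rw [finprod_eq_if, if_neg (by exact hc)])
  rw [hA]
  have hB : (∏ i, ∏ j, if i < j ∧ Adj b e i j then
      cross D ((I i : Ideal (𝓞 K)) * (I' i : Ideal (𝓞 K)))
        ((I j : Ideal (𝓞 K)) * (I' j : Ideal (𝓞 K))) else 1) =
      (∏ i, ∏ j, if i < j ∧ Adj b e i j then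
        cross D (I i : Ideal (𝓞 K)) (I j : Ideal (𝓞 K)) else 1) *
      (∏ i, ∏ j, if i < j ∧ Adj b e i j then
        cross D (I' i : Ideal (𝓞 K)) (I' j : Ideal (𝓞 K)) else 1) *
      ∏ i, ∏ j, if i < j ∧ Adj b e i j then
          (D.symbol (I i : Ideal (𝓞 K)) (I' j : Ideal (𝓞 K)) : ℂ) *
            (D.symbol (I' i : Ideal (𝓞 K)) (I j : Ideal (𝓞 K)) : ℂ)
        else 1 := by
    simp only [← Finset.prod_mul_distrib]
    refine Finset.prod_congr rfl fun i _ => Finset.prod_congr rfl fun j _ => ?_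
    split_ifs
    · rw [cross_mul D (hI i) (hI j) (hI' i) (hI' j),
        cross_eq_symbol D (hI i) (hI' j) (ord_of_mem _) (ord_of_mem _)
          (fun v => ord_coprime h v i j),
        cross_eq_symbol D (hI' i) (hI j) (ord_of_mem _) (ord_of_mem _)
          (fun v => (ord_coprime h v j i).symm)]
    · simp
  rw [hB]
  ring

/-- The coefficients at the powers of a prime. -/
theorem H_primePow (b : P.Base) {r : ℕ} (e : Fin r ≃ b.support) (D : SymbolChoices K S)
    (v : Pl K) (k : Fin r → ℕ) (hk : k ≠ 0) :
    H b e D (fun i => v.asIdeal ^ k i) = coeff b e (nrm v.asIdeal) k := by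
  classical
  have hord : ∀ (w : Pl K) (n : ℕ), ord w (v.asIdeal ^ n) = if w = v then n else 0 := by
    intro w n
    induction n with
    | zero =>
      rw [pow_zero]
      by_contra h
      have : ord w (1 : Ideal (𝓞 K)) ≠ 0 := by simpa using h
      exact w.prime.not_isUnit (isUnit_of_dvd_one ((ord_ne_zero_iff w).1 this))
    | succ n ih =>
      rw [pow_succ, ord_mul w (pow_ne_zero _ v.ne_bot) v.ne_bot, ih, ord_prime]
      split_ifs <;> rfl
  unfold H
  have h2 : ∀ m n : ℕ, cross D (v.asIdeal ^ m) (v.asIdeal ^ n) = 1 := by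
    intro m n
    unfold cross
    refine (finprod_congr fun u => (finprod_congr fun w => ?_).trans finprod_one).trans finprod_one
    rw [hord, hord]
    split_ifs <;> simp_all
  simp only [h2, ite_self, Finset.prod_const_one, mul_one]
  obtain ⟨i₀, hi₀⟩ : ∃ i, k i ≠ 0 := by
    by_contra! h
    exact hk (funext h)
  rw [finprod_eq_prod_of_mulSupport_subset (s := {v})]
  · rw [Finset.prod_singleton, finprod_eq_if, if_pos ⟨i₀, by simpa [hord] using hi₀⟩]
    simp [hord]
  · intro w hw
    by_contra h
    have hwv : w ≠ v := by simpa using h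
    exact hw (by dsimp only; rw [finprod_eq_if, if_neg (by simp [hord, hwv])])

theorem IsOneMod.mul {m n : Kˣ} (hm : IsOneMod S m) (hn : IsOneMod S n) : IsOneMod S (m * n) := by
  refine ⟨fun v hv => ?_, fun τ => ?_⟩
  · have hn1 : v.valuation K (n : K) = 1 := by
      simpa using Valuation.map_one_add_of_lt (v.valuation K) (hn.1 v hv).2
    have : ((m * n : Kˣ) : K) - 1 = ((m : K) - 1) * n + ((n : K) - 1) := by push_cast; ring
    rw [this]
    constructor
    · refine Valuation.map_add_le _ ?_ (hn.1 v hv).1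
      rw [map_mul, hn1, mul_one]
      exact (hm.1 v hv).1
    · refine Valuation.map_add_lt _ ?_ (hn.1 v hv).2
      rw [map_mul, hn1, mul_one]
      exact (hm.1 v hv).2
  · rw [Units.val_mul, map_mul]
    exact mul_pos (hm.2 τ) (hn.2 τ)

theorem IsOneMod.inv {m : Kˣ} (hm : IsOneMod S m) : IsOneMod S m⁻¹ := by
  refine ⟨fun v hv => ?_, fun τ => ?_⟩
  · have hm1 : v.valuation K (m : K) = 1 := by
      simpa using Valuation.map_one_add_of_lt (v.valuation K) (hm.1 v hv).2
    have hm0 : (m : K) ≠ 0 := m.ne_zero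
    have : ((m⁻¹ : Kˣ) : K) - 1 = -((m : K) - 1) / m := by
      rw [Units.val_inv_eq_inv_val]; field_simp; ring
    rw [this, map_div₀, Valuation.map_neg, hm1, div_one]
    exact hm.1 v hv
  · rw [Units.val_inv_eq_inv_val, map_inv₀]
    exact inv_pos.2 (hm.2 τ)

theorem isOneMod_one : IsOneMod S (1 : Kˣ) :=
  ⟨fun v _ => by simp, fun τ => by simp⟩

theorem group_aux₁ {Γ : Type*} [CommGroup Γ] (A B X Y Z W : Γ) (n : ℕ) :
    (Y * A * Z ^ 2) ^ n * (X * B * W ^ 2) = (Y ^ n * X) * (A ^ n * B) * (Z ^ n * W) ^ 2 := by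
  rw [mul_pow, mul_pow, mul_pow, ← pow_mul, ← pow_mul, mul_comm 2,
    mul_mul_mul_comm (Y ^ n * A ^ n), mul_mul_mul_comm (Y ^ n)]

theorem group_aux₂ {Γ : Type*} [CommGroup Γ] (A X Y : Γ) : A = X * A * Y * (X⁻¹ * Y⁻¹) := by
  rw [mul_comm X A, mul_assoc A, mul_assoc, ← mul_inv, mul_inv_cancel, mul_one]

theorem coprimeTo_iff {I : FracIdeals K} : CoprimeTo S I ↔ ∀ v ∈ S, countHom v I = 1 := Iff.rfl

theorem mk0_eq_prod (I : Ideal (𝓞 K)) (hI : I ≠ ⊥) {T : Finset (Pl K)}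
    (hT : ∀ v, ord v I ≠ 0 → v ∈ T) :
    FractionalIdeal.mk0 K ⟨I, mem_nonZeroDivisors_of_ne_zero hI⟩ =
      ∏ v ∈ T, primeFrac v ^ ord v I := by
  have h := Ideal.finprod_heightOneSpectrum_factorization (R := 𝓞 K) hI
  rw [finprod_eq_prod_of_mulSupport_subset (s := T)] at h
  · apply Units.ext
    rw [Units.coe_prod, FractionalIdeal.coe_mk0]
    dsimp only
    conv_lhs => rw [← h]
    rw [← FractionalIdeal.coeIdealHom_apply, map_prod]
    refine Finset.prod_congr rfl fun v _ => ?_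
    rw [HeightOneSpectrum.maxPowDividing_eq_pow_multiplicity hI, map_pow]
    rfl
  · intro v hv
    refine hT v fun h0 => hv ?_
    dsimp only
    rw [HeightOneSpectrum.maxPowDividing_eq_pow_multiplicity hI]
    change v.asIdeal ^ ord v I = 1
    rw [h0, pow_zero]

namespace SymbolChoices

/-- For `I` prime to `S` there is a decomposition `I = (m) E G²`, with `m ≡ 1 mod C`, `E ∈ 𝓔` and
`G ∈ 𝓙(S)`, such that `gen I` is `m m_E` up to a square. -/
theorem exists_decomp_gen (D : SymbolChoices K S) (I : IntegralIdeals S) :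
    ∃ (m : Kˣ) (k : Fin D.n → ℤ) (G : FracIdeals K) (t : Kˣ), k ∈ D.reps ∧
      IsDecomp S (FractionalIdeal.mk0 K ⟨(I : Ideal (𝓞 K)), mem_nonZeroDivisors_of_ne_zero I.2.1⟩)
        m (∏ i, D.E₀ i ^ k i) G ∧
      D.gen (I : Ideal (𝓞 K)) = m * (∏ i, D.m₀ i ^ k i) * t ^ 2 := by
  classical
  let T : Finset (Pl K) := (ord_finite I.2.1).toFinset
  have hT : ∀ v, ord v (I : Ideal (𝓞 K)) ≠ 0 → v ∈ T := fun v hv => by simpa [T] using hv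
  have hTS : ∀ v ∈ T, v ∉ S := fun v hv h => by
    have : ord v (I : Ideal (𝓞 K)) ≠ 0 := by simpa [T] using hv
    exact this (ord_of_mem I v h)
  set J : FracIdeals K :=
    FractionalIdeal.mk0 K ⟨(I : Ideal (𝓞 K)), mem_nonZeroDivisors_of_ne_zero I.2.1⟩ with hJ
  -- a decomposition of `I` with `E` outside the chosen set of representatives
  obtain ⟨m, k', G, hm, hG, hdec, hgen⟩ : ∃ (m : Kˣ) (k' : Fin D.n → ℤ) (G : FracIdeals K),
      IsOneMod S m ∧ CoprimeTo S G ∧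
      J = toPrincipalIdeal (𝓞 K) K m * (∏ i, D.E₀ i ^ k' i) * G ^ 2 ∧
      D.gen (I : Ideal (𝓞 K)) = m * ∏ i, D.m₀ i ^ k' i := by
    rw [hJ, mk0_eq_prod _ I.2.1 hT, gen_eq_prod D hT]
    clear_value T
    clear hT
    induction T using Finset.induction_on with
    | empty => exact ⟨1, 0, 1, isOneMod_one, fun v _ => by rw [Units.val_one, FractionalIdeal.count_one], by simp, by simp⟩
    | insert v T hv ih =>
      obtain ⟨m, k', G, hm, hG, h1, h2⟩ := ih fun w hw => hTS w (Finset.mem_insert_of_mem hw)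
      have hd := D.dec_spec v (hTS v (Finset.mem_insert_self _ _))
      have hpow : ∀ n : ℕ, IsOneMod S (D.decM v ^ n) := by
        intro n
        induction n with
        | zero => rw [pow_zero]; exact isOneMod_one
        | succ n ih => rw [pow_succ]; exact ih.mul hd.1
      refine ⟨D.decM v ^ ord v (I : Ideal (𝓞 K)) * m,
        fun i => D.decE v i * ord v (I : Ideal (𝓞 K)) + k' i,
        D.decG v ^ ord v (I : Ideal (𝓞 K)) * G, (hpow _).mul hm, ?_, ?_, ?_⟩
      · rw [coprimeTo_iff] at hG ⊢
        intro w hw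
        rw [map_mul, map_pow, hG w hw, coprimeTo_iff.1 hd.2.1 w hw, one_pow, one_mul]
      · rw [Finset.prod_insert hv, h1]
        conv_lhs => rw [hd.2.2]
        have hE : (∏ i, D.E₀ i ^ (D.decE v i * ord v (I : Ideal (𝓞 K)) + k' i)) =
            (∏ i, D.E₀ i ^ D.decE v i) ^ ord v (I : Ideal (𝓞 K)) * ∏ i, D.E₀ i ^ k' i := by
          simp only [zpow_add, zpow_mul, zpow_natCast, Finset.prod_mul_distrib, Finset.prod_pow]
        rw [hE, map_mul, map_pow]
        exact group_aux₁ _ _ _ _ _ _ _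
      · rw [Finset.prod_insert hv, h2, elt]
        simp only [zpow_add, zpow_mul, zpow_natCast, Finset.prod_mul_distrib, Finset.prod_pow,
          mul_pow]
        ac_rfl
  have hJS : CoprimeTo S J := by
    rw [coprimeTo_iff]
    intro v hv
    rw [hJ, mk0_eq_prod _ I.2.1 hT, map_prod]
    refine Finset.prod_eq_one fun w hw => ?_
    have hvw : w ≠ v := fun h => hTS w hw (h ▸ hv)
    rw [map_pow]
    have : countHom v (primeFrac w) = 1 := by
      change Multiplicative.ofAdd (FractionalIdeal.count K v
        ((primeFrac w : FracIdeals K) : FractionalIdeal (𝓞 K)⁰ K)) = _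
      rw [primeFrac, FractionalIdeal.coe_mk0, FractionalIdeal.count_maximal_coprime K v hvw]
      rfl
    rw [this, one_pow]
  obtain ⟨k, ⟨hk, m₁, G₁, hm₁, hG₁, h₁⟩, -⟩ := D.reps_spec J hJS
  have heven : ∀ i, Even (k' i - k i) := by
    refine (D.E₀_indep fun i => k' i - k i).1 ⟨m₁ * m⁻¹, G₁ * G⁻¹, hm₁.mul hm.inv, ?_, ?_⟩
    · rw [coprimeTo_iff] at *
      intro v hv
      rw [map_mul, map_inv, hG v hv, hG₁ v hv]
      simp
    · have : toPrincipalIdeal (𝓞 K) K m * (∏ i, D.E₀ i ^ k' i) * G ^ 2 =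
          toPrincipalIdeal (𝓞 K) K m₁ * (∏ i, D.E₀ i ^ k i) * G₁ ^ 2 := hdec.symm.trans h₁
      simp only [zpow_sub, Finset.prod_mul_distrib, Finset.prod_inv_distrib, map_mul, map_inv,
        mul_one, mul_pow, inv_pow]
      rw [mul_inv_eq_iff_eq_mul]
      have h2 : (∏ i, D.E₀ i ^ k' i) = (toPrincipalIdeal (𝓞 K) K m₁ * (∏ i, D.E₀ i ^ k i) * G₁ ^ 2) *
          ((toPrincipalIdeal (𝓞 K) K m)⁻¹ * (G ^ 2)⁻¹) := by
        rw [← this]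
        exact group_aux₂ _ _ _
      rw [h2]
      ac_rfl
  choose l hl using heven
  refine ⟨m, k, (∏ i, D.E₀ i ^ l i) * G, ∏ i, D.m₀ i ^ l i, hk, ⟨hm, ?_, ?_⟩, ?_⟩
  · rw [coprimeTo_iff] at *
    intro v hv
    rw [map_mul, hG v hv, mul_one, map_prod]
    refine Finset.prod_eq_one fun i _ => ?_
    rw [map_zpow, coprimeTo_iff.1 (D.E₀_coprime i) v hv, one_zpow]
  · have : ∀ i, k' i = k i + (l i + l i) := fun i => by have := hl i; omega
    rw [hdec]
    simp only [this, zpow_add, Finset.prod_mul_distrib, pow_two]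
    ac_rfl
  · have : ∀ i, k' i = k i + (l i + l i) := fun i => by have := hl i; omega
    rw [hgen]
    simp only [this, zpow_add, Finset.prod_mul_distrib, pow_two]
    ac_rfl

end SymbolChoices

end Arithmetic

end QuadWMDS

end

set_option linter.unusedSectionVars false

noncomputable section

namespace QuadWMDS

/-! ### Descents, inversions and the exchange property in the Weyl group. -/

section WeylGroup

variable {ι V V' : Type*} [Finite ι] [AddCommGroup V] [Module ℝ V] [AddCommGroup V'] [Module ℝ V']
  {P : RootPairing ι ℝ V V'} [P.IsCrystallographic] [P.IsReduced] (b : P.Base) {r : ℕ}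
  (e : Fin r ≃ b.support)

/-! The Dirichlet series factors into local series over the primes, and each local series is a
one-variable section of the power series of `f(x; q)` with `q = |P|`. Everything rests on a
functional equation and a bound uniform in `q` for these sections.

Local theory. In the variables `z_j = √q x_j` the substitution `σ_i` acts on monomials as the simple
reflection acts on the root lattice, and `Δ` becomes the product of the `1 - z^{2α}`. The slash
operators satisfy the Coxeter relations (`slashEnd_sq`, `slashEnd_comm`, `slashEnd_braid`), and the
Weyl group is presented by these relations (`exists_hom`), so they define an action of `W`. Since
`Δ` is even in each variable, `f` is the sum of `(1 / Δ) | w` over `w`, hence invariant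
(`invFunc_eq`, `slashEnd_invFunc`). Induction on the length of `w` (`exists_numerator`,
`exists_invFunc_eq`) writes `f` as a polynomial over the product of the `(1 - z^{2α})(1 - z^{2α} /
q)`, where the numerator has constant term `1` and coefficient sum bounded in terms of the root
system alone.

Invariance under `σ_i` gives a functional equation between rational functions, which must be
converted into one for power series coefficients. A coefficient function and its reflection satisfy
the same recursion. Their difference vanishes because it would otherwise grow geometrically in a
direction in which it is eventually zero, or be periodic with incompatible parity (`eq_reflF`). The
outcome (`exists_lattice_coeff`, `exists_localPoly`) is this: with the exponents `k_j`, `j ≠ i`,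
fixed and `m` the sum of the adjacent ones, the generating function in `x_i` is a polynomial `F`,
divided by `1 - x_i` if `m` is even, and `F(x) = (√q x)^{2⌊m/2⌋} F(1 / (q x))`.

Global theory. All neighbours of `j₀` precede it, so the variable ideal `J` occurs only as lower
argument of residue symbols, and the terms are products over primes (`dirichletTerm_eq_prod`). At a
prime `v` the argument of the generating function is `|P|^{-s}` times a sign. If `ord_v M` is even,
this sign is `ψ χ_M` and the pole `1 / (1 - x)` is the Euler factor of `L(s, ψ χ_M)`; if it is odd,
`χ_M` ramifies, the Euler factor is `1`, and there is no pole. The remaining polynomials are `1`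
away from `N` and form `Q` (`hasSum_dirichlet`). Their functional equations multiply to that of `Q`,
because `ord_v (M₁ M₂) = ⌊ord_v M / 2⌋` (`localFactor_functional`). At each prime of `N` the
constants independent of `q` are absorbed into a power of `|P|^{ord_v N}`
(`norm_localFactor_eval_le`), which gives the bound by a power of `|N|`. -/

theorem weylGroupToPerm_ofIdx (i : ι) :
    P.weylGroupToPerm (RootPairing.weylGroup.ofIdx P i) = P.reflectionPerm i := by
  change RootPairing.Equiv.indexHom P (RootPairing.Equiv.reflection P i) = _
  simp only [RootPairing.Equiv.indexHom_apply, RootPairing.Equiv.reflection_indexEquiv]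

theorem ofIdx_mul_self (i : ι) :
    RootPairing.weylGroup.ofIdx P i * RootPairing.weylGroup.ofIdx P i = 1 := by
  apply Subtype.ext
  change RootPairing.Equiv.reflection P i * RootPairing.Equiv.reflection P i = 1
  rw [mul_eq_one_iff_inv_eq, RootPairing.Equiv.reflection_inv P i]

theorem ofIdx_reflectionPerm (i j : ι) :
    RootPairing.weylGroup.ofIdx P (P.reflectionPerm j i) =
      RootPairing.weylGroup.ofIdx P j * RootPairing.weylGroup.ofIdx P i *
        RootPairing.weylGroup.ofIdx P j := by
  apply Subtype.ext
  apply RootPairing.Equiv.weightHom_injective P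
  change RootPairing.Equiv.weightHom P (RootPairing.Equiv.reflection P (P.reflectionPerm j i)) =
    RootPairing.Equiv.weightHom P (RootPairing.Equiv.reflection P j *
      RootPairing.Equiv.reflection P i * RootPairing.Equiv.reflection P j)
  rw [map_mul, map_mul]
  change (RootPairing.Equiv.reflection P (P.reflectionPerm j i)).weightEquiv =
    (RootPairing.Equiv.reflection P j).weightEquiv *
      (RootPairing.Equiv.reflection P i).weightEquiv *
        (RootPairing.Equiv.reflection P j).weightEquiv
  simp only [RootPairing.Equiv.reflection_weightEquiv]
  exact P.reflection_reflectionPerm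

theorem simpleReflection_mul_self (i : Fin r) :
    simpleReflection b e i * simpleReflection b e i = 1 := ofIdx_mul_self _

theorem simpleReflection_inv (i : Fin r) :
    (simpleReflection b e i)⁻¹ = simpleReflection b e i :=
  inv_eq_of_mul_eq_one_left (simpleReflection_mul_self b e i)

theorem simpleReflection_perm (i : Fin r) :
    P.weylGroupToPerm (simpleReflection b e i) = P.reflectionPerm (e i) :=
  weylGroupToPerm_ofIdx _

/-- A Weyl group element is determined by its action on weights, and the roots span. Finiteness of
the group, needed for the sum that defines `invFunc₀`, follows. -/
theorem weylGroupToPerm_injective [P.IsRootSystem] : Function.Injective P.weylGroupToPerm := by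
  intro x y h
  apply Subtype.ext
  apply RootPairing.Equiv.weightHom_injective P
  apply LinearEquiv.toLinearMap_injective
  refine LinearMap.ext_on_range (RootPairing.IsRootSystem.span_root_eq_top (P := P)) fun i => ?_
  have h1 := P.weylGroup_apply_root x i
  have h2 := P.weylGroup_apply_root y i
  rw [h, ← h2] at h1
  exact h1

theorem finite_weylGroup [P.IsRootSystem] : Finite P.weylGroup :=
  Finite.of_injective _ (weylGroupToPerm_injective (P := P))

/-- The index `P.reflectionPerm i i` is that of the negative root, so this is `w (-α) = -(w α)`,
read off on heights. Signs of roots are tested throughout by the sign of the height. -/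
theorem isPos_neg_of_perm (w : P.weylGroup) (i : ι) :
    b.height (P.weylGroupToPerm w (P.reflectionPerm i i)) =
      - b.height (P.weylGroupToPerm w i) := by
  have h : P.root (P.weylGroupToPerm w (P.reflectionPerm i i)) =
      P.root (P.reflectionPerm (P.weylGroupToPerm w i) (P.weylGroupToPerm w i)) := by
    rw [← P.weylGroup_apply_root, P.root_reflectionPerm, P.reflection_apply_self,
      P.root_reflectionPerm, P.reflection_apply_self, smul_neg, P.weylGroup_apply_root]
  rw [P.root.injective h]
  exact b.height_reflectionPerm_self _

theorem isPos_simple (i : Fin r) : b.IsPos (e i) := b.isPos_of_mem_support (e i).2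

theorem isPos_simpleReflection {i : Fin r} {α : ι} (hα : b.IsPos α) (h : α ≠ e i) :
    b.IsPos (P.reflectionPerm (e i) α) :=
  hα.reflectionPerm (e i).2 h

/-- `i` is a left descent of `w`: the root `w⁻¹ αᵢ` is negative. -/
def Descent (w : P.weylGroup) (i : Fin r) : Prop := b.height (P.weylGroupToPerm w⁻¹ (e i)) < 0

/-- The positive roots `α` for which `w⁻¹ α` is negative. -/
def inversions (w : P.weylGroup) : Set ι :=
  {α | b.IsPos α ∧ b.height (P.weylGroupToPerm w⁻¹ α) < 0}

theorem perm_inv_simpleReflection_mul (w : P.weylGroup) (i : Fin r) (α : ι) :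
    P.weylGroupToPerm (simpleReflection b e i * w)⁻¹ α =
      P.weylGroupToPerm w⁻¹ (P.reflectionPerm (e i) α) := by
  rw [mul_inv_rev, simpleReflection_inv, map_mul, Equiv.Perm.mul_apply, simpleReflection_perm]

/-- `(s_i w)⁻¹ α_i = w⁻¹ (s_i α_i) = -w⁻¹ α_i`, and the height of a root is never zero. -/
theorem descent_simpleReflection_mul (w : P.weylGroup) (i : Fin r) :
    Descent b e (simpleReflection b e i * w) i ↔ ¬ Descent b e w i := by
  unfold Descent
  rw [perm_inv_simpleReflection_mul, isPos_neg_of_perm]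
  have := b.height_ne_zero (P.weylGroupToPerm w⁻¹ (e i))
  constructor
  · intro h; omega
  · intro h; omega

/-- `s_i` permutes the positive roots other than `α_i`, so it carries the inversions of `w` to
inversions of `s_i w`, and only `α_i` is new. The exponents of the numerators below are controlled
by this recursion. -/
theorem inversions_simpleReflection_mul {w : P.weylGroup} {i : Fin r} (h : ¬ Descent b e w i) :
    inversions b (simpleReflection b e i * w) =
      insert (e i : ι) (P.reflectionPerm (e i) '' inversions b w) := by
  ext α
  have hinv : P.reflectionPerm (e i) (P.reflectionPerm (e i) α) = α := P.reflectionPerm_self _ _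
  constructor
  · rintro ⟨h1, h2⟩
    by_cases hα : α = e i
    · exact Or.inl hα
    · refine Or.inr ⟨P.reflectionPerm (e i) α, ⟨isPos_simpleReflection b e h1 hα, ?_⟩, hinv⟩
      rwa [perm_inv_simpleReflection_mul] at h2
  · rintro (rfl | ⟨β, ⟨h1, h2⟩, rfl⟩)
    · exact ⟨isPos_simple b e i, (descent_simpleReflection_mul b e w i).2 h⟩
    · refine ⟨isPos_simpleReflection b e h1 ?_, ?_⟩
      · rintro rfl
        exact h h2
      · rw [perm_inv_simpleReflection_mul, P.reflectionPerm_self]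
        exact h2

/-- The number of inversions of `w`. -/
def len (w : P.weylGroup) : ℕ := (inversions b w).ncard

theorem len_simpleReflection_mul {w : P.weylGroup} {i : Fin r} (h : ¬ Descent b e w i) :
    len b (simpleReflection b e i * w) = len b w + 1 := by
  unfold len
  rw [inversions_simpleReflection_mul b e h, Set.ncard_insert_of_notMem, Set.ncard_image_of_injective]
  · exact (P.reflectionPerm (e i)).injective
  -- `s_i β = α_i` forces `β = -α_i`, which is not positive.
  · rintro ⟨β, ⟨h1, h2⟩, h3⟩
    have hβ : β = P.reflectionPerm (e i) (e i) := by
      have h4 := congrArg (P.reflectionPerm (e i)) h3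
      rwa [P.reflectionPerm_self] at h4
    rw [RootPairing.Base.IsPos, hβ] at h1
    have := isPos_neg_of_perm b 1 (e i)
    simp only [map_one, Equiv.Perm.one_apply] at this
    rw [this] at h1
    have := isPos_simple b e i
    rw [RootPairing.Base.IsPos] at this
    omega

theorem len_of_descent {w : P.weylGroup} {i : Fin r} (h : Descent b e w i) :
    len b w = len b (simpleReflection b e i * w) + 1 := by
  have h1 : ¬ Descent b e (simpleReflection b e i * w) i := by
    rw [descent_simpleReflection_mul, not_not]; exact h
  have := len_simpleReflection_mul b e h1
  rwa [← mul_assoc, simpleReflection_mul_self, one_mul] at this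

/-- The exchange property. -/
theorem exchange (t : List (Fin r)) (β : ι) (hβ : b.IsPos β)
    (h : b.height (P.weylGroupToPerm ((t.map (simpleReflection b e)).prod)⁻¹ β) < 0) :
    ∃ t' : List (Fin r), t'.length + 1 = t.length ∧
      (t'.map (simpleReflection b e)).prod =
        RootPairing.weylGroup.ofIdx P β * (t.map (simpleReflection b e)).prod := by
  induction t generalizing β with
  | nil =>
    exfalso
    simp only [List.map_nil, List.prod_nil, inv_one, map_one, Equiv.Perm.one_apply] at h
    rw [RootPairing.Base.IsPos] at hβ
    omega
  | cons j u ih =>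
    rw [List.map_cons, List.prod_cons, perm_inv_simpleReflection_mul] at h
    -- If `β` is the simple root of the first letter, that letter cancels against the reflection in
    -- `β`.
    by_cases hj : β = e j
    · refine ⟨u, rfl, ?_⟩
      rw [List.map_cons, List.prod_cons, ← mul_assoc, hj]
      change _ = simpleReflection b e j * simpleReflection b e j * _
      rw [simpleReflection_mul_self, one_mul]
    -- Otherwise `s_j β` is positive and the tail makes it negative. Its reflection is `s_j s_β
    -- s_j`, so a letter is deleted from the tail and `j` is put back in front.
    · obtain ⟨u', h1, h2⟩ := ih _ (isPos_simpleReflection b e hβ hj) h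
      refine ⟨j :: u', by simpa using h1, ?_⟩
      rw [List.map_cons, List.prod_cons, h2, ofIdx_reflectionPerm]
      change simpleReflection b e j * (simpleReflection b e j * _ * simpleReflection b e j * _) = _
      rw [mul_assoc, ← mul_assoc (simpleReflection b e j), ← mul_assoc (simpleReflection b e j),
        simpleReflection_mul_self, one_mul, List.map_cons, List.prod_cons]

/-- If the first letter of a word is not a descent of its product, it is a descent of the product of
the tail. Exchange in the tail then writes the same product with two letters fewer, so the process
ends at the empty word or at a descent. -/
theorem exists_descent_word (n : ℕ) : ∀ l : List (Fin r), l.length = n →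
    (l.map (simpleReflection b e)).prod = 1 ∨
      ∃ i, Descent b e (l.map (simpleReflection b e)).prod i := by
  induction n using Nat.strong_induction_on with
  | _ n ih =>
    rintro (_ | ⟨i, t⟩) hl
    · simp
    by_cases h : Descent b e ((i :: t).map (simpleReflection b e)).prod i
    · exact Or.inr ⟨i, h⟩
    · rw [List.map_cons, List.prod_cons, descent_simpleReflection_mul, not_not] at h
      obtain ⟨t', h1, h2⟩ := exchange b e t (e i) (isPos_simple b e i) h
      rw [List.map_cons, List.prod_cons]
      change _ = simpleReflection b e i * _ at h2
      rw [← h2]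
      refine ih t'.length ?_ t' rfl
      simp only [List.length_cons] at hl
      omega

theorem exists_descent {w : P.weylGroup} (hw : w ≠ 1) : ∃ i, Descent b e w i := by
  obtain ⟨l, rfl⟩ := exists_word b e w
  exact (exists_descent_word b e _ l rfl).resolve_left hw

theorem not_descent_one (i : Fin r) : ¬ Descent b e (1 : P.weylGroup) i := by
  unfold Descent
  have := isPos_simple b e i
  rw [RootPairing.Base.IsPos] at this
  simp only [inv_one, map_one, Equiv.Perm.one_apply]
  omega

theorem descent_induction {p : P.weylGroup → Prop} (h1 : p 1)
    (hmul : ∀ i w, ¬ Descent b e w i → p w → p (simpleReflection b e i * w)) (w : P.weylGroup) :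
    p w := by
  induction hn : len b w using Nat.strong_induction_on generalizing w with
  | _ n ih =>
    by_cases hw : w = 1
    · rwa [hw]
    obtain ⟨i, hi⟩ := exists_descent b e hw
    have h2 : ¬ Descent b e (simpleReflection b e i * w) i := by
      rw [descent_simpleReflection_mul, not_not]; exact hi
    have := hmul i _ h2 (ih _ (by rw [← hn, len_of_descent b e hi]; omega) _ rfl)
    rwa [← mul_assoc, simpleReflection_mul_self, one_mul] at this

end WeylGroup

/-! ### Simply-laced Coxeter relations and the presentation of the Weyl group. -/

section SimplyLaced

variable {ι V V' : Type*} [Finite ι] [AddCommGroup V] [Module ℝ V] [AddCommGroup V'] [Module ℝ V']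
  {P : RootPairing ι ℝ V V'} [P.IsCrystallographic] [P.IsReduced] {b : P.Base} {r : ℕ}
  {e : Fin r ≃ b.support}

theorem root_reflectionPerm_simple (i : Fin r) (α : ι) :
    P.root (P.reflectionPerm (e i) α) = P.root α - P.pairingIn ℤ α (e i) • P.root (e i) := by
  rw [P.root_reflectionPerm, P.reflection_apply_root' ℤ]

theorem pairing_comm_of_zero {i j : Fin r} (h : P.pairingIn ℤ (e i) (e j) = 0) :
    P.pairingIn ℤ (e j) (e i) = 0 :=
  (b.cartanMatrix_apply_eq_zero_iff_symm (i := e i) (j := e j)).1 h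

theorem pairing_cases (hsl : b.cartanMatrix.IsSimplyLaced) {i j : Fin r} (hij : i ≠ j) :
    P.pairingIn ℤ (e i) (e j) = 0 ∨ P.pairingIn ℤ (e i) (e j) = -1 :=
  hsl (show e i ≠ e j from fun h => hij (e.injective h))

theorem reflectionPerm_of_pairing_zero {i j : Fin r} (h : P.pairingIn ℤ (e i) (e j) = 0) :
    P.reflectionPerm (e j) (e i) = e i := by
  apply P.root.injective
  rw [root_reflectionPerm_simple, h, zero_smul, sub_zero]

theorem commute_of_pairing_zero {i j : Fin r} (h : P.pairingIn ℤ (e i) (e j) = 0) :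
    simpleReflection b e i * simpleReflection b e j =
      simpleReflection b e j * simpleReflection b e i := by
  have h1 := ofIdx_reflectionPerm (P := P) (e i : ι) (e j : ι)
  rw [reflectionPerm_of_pairing_zero h] at h1
  change simpleReflection b e i = simpleReflection b e j * simpleReflection b e i *
    simpleReflection b e j at h1
  conv_lhs => rw [h1]
  rw [mul_assoc, simpleReflection_mul_self, mul_one]

theorem root_simple_add {i j : Fin r} (h : P.pairingIn ℤ (e i) (e j) = -1) :
    P.root (P.reflectionPerm (e j) (e i)) = P.root (e i) + P.root (e j) := by
  rw [root_reflectionPerm_simple, h, neg_smul, one_smul, sub_neg_eq_add]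

theorem braid_of_pairing {i j : Fin r} (h : P.pairingIn ℤ (e i) (e j) = -1)
    (h' : P.pairingIn ℤ (e j) (e i) = -1) :
    simpleReflection b e i * simpleReflection b e j * simpleReflection b e i =
      simpleReflection b e j * simpleReflection b e i * simpleReflection b e j := by
  have h1 : P.reflectionPerm (e j) (e i) = P.reflectionPerm (e i) (e j) := by
    apply P.root.injective
    rw [root_simple_add h, root_simple_add h', add_comm]
  have h2 := ofIdx_reflectionPerm (P := P) (e i : ι) (e j : ι)
  have h3 := ofIdx_reflectionPerm (P := P) (e j : ι) (e i : ι)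
  rw [h1, h3] at h2
  exact h2

/-- Here `s_j` fixes `α_i` and `s_i` negates it, so a trivial product would give `α_i = -α_i`. -/
theorem simpleReflection_ne {i j : Fin r} (h : P.pairingIn ℤ (e i) (e j) = 0) :
    simpleReflection b e i * simpleReflection b e j ≠ 1 := by
  intro hc
  have h1 := congrArg (fun w => P.weylGroupToPerm w (e i)) hc
  simp only [map_mul, Equiv.Perm.mul_apply, simpleReflection_perm, map_one,
    Equiv.Perm.one_apply, reflectionPerm_of_pairing_zero h] at h1
  have h2 := isPos_neg_of_perm b 1 (e i)
  simp only [map_one, Equiv.Perm.one_apply, h1] at h2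
  have := isPos_simple b e i
  rw [RootPairing.Base.IsPos] at this
  omega

/-- Distinct simple roots have pairing `0` or `-1`. For `0` the reflections commute, and the cube of
the product is the product itself, which is nontrivial. For `-1` the braid relation makes the cube
trivial. -/
theorem adj_iff (hsl : b.cartanMatrix.IsSimplyLaced) {i j : Fin r} :
    Adj b e i j ↔ i ≠ j ∧ P.pairingIn ℤ (e i) (e j) = -1 := by
  unfold Adj
  refine and_congr_right fun hij => ?_
  have hpow : (simpleReflection b e i * simpleReflection b e j) ^ 3 =
      (simpleReflection b e i * simpleReflection b e j * simpleReflection b e i) *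
        (simpleReflection b e j * simpleReflection b e i * simpleReflection b e j) := by
    simp only [pow_succ, pow_zero, one_mul, mul_assoc]
  rcases pairing_cases (e := e) hsl hij with h | h
  · rw [h]
    refine iff_of_false ?_ (by norm_num)
    have hc := commute_of_pairing_zero h
    rw [hpow]
    rw [hc, mul_assoc (simpleReflection b e j) (simpleReflection b e i) (simpleReflection b e i),
      simpleReflection_mul_self, mul_one, ← mul_assoc, ← mul_assoc, simpleReflection_mul_self,
      one_mul]
    exact simpleReflection_ne h
  · have h' : P.pairingIn ℤ (e j) (e i) = -1 := by
      rcases pairing_cases (e := e) hsl hij.symm with h' | h'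
      · rw [pairing_comm_of_zero h'] at h; norm_num at h
      · exact h'
    refine iff_of_true ?_ h
    rw [hpow, braid_of_pairing h h', mul_eq_one_iff_eq_inv]
    simp only [mul_inv_rev, simpleReflection_inv, mul_assoc]

theorem adj_symm (hsl : b.cartanMatrix.IsSimplyLaced) {i j : Fin r} (h : Adj b e i j) :
    Adj b e j i := by
  rw [adj_iff hsl] at h ⊢
  refine ⟨h.1.symm, ?_⟩
  rcases pairing_cases (e := e) hsl h.1.symm with h' | h'
  · rw [pairing_comm_of_zero h'] at h; norm_num at h
  · exact h'

theorem pairing_of_not_adj (hsl : b.cartanMatrix.IsSimplyLaced) {i j : Fin r} (hij : i ≠ j)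
    (h : ¬ Adj b e i j) : P.pairingIn ℤ (e i) (e j) = 0 :=
  (pairing_cases hsl hij).resolve_right fun h' => h ((adj_iff hsl).2 ⟨hij, h'⟩)

theorem height_simple_add {i j : Fin r} (h : P.pairingIn ℤ (e i) (e j) = -1) (w : P.weylGroup) :
    b.height (P.weylGroupToPerm w (P.reflectionPerm (e j) (e i))) =
      b.height (P.weylGroupToPerm w (e i)) + b.height (P.weylGroupToPerm w (e j)) := by
  apply b.height_add
  rw [← P.weylGroup_apply_root, root_simple_add h, smul_add, P.weylGroup_apply_root,
    P.weylGroup_apply_root]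

variable {M : Type*} [Monoid M]

/-- `U` is defined by recursion on the length along a chosen descent, and the content is
independence of the choice. Two descents `i`, `j` of `w` lead to a common shorter element, `s_i s_j
w` or, in the adjacent case, `s_i s_j s_i w`. There the induction hypothesis applies, and the
commutation or braid relation for `T` compares the two ways. -/
theorem exists_desc_fun (T : Fin r → M)
    (hcomm : ∀ i j, i ≠ j → ¬ Adj b e i j → T i * T j = T j * T i)
    (hbraid : ∀ i j, Adj b e i j → T i * T j * T i = T j * T i * T j)
    (hsl : b.cartanMatrix.IsSimplyLaced) :
    ∃ U : P.weylGroup → M, U 1 = 1 ∧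
      ∀ w i, Descent b e w i → U w = T i * U (simpleReflection b e i * w) := by
  classical
  have hwf : WellFounded fun w w' : P.weylGroup => len b w < len b w' :=
    InvImage.wf (len b) Nat.lt_wfRel.wf
  let U : P.weylGroup → M := hwf.fix fun w rec =>
    if h : ∃ i, Descent b e w i then
      T h.choose * rec (simpleReflection b e h.choose * w)
        (by rw [len_of_descent b e h.choose_spec]; omega)
    else 1
  have hU : ∀ w, U w = if h : ∃ i, Descent b e w i then
      T h.choose * U (simpleReflection b e h.choose * w) else 1 := fun w => hwf.fix_eq _ w
  have hone : U 1 = 1 := by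
    rw [hU, dif_neg]
    rintro ⟨i, hi⟩
    exact not_descent_one b e i hi
  refine ⟨U, hone, fun w => ?_⟩
  induction hn : len b w using Nat.strong_induction_on generalizing w with
  | _ n ih =>
    intro i hi
    have hex : ∃ i, Descent b e w i := ⟨i, hi⟩
    rw [hU w, dif_pos hex]
    obtain ⟨j, hj, hjd⟩ : ∃ j, hex.choose = j ∧ Descent b e w j := ⟨_, rfl, hex.choose_spec⟩
    rw [hj]
    by_cases hij : i = j
    · rw [hij]
    have hli := len_of_descent b e hi
    have hlj := len_of_descent b e hjd
    by_cases hadj : Adj b e i j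
    · have pij := ((adj_iff hsl).1 hadj).2
      have pji := ((adj_iff hsl).1 (adj_symm hsl hadj)).2
      -- removing two adjacent descents in either order
      have key : ∀ i j, Adj b e i j → Descent b e w i → Descent b e w j →
          len b (simpleReflection b e i * w) < n →
          U (simpleReflection b e i * w) = T j * (T i *
            U (simpleReflection b e i * (simpleReflection b e j * (simpleReflection b e i * w)))) := by
        intro i j hadj hi hj hl
        have pij := ((adj_iff hsl).1 hadj).2
        have pji := ((adj_iff hsl).1 (adj_symm hsl hadj)).2
        -- `w⁻¹ (α_i + α_j)` has negative height as a sum of two negative roots, so `j` remains a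
        -- descent after `s_i` is removed.
        have hsum := height_simple_add pji w⁻¹
        have d1 : Descent b e (simpleReflection b e i * w) j := by
          unfold Descent at *
          rw [perm_inv_simpleReflection_mul, hsum]
          omega
        have d2 : Descent b e (simpleReflection b e j * (simpleReflection b e i * w)) i := by
          unfold Descent at *
          rw [perm_inv_simpleReflection_mul, perm_inv_simpleReflection_mul]
          have : P.reflectionPerm (e i) (P.reflectionPerm (e j) (e i)) = e j := by
            apply P.root.injective
            rw [P.root_reflectionPerm, root_simple_add pij, map_add, P.reflection_apply_self,
              ← P.root_reflectionPerm, root_simple_add pji]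
            abel
          rw [this]
          exact hj
        have l1 := len_of_descent b e d1
        rw [ih _ hl _ rfl j d1, ih _ (by omega) _ rfl i d2]
      rw [key i j hadj hi hjd (by omega), key j i (adj_symm hsl hadj) hjd hi (by omega)]
      have hb : simpleReflection b e i * (simpleReflection b e j * (simpleReflection b e i * w)) =
          simpleReflection b e j * (simpleReflection b e i * (simpleReflection b e j * w)) := by
        have := congrArg (· * w) (braid_of_pairing pij pji)
        simpa only [mul_assoc] using this
      rw [hb]
      simp only [← mul_assoc]
      rw [hbraid i j hadj]
    · have pij := pairing_of_not_adj hsl hij hadj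
      have pji := pairing_comm_of_zero pij
      have d1 : Descent b e (simpleReflection b e i * w) j := by
        unfold Descent at *
        rw [perm_inv_simpleReflection_mul, reflectionPerm_of_pairing_zero pji]
        exact hjd
      have d2 : Descent b e (simpleReflection b e j * w) i := by
        unfold Descent at *
        rw [perm_inv_simpleReflection_mul, reflectionPerm_of_pairing_zero pij]
        exact hi
      have hc : simpleReflection b e i * (simpleReflection b e j * w) =
          simpleReflection b e j * (simpleReflection b e i * w) := by
        rw [← mul_assoc, commute_of_pairing_zero pij, mul_assoc]
      rw [ih _ (by omega) _ rfl j d1, ih _ (by omega) _ rfl i d2, hc, ← mul_assoc (T j),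
        ← mul_assoc (T i), hcomm i j hij hadj]

/-- A simply-laced Weyl group is presented by its simple reflections and the braid relations. -/
theorem exists_hom (T : Fin r → M) (hT : ∀ i, T i * T i = 1)
    (hcomm : ∀ i j, i ≠ j → ¬ Adj b e i j → T i * T j = T j * T i)
    (hbraid : ∀ i j, Adj b e i j → T i * T j * T i = T j * T i * T j)
    (hsl : b.cartanMatrix.IsSimplyLaced) :
    ∃ U : P.weylGroup →* M, ∀ i, U (simpleReflection b e i) = T i := by
  obtain ⟨U, h1, h2⟩ := exists_desc_fun T hcomm hbraid hsl
  have hs : ∀ i w, U (simpleReflection b e i * w) = T i * U w := by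
    intro i w
    by_cases hd : Descent b e w i
    · rw [h2 w i hd, ← mul_assoc, hT, one_mul]
    · rw [h2 _ i ((descent_simpleReflection_mul b e w i).2 hd), ← mul_assoc (simpleReflection b e i),
        simpleReflection_mul_self, one_mul]
  refine ⟨⟨⟨U, h1⟩, fun x y => ?_⟩, fun i => ?_⟩
  · change U (x * y) = U x * U y
    refine descent_induction b e (p := fun x => U (x * y) = U x * U y) ?_ ?_ x
    · rw [one_mul, h1, one_mul]
    · intro i w _ hw
      rw [mul_assoc, hs, hw, hs, mul_assoc]
  · change U _ = _
    rw [← mul_one (simpleReflection b e i), hs, h1, mul_one]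

end SimplyLaced

/-! ### Laurent polynomials and monomial substitutions -/

section Laurent

variable {r : ℕ}

/-- Laurent polynomials in `z₁, …, z_r`, where `zⱼ = √q xⱼ`. -/
abbrev Laur (r : ℕ) : Type := AddMonoidAlgebra ℂ (Fin r → ℤ)

/-- The monomial `a z^l`. -/
abbrev mono (l : Fin r → ℤ) (a : ℂ) : Laur r := AddMonoidAlgebra.single l a

theorem mono_mul (l m : Fin r → ℤ) (a c : ℂ) : mono l a * mono m c = mono (l + m) (a * c) :=
  AddMonoidAlgebra.single_mul_single _ _ _ _

theorem mono_zero_one : mono (0 : Fin r → ℤ) 1 = 1 := AddMonoidAlgebra.one_def.symm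

theorem smul_mono (c : ℂ) (l : Fin r → ℤ) (a : ℂ) : c • mono l a = mono l (c * a) := by
  simp [mono]

theorem laur_algHom_ext {B : Type*} [Semiring B] [Algebra ℂ B] {φ ψ : Laur r →ₐ[ℂ] B}
    (h : ∀ l, φ (mono l 1) = ψ (mono l 1)) : φ = ψ := by
  refine AddMonoidAlgebra.algHom_ext h ?_
  exact Subsingleton.elim _ _

variable (q : ℕ)

/-- The complex number `√q`. -/
abbrev rootQ : ℂ := ((Real.sqrt q : ℝ) : ℂ)

variable {q}

theorem rootQ_ne_zero (hq : 0 < q) : rootQ q ≠ 0 := by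
  have : (0 : ℝ) < Real.sqrt q := Real.sqrt_pos.2 (by exact_mod_cast hq)
  exact Complex.ofReal_ne_zero.2 this.ne'

theorem rootQ_mul_self : rootQ q * rootQ q = q := by
  rw [← Complex.ofReal_mul, Real.mul_self_sqrt (Nat.cast_nonneg q)]
  simp

theorem csqrt_mul_self : csqrt (r := r) q * csqrt q = cq q := by
  unfold csqrt cq
  rw [← map_mul, rootQ_mul_self]

theorem csqrt_ne_zero (hq : 0 < q) : csqrt (r := r) q ≠ 0 := by
  unfold csqrt
  exact (map_ne_zero _).2 (rootQ_ne_zero hq)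

theorem var_ne_zero (j : Fin r) : var j ≠ 0 := by
  unfold var
  rw [Ne, FaithfulSMul.algebraMap_eq_zero_iff]
  exact MvPolynomial.X_ne_zero j

variable (q)

/-- The variable `zⱼ = √q xⱼ`. -/
def zvar (j : Fin r) : RatFunc r := csqrt q * var j

variable {q}

theorem zvar_ne_zero (hq : 0 < q) (j : Fin r) : zvar q j ≠ 0 :=
  mul_ne_zero (csqrt_ne_zero hq) (var_ne_zero j)

/-- The monomials `z^l`, as a homomorphism. -/
def zmonHom (hq : 0 < q) : Multiplicative (Fin r → ℤ) →* RatFunc r where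
  toFun l := ∏ j, zvar q j ^ (Multiplicative.toAdd l j)
  map_one' := by simp
  map_mul' l m := by
    rw [← Finset.prod_mul_distrib]
    exact Finset.prod_congr rfl fun j _ => zpow_add₀ (zvar_ne_zero hq j) _ _

/-- The embedding of Laurent polynomials into rational functions. -/
def toRat (hq : 0 < q) : Laur r →ₐ[ℂ] RatFunc r := AddMonoidAlgebra.lift _ _ _ (zmonHom hq)

theorem toRat_mono (hq : 0 < q) (l : Fin r → ℤ) (a : ℂ) :
    toRat hq (mono l a) = algebraMap ℂ (RatFunc r) a * ∏ j, zvar q j ^ l j := by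
  unfold toRat
  rw [AddMonoidAlgebra.lift_single, Algebra.smul_def]
  rfl

variable (q) in
/-- Polynomials in `x` as Laurent polynomials in `z`. -/
def ofPoly : MvPolynomial (Fin r) ℂ →ₐ[ℂ] Laur r :=
  MvPolynomial.aeval fun j => mono (Pi.single j 1) (rootQ q)⁻¹

theorem prod_zvar_single (j : Fin r) : ∏ k, zvar q k ^ (Pi.single j (1 : ℤ) : Fin r → ℤ) k = zvar q j := by
  rw [Finset.prod_eq_single j]
  · simp
  · intro k _ hk
    simp [hk]
  · simp

theorem toRat_ofPoly (hq : 0 < q) (p : MvPolynomial (Fin r) ℂ) :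
    toRat hq (ofPoly q p) = algebraMap _ (RatFunc r) p := by
  have : (toRat hq).comp (ofPoly q) = Algebra.algHom ℂ _ (RatFunc r) := by
    refine MvPolynomial.algHom_ext fun j => ?_
    rw [AlgHom.comp_apply]
    unfold ofPoly
    rw [MvPolynomial.aeval_X, toRat_mono, prod_zvar_single]
    change _ = var j
    have h := csqrt_ne_zero (r := r) hq
    unfold zvar
    rw [← mul_assoc, map_inv₀]
    change (csqrt q)⁻¹ * csqrt q * var j = _
    rw [inv_mul_cancel₀ h, one_mul]
  exact DFunLike.congr_fun this p

theorem ofPoly_injective (hq : 0 < q) : Function.Injective (ofPoly (r := r) q) := by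
  intro p p' h
  have := congrArg (toRat hq) h
  rw [toRat_ofPoly, toRat_ofPoly] at this
  exact IsFractionRing.injective _ _ this

theorem ofPoly_monomial (k : Fin r →₀ ℕ) (a : ℂ) :
    ofPoly q (MvPolynomial.monomial k a) =
      mono (fun j => (k j : ℤ)) (a * ((rootQ q)⁻¹) ^ (∑ j, k j)) := by
  unfold ofPoly
  have h : ∀ (s : Finset (Fin r)), ∏ j ∈ s, mono (Pi.single j (1 : ℤ)) (rootQ q)⁻¹ ^ k j =
      mono (∑ j ∈ s, (k j : ℤ) • Pi.single j (1 : ℤ)) (((rootQ q)⁻¹) ^ (∑ j ∈ s, k j)) := by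
    intro s
    induction s using Finset.cons_induction with
    | empty => simp [mono_zero_one]
    | cons j s hj ih =>
      rw [Finset.prod_cons, ih, Finset.sum_cons, Finset.sum_cons, pow_add,
        AddMonoidAlgebra.single_pow, mono_mul, natCast_zsmul]
  rw [MvPolynomial.aeval_monomial, Finsupp.prod_fintype _ _ (fun _ => pow_zero _), h,
    ← Algebra.smul_def, smul_mono]
  congr 1
  ext j
  simp [Finset.sum_apply, Pi.single_apply]

theorem exists_ofPoly_of_nonneg (hq : 0 < q) (c : Laur r)
    (hc : ∀ l ∈ c.coeff.support, 0 ≤ l) : ∃ p, ofPoly q p = c := by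
  have hsum : c = ∑ l ∈ c.coeff.support, mono l (c.coeff l) := by
    apply AddMonoidAlgebra.coeff_injective
    conv_lhs => rw [← Finsupp.sum_single c.coeff]
    rw [AddMonoidAlgebra.coeff_sum]
    rfl
  have hmono : ∀ l : Fin r → ℤ, 0 ≤ l → ∀ a, ∃ p, ofPoly q p = mono l a := by
    intro l hl a
    refine ⟨MvPolynomial.monomial (Finsupp.equivFunOnFinite.symm fun j => (l j).toNat)
      (a * (rootQ q) ^ (∑ j, (l j).toNat)), ?_⟩
    rw [ofPoly_monomial]
    congr 1
    · ext j
      simpa using hl j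
    · simp only [Finsupp.equivFunOnFinite_symm_apply_apply]
      rw [mul_assoc, ← mul_pow, mul_inv_cancel₀ (rootQ_ne_zero hq), one_pow, mul_one]
  choose! p hp using hmono
  refine ⟨∑ l ∈ c.coeff.support, p l (c.coeff l), ?_⟩
  rw [map_sum]
  conv_rhs => rw [hsum]
  exact Finset.sum_congr rfl fun l hl => hp l (hc l hl) _

theorem exists_mul_mono (hq : 0 < q) (c : Laur r) :
    ∃ (l : Fin r → ℤ) (p : MvPolynomial (Fin r) ℂ), c * mono l 1 = ofPoly q p := by
  classical
  -- The shift in direction `j` is the sum of all the `|m j|`, which dominates every `-m j`.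
  let l : Fin r → ℤ := fun j => ∑ m ∈ c.coeff.support, |m j|
  obtain ⟨p, hp⟩ := exists_ofPoly_of_nonneg hq (c * mono l 1) (by
    intro m hm j
    obtain ⟨m', hm', x, hx, hmx⟩ := Finset.mem_add.1 (AddMonoidAlgebra.support_coeff_mul_subset _ _ hm)
    have hx' : x = l := by
      have := Finsupp.support_single_subset hx
      simpa using this
    have h1 := Finset.single_le_sum (f := fun m : Fin r → ℤ => |m j|)
      (fun m _ => abs_nonneg (m j)) hm'
    have h2 := neg_abs_le (m' j)
    rw [← hmx, hx']
    change 0 ≤ m' j + ∑ m ∈ c.coeff.support, |m j|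
    omega)
  exact ⟨l, p, hp.symm⟩

theorem mono_one_mul_inv (l : Fin r → ℤ) : mono l 1 * mono (-l) 1 = 1 := by
  rw [mono_mul, add_neg_cancel, one_mul, mono_zero_one]

theorem toRat_injective (hq : 0 < q) : Function.Injective (toRat (r := r) hq) := by
  rw [injective_iff_map_eq_zero]
  intro c hc
  obtain ⟨l, p, hp⟩ := exists_mul_mono hq c
  have h1 : algebraMap _ (RatFunc r) p = 0 := by
    rw [← toRat_ofPoly hq, ← hp, map_mul, hc, zero_mul]
  have h2 : p = 0 := by
    rwa [FaithfulSMul.algebraMap_eq_zero_iff] at h1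
  rw [h2, map_zero] at hp
  have := congrArg (· * mono (-l) 1) hp
  simpa only [mul_assoc, mono_one_mul_inv, mul_one, zero_mul] using this

/-! ### Injective substitutions extended to the field of rational functions. -/

section Substitution

variable (hq : 0 < q) {φ : Laur r →ₐ[ℂ] Laur r} (hφ : Function.Injective φ)

include hφ in
theorem substHom_injective :
    Function.Injective (((toRat hq).comp φ).comp (ofPoly (r := r) q)) :=
  (toRat_injective hq).comp (hφ.comp (ofPoly_injective hq))

/-- The endomorphism of the field of rational functions that extends an injective endomorphism of
the algebra of Laurent polynomials. -/
def substHom : RatFunc r →ₐ[ℂ] RatFunc r :=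
  IsFractionRing.liftAlgHom (substHom_injective hq hφ)

theorem substHom_algebraMap (p : MvPolynomial (Fin r) ℂ) :
    substHom hq hφ (algebraMap _ _ p) = toRat hq (φ (ofPoly q p)) := by
  unfold substHom
  rw [IsFractionRing.liftAlgHom_apply]
  exact IsFractionRing.lift_algebraMap _ _

/-- `substHom` is specified on polynomials. A monomial `z^l` is the quotient of the polynomial
monomials `z^(l + |l|)` and `z^|l|`, and a general Laurent polynomial becomes a polynomial after
multiplication by a monomial. Monomials are units, so they can be cancelled. -/
theorem substHom_toRat (c : Laur r) : substHom hq hφ (toRat hq c) = toRat hq (φ c) := by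
  obtain ⟨l, p, hp⟩ := exists_mul_mono hq c
  obtain ⟨l', p', hp'⟩ := exists_mul_mono (r := r) hq (mono l 1)
  have h1 : substHom hq hφ (toRat hq (mono l 1)) = toRat hq (φ (mono l 1)) := by
    have h0 : ∀ m : Fin r → ℤ, 0 ≤ m →
        substHom hq hφ (toRat hq (mono m 1)) = toRat hq (φ (mono m 1)) := by
      intro m hm
      obtain ⟨p, hp⟩ := exists_ofPoly_of_nonneg hq (mono m (1 : ℂ)) (by
        intro x hx
        have := Finsupp.support_single_subset hx
        rw [Finset.mem_singleton] at this
        rwa [this])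
      rw [← hp, toRat_ofPoly, substHom_algebraMap]
    have e1 : mono l 1 * mono (fun j => |l j|) 1 = mono (fun j => l j + |l j|) (1 : ℂ) := by
      rw [mono_mul, one_mul]; rfl
    have e2 := h0 (fun j => |l j|) (fun j => abs_nonneg _)
    have e3 := h0 (fun j => l j + |l j|) (fun j => by
      have := neg_abs_le (l j); change 0 ≤ l j + |l j|; omega)
    rw [← e1, map_mul, map_mul, map_mul, map_mul, e2] at e3
    refine mul_right_cancel₀ ?_ e3
    have hu : IsUnit (mono (fun j => |l j|) (1 : ℂ) : Laur r) :=
      IsUnit.of_mul_eq_one _ (mono_one_mul_inv _)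
    exact ((hu.map φ).map (toRat hq)).ne_zero
  have h2 : substHom hq hφ (toRat hq (c * mono l 1)) = toRat hq (φ (c * mono l 1)) := by
    rw [hp, toRat_ofPoly, substHom_algebraMap]
  rw [map_mul, map_mul, map_mul, map_mul, h1] at h2
  refine mul_right_cancel₀ ?_ h2
  have hu : IsUnit (mono l (1 : ℂ) : Laur r) := IsUnit.of_mul_eq_one _ (mono_one_mul_inv _)
  exact ((hu.map φ).map (toRat hq)).ne_zero

/-- `subst` evaluates one chosen numerator and denominator, so it respects sums and products only if
no denominator is sent to zero. Injectivity of `φ` ensures this and makes `subst` a field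
homomorphism. -/
theorem subst_eq_substHom {y : Fin r → RatFunc r}
    (hy : ∀ j, y j = toRat hq (φ (mono (Pi.single j 1) (rootQ q)⁻¹))) (f : RatFunc r) :
    subst y f = substHom hq hφ f := by
  have h : (MvPolynomial.aeval y : MvPolynomial (Fin r) ℂ →ₐ[ℂ] RatFunc r) =
      ((toRat hq).comp φ).comp (ofPoly (r := r) q) := by
    refine MvPolynomial.algHom_ext fun j => ?_
    rw [MvPolynomial.aeval_X, hy]
    simp [ofPoly]
  unfold subst
  rw [h]
  conv_rhs => rw [← IsFractionRing.mk'_num_den (MvPolynomial (Fin r) ℂ) f,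
    IsFractionRing.mk'_eq_div, map_div₀, substHom_algebraMap, substHom_algebraMap]
  rfl

end Substitution

/-- The monomials generate the field over `ℂ`. Relations between substitutions thereby reduce to
relations between maps of the exponent lattice. -/
theorem ratHom_ext {B : Type*} [Field B] [Algebra ℂ B] (hq : 0 < q) {σ τ : RatFunc r →ₐ[ℂ] B}
    (h : ∀ l, σ (toRat hq (mono l 1)) = τ (toRat hq (mono l 1))) (f : RatFunc r) : σ f = τ f := by
  have h1 : σ.comp (toRat hq) = τ.comp (toRat hq) := laur_algHom_ext h
  have h2 : ∀ p : MvPolynomial (Fin r) ℂ, σ (algebraMap _ _ p) = τ (algebraMap _ _ p) := by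
    intro p
    rw [← toRat_ofPoly hq]
    exact DFunLike.congr_fun h1 _
  conv_lhs => rw [← IsFractionRing.mk'_num_den (MvPolynomial (Fin r) ℂ) f,
    IsFractionRing.mk'_eq_div, map_div₀, h2, h2, ← map_div₀, ← IsFractionRing.mk'_eq_div,
    IsFractionRing.mk'_num_den]

/-! ### Reflections and sign changes -/

variable (A : Fin r → Fin r → Prop)

open Classical in
/-- The sum of the coordinates that are adjacent to `i`. -/
def adjSum (i : Fin r) : (Fin r → ℤ) →+ ℤ where
  toFun l := ∑ j, if A i j then l j else 0
  map_zero' := by simp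
  map_add' l m := by
    rw [← Finset.sum_add_distrib]
    refine Finset.sum_congr rfl fun j _ => ?_
    split_ifs <;> simp

/-- The action of `σᵢ` on exponents. -/
def latRefl (i : Fin r) : (Fin r → ℤ) →+ (Fin r → ℤ) where
  toFun l j := if j = i then adjSum A i l - l i else l j
  map_zero' := by ext j; simp
  map_add' l m := by
    ext j
    simp only [map_add, Pi.add_apply]
    split_ifs
    · ring
    · rfl

theorem latRefl_apply (i : Fin r) (l : Fin r → ℤ) (j : Fin r) :
    latRefl A i l j = if j = i then adjSum A i l - l i else l j := rfl

theorem latRefl_self (i : Fin r) (l : Fin r → ℤ) : latRefl A i l i = adjSum A i l - l i := by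
  rw [latRefl_apply, if_pos rfl]

theorem latRefl_of_ne {i j : Fin r} (h : j ≠ i) (l : Fin r → ℤ) : latRefl A i l j = l j := by
  rw [latRefl_apply, if_neg h]

theorem latRefl_eq_add (i : Fin r) (l : Fin r → ℤ) :
    latRefl A i l = l + (adjSum A i l - 2 * l i) • Pi.single i 1 := by
  ext j
  rw [latRefl_apply]
  by_cases h : j = i
  · subst h; simp; ring
  · simp [h]

open Classical in
theorem adjSum_single (i j : Fin r) (n : ℤ) :
    adjSum A i (Pi.single j n) = if A i j then n else 0 := by
  change (∑ k, if A i k then (Pi.single j n : Fin r → ℤ) k else 0) = _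
  rw [Finset.sum_eq_single j]
  · simp
  · intro k _ hk
    simp [hk]
  · simp

variable {A}

theorem adjSum_latRefl_self (hA : ∀ i, ¬ A i i) (i : Fin r) (l : Fin r → ℤ) :
    adjSum A i (latRefl A i l) = adjSum A i l := by
  classical
  rw [latRefl_eq_add, map_add, map_zsmul, adjSum_single, if_neg (hA i), smul_zero, add_zero]

theorem latRefl_latRefl (hA : ∀ i, ¬ A i i) (i : Fin r) (l : Fin r → ℤ) :
    latRefl A i (latRefl A i l) = l := by
  ext j
  by_cases h : j = i
  · subst h
    rw [latRefl_self, adjSum_latRefl_self hA, latRefl_self]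
    ring
  · rw [latRefl_of_ne A h, latRefl_of_ne A h]

theorem adjSum_latRefl_of_adj {i j : Fin r} (h : A i j) (l : Fin r → ℤ) :
    adjSum A i (latRefl A j l) = adjSum A i l + adjSum A j l - 2 * l j := by
  classical
  rw [latRefl_eq_add, map_add, map_zsmul, adjSum_single, if_pos h]
  simp; ring

theorem adjSum_latRefl_of_not_adj {i j : Fin r} (h : ¬ A i j) (l : Fin r → ℤ) :
    adjSum A i (latRefl A j l) = adjSum A i l := by
  classical
  rw [latRefl_eq_add, map_add, map_zsmul, adjSum_single, if_neg h]
  simp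

variable (A)

/-- The action of `σᵢ` on Laurent polynomials. -/
def refl (i : Fin r) : Laur r →ₐ[ℂ] Laur r := AddMonoidAlgebra.mapDomainAlgHom ℂ ℂ (latRefl A i)

theorem refl_mono (i : Fin r) (l : Fin r → ℤ) (a : ℂ) :
    refl A i (mono l a) = mono (latRefl A i l) a :=
  AddMonoidAlgebra.mapDomain_single

/-- The sign by which `εᵢ` acts on a monomial. -/
def sgn (i : Fin r) (l : Fin r → ℤ) : ℂ := (-1) ^ adjSum A i l

theorem sgn_add (i : Fin r) (l m : Fin r → ℤ) : sgn A i (l + m) = sgn A i l * sgn A i m := by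
  unfold sgn
  rw [map_add, zpow_add₀ (by norm_num)]

theorem sgn_mul_self (i : Fin r) (l : Fin r → ℤ) : sgn A i l * sgn A i l = 1 := by
  unfold sgn
  rw [← mul_zpow]; norm_num

/-- The action of `εᵢ` on Laurent polynomials. -/
def eps (i : Fin r) : Laur r →ₐ[ℂ] Laur r :=
  AddMonoidAlgebra.lift _ _ _
    { toFun := fun l => mono (Multiplicative.toAdd l) (sgn A i (Multiplicative.toAdd l))
      map_one' := by
        rw [toAdd_one]; unfold sgn; rw [map_zero, zpow_zero]; exact mono_zero_one
      map_mul' := fun l m => by rw [toAdd_mul, sgn_add, mono_mul] }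

theorem eps_mono (i : Fin r) (l : Fin r → ℤ) (a : ℂ) :
    eps A i (mono l a) = mono l (sgn A i l * a) := by
  unfold eps
  rw [AddMonoidAlgebra.lift_single]
  change a • mono l (sgn A i l) = _
  rw [smul_mono, mul_comm]

variable {A}

theorem refl_refl (hA : ∀ i, ¬ A i i) (i : Fin r) (c : Laur r) : refl A i (refl A i c) = c := by
  have : (refl A i).comp (refl A i) = AlgHom.id ℂ _ :=
    laur_algHom_ext fun l => by
      rw [AlgHom.comp_apply, refl_mono, refl_mono, latRefl_latRefl hA]; rfl
  exact DFunLike.congr_fun this c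

theorem eps_eps (i : Fin r) (c : Laur r) : eps A i (eps A i c) = c := by
  have : (eps A i).comp (eps A i) = AlgHom.id ℂ _ :=
    laur_algHom_ext fun l => by
      rw [AlgHom.comp_apply, eps_mono, eps_mono, ← mul_assoc, sgn_mul_self, one_mul]; rfl
  exact DFunLike.congr_fun this c

theorem refl_injective (hA : ∀ i, ¬ A i i) (i : Fin r) : Function.Injective (refl A i) :=
  Function.LeftInverse.injective (refl_refl hA i)

theorem eps_injective (i : Fin r) : Function.Injective (eps A i) :=
  Function.LeftInverse.injective (eps_eps i)

/-- The action of `σᵢ` on rational functions. -/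
def sigmaHom (hq : 0 < q) (hA : ∀ i, ¬ A i i) (i : Fin r) : RatFunc r →ₐ[ℂ] RatFunc r :=
  substHom hq (refl_injective hA i)

variable (A) in
/-- The action of `εᵢ` on rational functions. -/
def epsHom (hq : 0 < q) (i : Fin r) : RatFunc r →ₐ[ℂ] RatFunc r :=
  substHom hq (eps_injective (A := A) i)

theorem sigmaHom_toRat (hq : 0 < q) (hA : ∀ i, ¬ A i i) (i : Fin r) (c : Laur r) :
    sigmaHom hq hA i (toRat hq c) = toRat hq (refl A i c) := substHom_toRat _ _ _

theorem epsHom_toRat (hq : 0 < q) (i : Fin r) (c : Laur r) :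
    epsHom A hq i (toRat hq c) = toRat hq (eps A i c) := substHom_toRat _ _ _

theorem toRat_var (hq : 0 < q) (j : Fin r) : toRat hq (mono (Pi.single j 1) 1) = zvar q j := by
  rw [toRat_mono, prod_zvar_single, map_one, one_mul]

theorem sgn_single (i j : Fin r) [Decidable (A i j)] :
    sgn A i (Pi.single j 1) = if A i j then -1 else 1 := by
  unfold sgn
  rw [adjSum_single]
  split_ifs <;> simp

end Laurent

/-! ### The substitutions `σ_i` and `ε_i` in the variables `z`. -/

section Vec

variable {ι V V' : Type*} [Finite ι] [AddCommGroup V] [Module ℝ V] [AddCommGroup V'] [Module ℝ V']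
  {P : RootPairing ι ℝ V V'} [P.IsCrystallographic] [P.IsReduced] {b : P.Base} {r : ℕ}
  {e : Fin r ≃ b.support} {q : ℕ}

theorem adj_irrefl (i : Fin r) : ¬ Adj b e i i := fun h => h.1 rfl

theorem var_eq (hq : 0 < q) (j : Fin r) :
    (var j : RatFunc r) = toRat hq (mono (Pi.single j 1) (rootQ q)⁻¹) := by
  rw [toRat_mono, prod_zvar_single, zvar, ← mul_assoc, map_inv₀]
  change _ = (csqrt q)⁻¹ * csqrt q * var j
  rw [inv_mul_cancel₀ (csqrt_ne_zero hq), one_mul]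

/-- In the variables `z` the scalars `q` and `√q` disappear: `z_i` goes to `1 / z_i`, a neighbour
`z_j` to `z_i z_j`, and the others are fixed. On exponents this is `latRefl`. -/
theorem subst_sigmaVec (hq : 0 < q) (i : Fin r) (f : RatFunc r) :
    subst (sigmaVec b e q i) f = sigmaHom hq (adj_irrefl (b := b) (e := e)) i f := by
  classical
  refine subst_eq_substHom hq _ (fun j => ?_) f
  have hs := csqrt_ne_zero (r := r) hq
  have hz := zvar_ne_zero (r := r) hq
  have hinv : algebraMap ℂ (RatFunc r) (rootQ q)⁻¹ = (csqrt q)⁻¹ := map_inv₀ _ _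
  rw [refl_mono, toRat_mono, hinv, latRefl_eq_add, adjSum_single, sigmaVec]
  simp only [Pi.add_apply, zpow_add₀ (hz _), Finset.prod_mul_distrib, prod_zvar_single,
    Pi.smul_apply, smul_eq_mul, mul_comm _ ((Pi.single i (1 : ℤ) : Fin r → ℤ) _), zpow_mul,
    Finset.prod_zpow]
  by_cases hji : j = i
  · subst hji
    rw [if_pos rfl, if_neg (adj_irrefl j)]
    have hv := var_ne_zero j
    simp only [Pi.single_eq_same, zvar, ← csqrt_mul_self]
    rw [show (0 - 2 * 1 : ℤ) = -2 by norm_num, zpow_neg]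
    field_simp
  · rw [if_neg hji]
    simp only [Pi.single_eq_of_ne (Ne.symm hji)]
    split_ifs
    · simp only [zvar]
      norm_num
      field_simp
    · simp only [zvar]
      norm_num
      field_simp

theorem subst_epsVec (hq : 0 < q) (i : Fin r) (f : RatFunc r) :
    subst (epsVec b e i) f = epsHom (Adj b e) hq i f := by
  classical
  refine subst_eq_substHom hq _ (fun j => ?_) f
  rw [eps_mono, sgn_single, epsVec, var_eq hq]
  split_ifs
  · rw [← map_neg]
    congr 1
    rw [neg_one_mul]
    exact (AddMonoidAlgebra.single_neg _ _).symm
  · rw [one_mul]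

end Vec

/-! ### The braid relations for the action on rational functions -/

section Abstract

variable {F : Type*} [Field F]

/-- The coefficient of `f(σ x)` in `f | σ`. -/
def coefP (s u : F) : F := (s - 1) * (1 + u) / (2 * u * (s - u))

/-- The coefficient of `f(ε σ x)` in `f | σ`. -/
def coefM (s u : F) : F := (s + 1) * (u - 1) / (2 * u * (s - u))

theorem map_coefP (φ : F →+* F) (s u : F) : φ (coefP s u) = coefP (φ s) (φ u) := by
  simp [coefP, map_ofNat]

theorem map_coefM (φ : F →+* F) (s u : F) : φ (coefM s u) = coefM (φ s) (φ u) := by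
  simp [coefM, map_ofNat]

/-- The operator `f ↦ f | σ`, written in terms of the substitutions `S` and `E`. -/
def slashOp (S E : F →+* F) (s u f : F) : F := coefP s u * S f + coefM s u * S (E f)

variable [NeZero (2 : F)] {S S' E E' : F →+* F} {s u v : F}

/-- Since `S u = u⁻¹`, the square expands into a combination of `f` and `E f`; `e1` and `e2` say
that the coefficients are `1` and `0`. -/
theorem slashOp_slashOp (hs : S s = s) (hu : S u = u⁻¹) (hEs : E s = s) (hEu : E u = u)
    (hSS : ∀ f, S (S f) = f) (hEE : ∀ f, E (E f) = f) (hES : ∀ f, E (S f) = S (E f))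
    (u0 : u ≠ 0) (h1 : s - u ≠ 0) (h2 : s * u - 1 ≠ 0) (f : F) :
    slashOp S E s u (slashOp S E s u f) = f := by
  have two : (2 : F) ≠ 0 := NeZero.ne _
  have hd : s - u⁻¹ ≠ 0 := by
    intro h; apply h2; field_simp at h; linear_combination h
  have e1 : coefP s u * coefP s u⁻¹ + coefM s u * coefM s u⁻¹ = 1 := by
    unfold coefP coefM
    have : s - u⁻¹ = (s * u - 1) / u := by field_simp
    rw [this]
    field_simp
    ring
  have e2 : coefP s u * coefM s u⁻¹ + coefM s u * coefP s u⁻¹ = 0 := by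
    unfold coefP coefM
    have : s - u⁻¹ = (s * u - 1) / u := by field_simp
    rw [this]
    field_simp
    ring
  simp only [slashOp, map_add, map_mul, map_coefP, map_coefM, hs, hu, hEs, hEu, hSS, hES, hEE]
  linear_combination f * e1 + E f * e2

theorem slashOp_comm (hs : S s = s) (hs' : S' s = s) (hEs : E s = s) (hEs' : E' s = s)
    (hv : S v = v) (hu : S' u = u) (hEv : E v = v) (hEu : E' u = u)
    (hSS : ∀ f, S (S' f) = S' (S f)) (hEE : ∀ f, E (E' f) = E' (E f))
    (hES : ∀ f, E (S' f) = S' (E f)) (hES' : ∀ f, E' (S f) = S (E' f)) (f : F) :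
    slashOp S E s u (slashOp S' E' s v f) = slashOp S' E' s v (slashOp S E s u f) := by
  simp only [slashOp, map_add, map_mul, map_coefP, map_coefM, hs, hs', hu, hv, hEs, hEs', hEu, hEv,
    hES, hES', hSS, hEE]
  ring

/-- Each side is a combination of `S' S S'` applied to `f`, `E f`, `E' f` and `E' E f`, once the
sign changes are moved inwards by `hES2` and `hES3`. The coefficients of `f` agree outright, those
of `E f` and `E' f` by `key1` for `(u, v)` and for `(v, u)`, and those of `E' E f` by `key2`. -/
theorem slashOp_braid (hs : S s = s) (hs' : S' s = s) (hEs : E s = s) (hEs' : E' s = s)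
    (hu : S u = u⁻¹) (hv : S' v = v⁻¹) (huv : S v = u * v) (hvu : S' u = u * v)
    (hEu : E u = u) (hEv : E' v = v) (hEuv : E v = -v) (hEvu : E' u = -u)
    (hEE1 : ∀ f, E (E f) = f) (hEE1' : ∀ f, E' (E' f) = f)
    (hSS : ∀ f, S (S' (S f)) = S' (S (S' f))) (hEE : ∀ f, E (E' f) = E' (E f))
    (hES : ∀ f, E (S f) = S (E f)) (hES1 : ∀ f, E' (S' f) = S' (E' f))
    (hES2 : ∀ f, E (S' f) = S' (E' (E f))) (hES3 : ∀ f, E' (S f) = S (E' (E f)))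
    (u0 : u ≠ 0) (v0 : v ≠ 0) (h1 : s - u ≠ 0) (h2 : s + u ≠ 0) (h3 : s - v ≠ 0)
    (h4 : s + v ≠ 0) (h5 : s - u * v ≠ 0) (h6 : s + u * v ≠ 0) (f : F) :
    slashOp S E s u (slashOp S' E' s v (slashOp S E s u f)) =
      slashOp S' E' s v (slashOp S E s u (slashOp S' E' s v f)) := by
  have two : (2 : F) ≠ 0 := NeZero.ne _
  have c1 : u⁻¹ * (u * v) = v := by field_simp
  have c2 : u * v * v⁻¹ = u := by field_simp
  have key1 : ∀ u v : F, u ≠ 0 → v ≠ 0 → s - u ≠ 0 → s + u ≠ 0 → s - v ≠ 0 → s + v ≠ 0 →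
      s - u * v ≠ 0 → s + u * v ≠ 0 →
      coefP s u * coefP s (u * v) * coefM s v + coefM s u * coefM s (-(u * v)) * coefP s v =
        coefP s v * coefM s (u * v) * coefM s (-u) + coefM s v * coefP s (-(u * v)) * coefP s (-u) := by
    intro u v u0 v0 h1 h2 h3 h4 h5 h6
    unfold coefP coefM
    rw [sub_neg_eq_add, sub_neg_eq_add]
    field_simp
    ring
  have key2 : coefP s u * coefM s (u * v) * coefP s (-v) + coefM s u * coefP s (-(u * v)) * coefM s (-v) =
        coefP s v * coefM s (u * v) * coefP s (-u) + coefM s v * coefP s (-(u * v)) * coefM s (-u) := by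
    unfold coefP coefM
    rw [sub_neg_eq_add, sub_neg_eq_add, sub_neg_eq_add]
    field_simp
    ring
  have k1 := key1 u v u0 v0 h1 h2 h3 h4 h5 h6
  have k3 := key1 v u v0 u0 h3 h4 h1 h2 (by rwa [mul_comm]) (by rwa [mul_comm])
  rw [mul_comm v u] at k3
  simp only [slashOp, map_add, map_mul, map_neg, map_coefP, map_coefM, hs, hs', hu, hv, huv, hvu, hEs,
    hEs', hEu, hEv, hEuv, hEvu, hES, hES1, hES2, hES3, hSS, hEE, hEE1, hEE1', c1, c2, mul_neg,
    neg_mul, neg_neg]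
  linear_combination S' (S (S' (E f))) * k1 - S' (S (S' (E' f))) * k3 +
    S' (S (S' (E' (E f)))) * key2

end Abstract

/-! ### The Coxeter relations for the slash operators. -/

section Ops

variable {r : ℕ} {q : ℕ} {A : Fin r → Fin r → Prop} (hq : 0 < q) (hA : ∀ i, ¬ A i i)

theorem sigmaHom_csqrt (i : Fin r) : sigmaHom hq hA i (csqrt q) = csqrt q := AlgHom.commutes _ _

theorem epsHom_csqrt (i : Fin r) : epsHom A hq i (csqrt q) = csqrt q := AlgHom.commutes _ _

theorem sigmaHom_sigmaHom (i : Fin r) (f : RatFunc r) :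
    sigmaHom hq hA i (sigmaHom hq hA i f) = f := by
  refine ratHom_ext hq (σ := (sigmaHom hq hA i).comp (sigmaHom hq hA i)) (τ := AlgHom.id ℂ _)
    (fun l => ?_) f
  rw [AlgHom.comp_apply, sigmaHom_toRat, sigmaHom_toRat, refl_refl hA]; rfl

theorem epsHom_epsHom (i : Fin r) (f : RatFunc r) : epsHom A hq i (epsHom A hq i f) = f := by
  refine ratHom_ext hq (σ := (epsHom A hq i).comp (epsHom A hq i)) (τ := AlgHom.id ℂ _)
    (fun l => ?_) f
  rw [AlgHom.comp_apply, epsHom_toRat, epsHom_toRat, eps_eps]; rfl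

theorem epsHom_comm (i j : Fin r) (f : RatFunc r) :
    epsHom A hq i (epsHom A hq j f) = epsHom A hq j (epsHom A hq i f) := by
  refine ratHom_ext hq (σ := (epsHom A hq i).comp (epsHom A hq j))
    (τ := (epsHom A hq j).comp (epsHom A hq i)) (fun l => ?_) f
  simp only [AlgHom.comp_apply, epsHom_toRat, eps_mono]
  rw [mul_left_comm]

theorem sgn_latRefl_of_not_adj {i j : Fin r} (h : ¬ A i j) (l : Fin r → ℤ) :
    sgn A i (latRefl A j l) = sgn A i l := by
  unfold sgn; rw [adjSum_latRefl_of_not_adj h]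

/-- `σ_j` replaces the coordinate `l j`, which counts in `adjSum A i`, by `adjSum A j l - l j`.
Modulo `2` this changes the sum by `adjSum A j l`. -/
theorem sgn_latRefl_of_adj {i j : Fin r} (h : A i j) (l : Fin r → ℤ) :
    sgn A i (latRefl A j l) = sgn A j l * sgn A i l := by
  unfold sgn
  have h0 : (-1 : ℂ) ≠ 0 := by norm_num
  rw [adjSum_latRefl_of_adj h, zpow_sub₀ h0, zpow_add₀ h0, zpow_mul]
  norm_num
  ring

theorem epsHom_sigmaHom_of_not_adj {i j : Fin r} (h : ¬ A i j) (f : RatFunc r) :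
    epsHom A hq i (sigmaHom hq hA j f) = sigmaHom hq hA j (epsHom A hq i f) := by
  refine ratHom_ext hq (σ := (epsHom A hq i).comp (sigmaHom hq hA j))
    (τ := (sigmaHom hq hA j).comp (epsHom A hq i)) (fun l => ?_) f
  simp only [AlgHom.comp_apply, epsHom_toRat, sigmaHom_toRat, eps_mono, refl_mono,
    sgn_latRefl_of_not_adj h]

theorem epsHom_sigmaHom_of_adj {i j : Fin r} (h : A i j) (f : RatFunc r) :
    epsHom A hq i (sigmaHom hq hA j f) =
      sigmaHom hq hA j (epsHom A hq j (epsHom A hq i f)) := by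
  refine ratHom_ext hq (σ := (epsHom A hq i).comp (sigmaHom hq hA j))
    (τ := (sigmaHom hq hA j).comp ((epsHom A hq j).comp (epsHom A hq i))) (fun l => ?_) f
  simp only [AlgHom.comp_apply, epsHom_toRat, sigmaHom_toRat, eps_mono, refl_mono,
    sgn_latRefl_of_adj h, mul_assoc]

theorem latRefl_comm {i j : Fin r} (h : ¬ A i j) (h' : ¬ A j i) (l : Fin r → ℤ) :
    latRefl A i (latRefl A j l) = latRefl A j (latRefl A i l) := by
  by_cases hij : i = j
  · rw [hij]
  ext k
  simp only [latRefl_apply, adjSum_latRefl_of_not_adj h, adjSum_latRefl_of_not_adj h']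
  by_cases h1 : k = i <;> by_cases h2 : k = j <;> simp_all

theorem sigmaHom_comm {i j : Fin r} (h : ¬ A i j) (h' : ¬ A j i) (f : RatFunc r) :
    sigmaHom hq hA i (sigmaHom hq hA j f) = sigmaHom hq hA j (sigmaHom hq hA i f) := by
  refine ratHom_ext hq (σ := (sigmaHom hq hA i).comp (sigmaHom hq hA j))
    (τ := (sigmaHom hq hA j).comp (sigmaHom hq hA i)) (fun l => ?_) f
  simp only [AlgHom.comp_apply, sigmaHom_toRat, refl_mono, latRefl_comm h h']

include hA in
theorem latRefl_braid {i j : Fin r} (h : A i j) (h' : A j i) (l : Fin r → ℤ) :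
    latRefl A i (latRefl A j (latRefl A i l)) = latRefl A j (latRefl A i (latRefl A j l)) := by
  have hij : i ≠ j := fun hij => hA i (by rwa [← hij] at h)
  ext k
  simp only [latRefl_apply, adjSum_latRefl_of_adj h, adjSum_latRefl_of_adj h',
    adjSum_latRefl_self hA]
  by_cases h1 : k = i
  · subst h1
    simp [hij, hij.symm]
    ring
  · by_cases h2 : k = j
    · subst h2
      simp [hij, hij.symm]
      ring
    · simp [h1, h2]

theorem sigmaHom_braid {i j : Fin r} (h : A i j) (h' : A j i) (f : RatFunc r) :
    sigmaHom hq hA i (sigmaHom hq hA j (sigmaHom hq hA i f)) =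
      sigmaHom hq hA j (sigmaHom hq hA i (sigmaHom hq hA j f)) := by
  refine ratHom_ext hq
    (σ := (sigmaHom hq hA i).comp ((sigmaHom hq hA j).comp (sigmaHom hq hA i)))
    (τ := (sigmaHom hq hA j).comp ((sigmaHom hq hA i).comp (sigmaHom hq hA j))) (fun l => ?_) f
  simp only [AlgHom.comp_apply, sigmaHom_toRat, refl_mono, latRefl_braid hA h h']

theorem sigmaHom_zvar_self (i : Fin r) : sigmaHom hq hA i (zvar q i) = (zvar q i)⁻¹ := by
  classical
  apply eq_inv_of_mul_eq_one_left
  rw [← toRat_var hq, sigmaHom_toRat, refl_mono, ← map_mul, mono_mul, latRefl_eq_add, adjSum_single,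
    if_neg (hA i), one_mul]
  have : (Pi.single i (1 : ℤ) + ((0 : ℤ) - 2 * (Pi.single i (1 : ℤ) : Fin r → ℤ) i) •
      (Pi.single i (1 : ℤ) : Fin r → ℤ)) + Pi.single i 1 = 0 := by
    ext k
    simp; ring
  rw [this, mono_zero_one, map_one]

theorem sigmaHom_zvar_of_adj {i j : Fin r} (h : A i j) :
    sigmaHom hq hA i (zvar q j) = zvar q i * zvar q j := by
  classical
  have hij : j ≠ i := fun hij => hA i (by rwa [hij] at h)
  rw [← toRat_var hq, ← toRat_var hq, sigmaHom_toRat, refl_mono, ← map_mul, mono_mul,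
    latRefl_eq_add, adjSum_single, if_pos h, one_mul, Pi.single_eq_of_ne hij.symm, mul_zero,
    sub_zero, one_smul, add_comm]

theorem sigmaHom_zvar_of_not_adj {i j : Fin r} (hij : j ≠ i) (h : ¬ A i j) :
    sigmaHom hq hA i (zvar q j) = zvar q j := by
  classical
  rw [← toRat_var hq, sigmaHom_toRat, refl_mono, latRefl_eq_add, adjSum_single, if_neg h,
    Pi.single_eq_of_ne hij.symm, mul_zero, sub_zero, zero_smul, add_zero]

theorem epsHom_zvar_of_adj {i j : Fin r} (h : A i j) : epsHom A hq i (zvar q j) = - zvar q j := by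
  classical
  rw [← toRat_var hq, epsHom_toRat, eps_mono, sgn_single, if_pos h, ← map_neg, mul_one]
  congr 1
  exact AddMonoidAlgebra.single_neg _ _

theorem epsHom_zvar_of_not_adj {i j : Fin r} (h : ¬ A i j) : epsHom A hq i (zvar q j) = zvar q j := by
  classical
  rw [← toRat_var hq, epsHom_toRat, eps_mono, sgn_single, if_neg h, mul_one]

/-- Distinct monomials cannot cancel. The binomial denominators in the Coxeter relations are all
nonzero for this reason. -/
theorem toRat_ne_zero_of_two {l : Fin r → ℤ} (hl : l ≠ 0) {a c : ℂ} (ha : a ≠ 0) :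
    toRat hq (mono 0 a + mono l c) ≠ 0 := by
  intro h
  rw [map_eq_zero_iff _ (toRat_injective hq)] at h
  have h2 := congrArg (fun x : Laur r => x.coeff 0) h
  simp [mono, hl] at h2
  exact ha h2

theorem algebraMap_add_ne_zero {l : Fin r → ℤ} (hl : l ≠ 0) {a c : ℂ} (ha : a ≠ 0) :
    algebraMap ℂ (RatFunc r) a + algebraMap ℂ (RatFunc r) c * toRat hq (mono l 1) ≠ 0 := by
  have := toRat_ne_zero_of_two (q := q) hq hl (c := c) ha
  rw [map_add, toRat_mono hq 0] at this
  have h3 : mono l c = c • mono l (1 : ℂ) := by rw [smul_mono, mul_one]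
  rw [h3, map_smul, Algebra.smul_def] at this
  simpa using this

/-- The operator `f ↦ f | σᵢ`. -/
def slashEnd (i : Fin r) : AddMonoid.End (RatFunc r) where
  toFun f := slashOp (sigmaHom hq hA i : RatFunc r →+* RatFunc r) (epsHom A hq i) (csqrt q)
    (zvar q i) f
  map_zero' := by simp only [slashOp, map_zero, mul_zero, add_zero]
  map_add' f g := by simp only [slashOp, map_add]; ring

theorem slashEnd_apply (i : Fin r) (f : RatFunc r) :
    slashEnd hq hA i f = slashOp (sigmaHom hq hA i : RatFunc r →+* RatFunc r) (epsHom A hq i)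
      (csqrt q) (zvar q i) f := rfl

theorem single_ne_zero' (i : Fin r) : (Pi.single i (1 : ℤ) : Fin r → ℤ) ≠ 0 := by
  intro h
  simpa using congrFun h i

include hq in
theorem csqrt_sub_zvar_ne (i : Fin r) : csqrt q - zvar q i ≠ 0 := by
  have := algebraMap_add_ne_zero hq (single_ne_zero' i) (c := -1) (rootQ_ne_zero hq)
  rwa [toRat_var, map_neg, map_one, neg_one_mul, ← sub_eq_add_neg] at this

include hq in
theorem csqrt_add_zvar_ne (i : Fin r) : csqrt q + zvar q i ≠ 0 := by
  have := algebraMap_add_ne_zero hq (single_ne_zero' i) (c := 1) (rootQ_ne_zero hq)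
  rwa [toRat_var, map_one, one_mul] at this

include hq in
theorem csqrt_mul_zvar_sub_ne (i : Fin r) : csqrt q * zvar q i - 1 ≠ 0 := by
  have := algebraMap_add_ne_zero hq (single_ne_zero' i) (a := -1) (c := rootQ q) (by norm_num)
  rwa [toRat_var, map_neg, map_one, neg_add_eq_sub] at this

theorem single_add_ne (i j : Fin r) :
    (Pi.single i (1 : ℤ) + Pi.single j (1 : ℤ) : Fin r → ℤ) ≠ 0 := by
  intro h
  have := congrFun h i
  by_cases hij : i = j
  · subst hij
    simp at this
  · simp [hij] at this

include hq in
theorem toRat_var_mul (i j : Fin r) :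
    toRat hq (mono (Pi.single i (1 : ℤ) + Pi.single j (1 : ℤ)) 1) = zvar q i * zvar q j := by
  rw [← toRat_var hq, ← toRat_var hq, ← map_mul, mono_mul, one_mul]

include hq in
theorem csqrt_sub_mul_ne (i j : Fin r) : csqrt q - zvar q i * zvar q j ≠ 0 := by
  have := algebraMap_add_ne_zero hq (single_add_ne i j) (c := -1) (rootQ_ne_zero hq)
  rwa [toRat_var_mul, map_neg, map_one, neg_one_mul, ← sub_eq_add_neg] at this

include hq in
theorem csqrt_add_mul_ne (i j : Fin r) : csqrt q + zvar q i * zvar q j ≠ 0 := by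
  have := algebraMap_add_ne_zero hq (single_add_ne i j) (c := 1) (rootQ_ne_zero hq)
  rwa [toRat_var_mul, map_one, one_mul] at this

theorem slashEnd_sq (i : Fin r) : slashEnd hq hA i * slashEnd hq hA i = 1 := by
  refine DFunLike.ext _ _ fun f => ?_
  rw [AddMonoid.End.coe_mul, Function.comp_apply, slashEnd_apply, slashEnd_apply]
  exact slashOp_slashOp (sigmaHom_csqrt hq hA i) (sigmaHom_zvar_self hq hA i) (epsHom_csqrt hq i)
    (epsHom_zvar_of_not_adj hq (hA i)) (sigmaHom_sigmaHom hq hA i) (epsHom_epsHom hq i)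
    (epsHom_sigmaHom_of_not_adj hq hA (hA i)) (zvar_ne_zero hq i) (csqrt_sub_zvar_ne hq i)
    (csqrt_mul_zvar_sub_ne hq i) f

theorem slashEnd_comm {i j : Fin r} (hij : i ≠ j) (h : ¬ A i j) (h' : ¬ A j i) :
    slashEnd hq hA i * slashEnd hq hA j = slashEnd hq hA j * slashEnd hq hA i := by
  refine DFunLike.ext _ _ fun f => ?_
  simp only [AddMonoid.End.coe_mul, Function.comp_apply, slashEnd_apply]
  exact slashOp_comm (sigmaHom_csqrt hq hA i) (sigmaHom_csqrt hq hA j) (epsHom_csqrt hq i)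
    (epsHom_csqrt hq j) (sigmaHom_zvar_of_not_adj hq hA hij.symm h)
    (sigmaHom_zvar_of_not_adj hq hA hij h') (epsHom_zvar_of_not_adj hq h)
    (epsHom_zvar_of_not_adj hq h') (sigmaHom_comm hq hA h h') (epsHom_comm hq i j)
    (epsHom_sigmaHom_of_not_adj hq hA h) (epsHom_sigmaHom_of_not_adj hq hA h') f

theorem slashEnd_braid {i j : Fin r} (h : A i j) (h' : A j i) :
    slashEnd hq hA i * slashEnd hq hA j * slashEnd hq hA i =
      slashEnd hq hA j * slashEnd hq hA i * slashEnd hq hA j := by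
  refine DFunLike.ext _ _ fun f => ?_
  simp only [AddMonoid.End.coe_mul, Function.comp_apply, slashEnd_apply]
  exact slashOp_braid (sigmaHom_csqrt hq hA i) (sigmaHom_csqrt hq hA j) (epsHom_csqrt hq i)
    (epsHom_csqrt hq j) (sigmaHom_zvar_self hq hA i) (sigmaHom_zvar_self hq hA j)
    (sigmaHom_zvar_of_adj hq hA h) ((sigmaHom_zvar_of_adj hq hA h').trans (mul_comm _ _))
    (epsHom_zvar_of_not_adj hq (hA i)) (epsHom_zvar_of_not_adj hq (hA j))
    (epsHom_zvar_of_adj hq h) (epsHom_zvar_of_adj hq h') (epsHom_epsHom hq i) (epsHom_epsHom hq j)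
    (sigmaHom_braid hq hA h h') (epsHom_comm hq i j)
    (epsHom_sigmaHom_of_not_adj hq hA (hA i)) (epsHom_sigmaHom_of_not_adj hq hA (hA j))
    (epsHom_sigmaHom_of_adj hq hA h)
    (fun f => (epsHom_sigmaHom_of_adj hq hA h' f).trans (congrArg _ (epsHom_comm hq i j f)))
    (zvar_ne_zero hq i) (zvar_ne_zero hq j) (csqrt_sub_zvar_ne hq i)
    (csqrt_add_zvar_ne hq i) (csqrt_sub_zvar_ne hq j) (csqrt_add_zvar_ne hq j)
    (csqrt_sub_mul_ne hq i j) (csqrt_add_mul_ne hq i j) f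

end Ops

/-! ### Supports and norms of Laurent polynomials -/

section Supp

variable {r : ℕ}

theorem sum_mono (c : Laur r) : ∑ l ∈ c.coeff.support, mono l (c.coeff l) = c := by
  apply AddMonoidAlgebra.coeff_injective
  conv_rhs => rw [← Finsupp.sum_single c.coeff]
  rw [AddMonoidAlgebra.coeff_sum]
  rfl

theorem coeff_mono (l m : Fin r → ℤ) [Decidable (l = m)] (a : ℂ) :
    (mono l a).coeff m = if l = m then a else 0 := by
  classical
  rw [AddMonoidAlgebra.coeff_single, Finsupp.single_apply]

/-- Laurent polynomials with exponents in the monoid `H`. -/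
def suppAlg (H : AddSubmonoid (Fin r → ℤ)) : Subalgebra ℂ (Laur r) where
  carrier := {c | ∀ l, c.coeff l ≠ 0 → l ∈ H}
  mul_mem' := by
    classical
    intro c d hc hd l hl
    obtain ⟨x, hx, y, hy, rfl⟩ := Finset.mem_add.1
      (AddMonoidAlgebra.support_coeff_mul_subset _ _ (Finsupp.mem_support_iff.2 hl))
    exact H.add_mem (hc x (Finsupp.mem_support_iff.1 hx)) (hd y (Finsupp.mem_support_iff.1 hy))
  add_mem' := by
    intro c d hc hd l hl
    rw [AddMonoidAlgebra.coeff_add, Finsupp.add_apply] at hl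
    by_cases h : c.coeff l = 0
    · exact hd l fun h' => hl (by rw [h, h', add_zero])
    · exact hc l h
  algebraMap_mem' := by
    classical
    intro a l hl
    have : (algebraMap ℂ (Laur r) a) = mono 0 a := by simp
    rw [this, coeff_mono] at hl
    by_cases h : (0 : Fin r → ℤ) = l
    · rw [← h]; exact H.zero_mem
    · rw [if_neg h] at hl; exact absurd rfl hl

theorem mono_mem_suppAlg {H : AddSubmonoid (Fin r → ℤ)} {l : Fin r → ℤ} (hl : l ∈ H) (a : ℂ) :
    mono l a ∈ suppAlg H := by
  classical
  intro m hm
  rw [coeff_mono] at hm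
  by_cases h : l = m
  · rwa [← h]
  · rw [if_neg h] at hm; exact absurd rfl hm

theorem suppAlg_mono {H H' : AddSubmonoid (Fin r → ℤ)} (h : H ≤ H') : suppAlg H ≤ suppAlg H' :=
  fun _ hc l hl => h (hc l hl)

/-- An additive map that sends the monomials with exponents in `H` into `B`. -/
theorem mem_of_mono {H : AddSubmonoid (Fin r → ℤ)} (φ : Laur r →+ Laur r) (B : Subalgebra ℂ (Laur r))
    (h : ∀ l ∈ H, ∀ a, φ (mono l a) ∈ B) {c : Laur r} (hc : c ∈ suppAlg H) : φ c ∈ B := by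
  rw [← sum_mono c, map_sum]
  exact B.sum_mem fun l hl => h l (hc l (Finsupp.mem_support_iff.1 hl)) _

/-- The sum of the absolute values of the coefficients. -/
def norm1 (c : Laur r) : ℝ := ∑ l ∈ c.coeff.support, ‖c.coeff l‖

theorem norm1_eq_sum {c : Laur r} {T : Finset (Fin r → ℤ)} (h : c.coeff.support ⊆ T) :
    norm1 c = ∑ l ∈ T, ‖c.coeff l‖ :=
  Finset.sum_subset h fun l _ hl => by rw [Finsupp.notMem_support_iff.1 hl, norm_zero]

theorem norm1_nonneg (c : Laur r) : 0 ≤ norm1 c := Finset.sum_nonneg fun _ _ => norm_nonneg _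

theorem norm1_zero : norm1 (0 : Laur r) = 0 := by simp [norm1]

theorem norm1_add_le (c d : Laur r) : norm1 (c + d) ≤ norm1 c + norm1 d := by
  classical
  rw [norm1_eq_sum (c := c) (T := c.coeff.support ∪ d.coeff.support) Finset.subset_union_left,
    norm1_eq_sum (c := d) (T := c.coeff.support ∪ d.coeff.support) Finset.subset_union_right,
    norm1_eq_sum (c := c + d) (T := c.coeff.support ∪ d.coeff.support) Finsupp.support_add,
    ← Finset.sum_add_distrib]
  exact Finset.sum_le_sum fun l _ => norm_add_le _ _

theorem norm1_sum_le {κ : Type*} (T : Finset κ) (c : κ → Laur r) :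
    norm1 (∑ k ∈ T, c k) ≤ ∑ k ∈ T, norm1 (c k) := by
  classical
  induction T using Finset.induction_on with
  | empty => simp [norm1_zero]
  | insert k T hk ih =>
    rw [Finset.sum_insert hk, Finset.sum_insert hk]
    exact (norm1_add_le _ _).trans (add_le_add_right ih _)

theorem norm1_mono (l : Fin r → ℤ) (a : ℂ) : norm1 (mono l a) = ‖a‖ := by
  classical
  have h : (mono l a).coeff.support ⊆ {l} := Finsupp.support_single_subset
  rw [norm1_eq_sum h, Finset.sum_singleton, coeff_mono,
    if_pos rfl]

theorem norm1_map_le (φ : Laur r →+ Laur r) {B : ℝ} (h : ∀ l a, norm1 (φ (mono l a)) ≤ B * ‖a‖)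
    (c : Laur r) : norm1 (φ c) ≤ B * norm1 c := by
  conv_lhs => rw [← sum_mono c, map_sum]
  refine (norm1_sum_le _ _).trans ?_
  rw [norm1, Finset.mul_sum]
  exact Finset.sum_le_sum fun l _ => h l _

theorem norm1_mono_mul_le (l : Fin r → ℤ) (a : ℂ) (c : Laur r) :
    norm1 (mono l a * c) ≤ ‖a‖ * norm1 c :=
  norm1_map_le (AddMonoidHom.mulLeft (mono l a)) (fun m b => by
    rw [AddMonoidHom.coe_mulLeft, mono_mul, norm1_mono, norm_mul]) c

theorem norm1_sub_mono_mul_le (l : Fin r → ℤ) {a : ℂ} (ha : ‖a‖ ≤ 1) (c : Laur r) :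
    norm1 ((1 - mono l a) * c) ≤ 2 * norm1 c := by
  have : (1 - mono l a) * c = c + mono l (-a) * c := by
    have : mono l (-a) = - mono l a := AddMonoidAlgebra.single_neg _ _
    rw [this]; ring
  rw [this]
  have h1 := norm1_add_le c (mono l (-a) * c)
  have h2 := norm1_mono_mul_le l (-a) c
  rw [norm_neg] at h2
  have h3 := mul_le_mul_of_nonneg_right ha (norm1_nonneg c)
  linarith

variable {A : Fin r → Fin r → Prop}

theorem norm1_refl_le (i : Fin r) (c : Laur r) : norm1 (refl A i c) ≤ norm1 c := by
  have := norm1_map_le (refl A i : Laur r →+ Laur r) (B := 1) (fun m b => by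
    rw [one_mul]
    change norm1 (refl A i (mono m b)) ≤ _
    rw [refl_mono, norm1_mono]) c
  rwa [one_mul] at this

theorem norm_sgn (i : Fin r) (l : Fin r → ℤ) : ‖sgn A i l‖ = 1 := by
  simp [sgn]

theorem norm1_eps_le (i : Fin r) (c : Laur r) : norm1 (eps A i c) ≤ norm1 c := by
  have := norm1_map_le (eps A i : Laur r →+ Laur r) (B := 1) (fun m b => by
    rw [one_mul]
    change norm1 (eps A i (mono m b)) ≤ _
    rw [eps_mono, norm1_mono, norm_mul, norm_sgn, one_mul]) c
  rwa [one_mul] at this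

theorem refl_mem_suppAlg {H H' : AddSubmonoid (Fin r → ℤ)} {i : Fin r}
    (h : ∀ l ∈ H, latRefl A i l ∈ H') {c : Laur r} (hc : c ∈ suppAlg H) :
    refl A i c ∈ suppAlg H' := by
  refine mem_of_mono (refl A i : Laur r →+ Laur r) _ (fun l hl a => ?_) hc
  change refl A i (mono l a) ∈ _
  rw [refl_mono]
  exact mono_mem_suppAlg (h l hl) a

theorem eps_mem_suppAlg {H : AddSubmonoid (Fin r → ℤ)} {i : Fin r}
    {c : Laur r} (hc : c ∈ suppAlg H) : eps A i c ∈ suppAlg H := by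
  refine mem_of_mono (eps A i : Laur r →+ Laur r) _ (fun l hl a => ?_) hc
  change eps A i (mono l a) ∈ _
  rw [eps_mono]
  exact mono_mem_suppAlg hl _

/-- The cone of nonnegative exponents. -/
def posCone (r : ℕ) : AddSubmonoid (Fin r → ℤ) where
  carrier := {l | 0 ≤ l}
  zero_mem' := le_refl (0 : Fin r → ℤ)
  add_mem' := fun {a b} (ha : 0 ≤ a) (hb : 0 ≤ b) => (add_nonneg ha hb : 0 ≤ a + b)

theorem mem_posCone {l : Fin r → ℤ} : l ∈ posCone r ↔ 0 ≤ l := Iff.rfl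

/-- Every exponent of the product has `i`-th coordinate at least `1`. -/
theorem coeff_zero_mono_mul {i : Fin r} {c : Laur r} (hc : c ∈ suppAlg (posCone r)) :
    (mono (Pi.single i 1) 1 * c).coeff 0 = 0 := by
  by_contra h
  classical
  obtain ⟨x, hx, y, hy, hxy⟩ := Finset.mem_add.1
    (AddMonoidAlgebra.support_coeff_mul_subset _ _ (Finsupp.mem_support_iff.2 h))
  have hx' := Finset.mem_singleton.1 (Finsupp.support_single_subset hx)
  have hy' := hc y (Finsupp.mem_support_iff.1 hy) i
  have := congrFun hxy i
  rw [hx'] at this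
  simp at this hy'
  omega

end Supp

/-! ### The coordinates of the roots -/

section RootVec

variable {ι V V' : Type*} [Finite ι] [AddCommGroup V] [Module ℝ V] [AddCommGroup V'] [Module ℝ V']
  {P : RootPairing ι ℝ V V'} [P.IsCrystallographic] [P.IsReduced] (b : P.Base) {r : ℕ}
  (e : Fin r ≃ b.support)

/-- The coordinates of a root with respect to the simple roots. -/
def rootVec (α : ι) (j : Fin r) : ℤ := b.toWeightBasisInt.repr (P.rootSpanMem ℤ α) (e j)

theorem sum_rootVec (α : ι) : P.root α = ∑ j, rootVec b e α j • P.root (e j) := by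
  have h := b.toWeightBasisInt.sum_repr (P.rootSpanMem ℤ α)
  have h2 := congrArg (Subtype.val) h
  rw [AddSubmonoidClass.coe_finsetSum] at h2
  rw [← Equiv.sum_comp e] at h2
  rw [← show ((P.rootSpanMem ℤ α : P.rootSpan ℤ) : V) = P.root α from rfl, ← h2]
  refine Finset.sum_congr rfl fun j _ => ?_
  rw [Submodule.coe_smul, b.coe_toWeightBasisInt_apply]
  rfl

theorem eq_rootVec {α : ι} {f : Fin r → ℤ} (h : P.root α = ∑ j, f j • P.root (e j)) :
    rootVec b e α = f := by
  have h1 : P.rootSpanMem ℤ α = ∑ j, f j • b.toWeightBasisInt (e j) := by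
    apply Subtype.ext
    rw [AddSubmonoidClass.coe_finsetSum]
    change P.root α = _
    rw [h]
    refine Finset.sum_congr rfl fun j _ => ?_
    rw [Submodule.coe_smul, b.coe_toWeightBasisInt_apply]
  ext j
  unfold rootVec
  rw [h1, map_sum, Finsupp.finsetSum_apply, Finset.sum_eq_single j]
  · simp
  · intro k _ hk
    simp [hk]
  · simp

theorem rootVec_simple (i : Fin r) : rootVec b e (e i) = Pi.single i 1 := by
  apply eq_rootVec
  rw [Finset.sum_eq_single i]
  · simp
  · intro k _ hk; simp [hk]
  · simp

theorem height_eq_sum_rootVec (α : ι) : b.height α = ∑ j, rootVec b e α j := by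
  classical
  let f : ι → ℤ := fun k => if h : k ∈ b.support then rootVec b e α (e.symm ⟨k, h⟩) else 0
  have hf : ∀ k : b.support, f k = rootVec b e α (e.symm k) := fun k => dif_pos k.2
  have h1 : P.root α = ∑ k ∈ b.support, f k • P.root k := by
    rw [sum_rootVec b e α, ← Finset.sum_coe_sort b.support, ← Equiv.sum_comp e]
    simp [hf]
  rw [RootPairing.Base.height_eq_sum h1, ← Finset.sum_coe_sort b.support, ← Equiv.sum_comp e]
  simp [hf]

theorem rootVec_nonneg {α : ι} (hα : b.IsPos α) : 0 ≤ rootVec b e α := by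
  obtain ⟨f, -, hf, h⟩ := b.exists_root_eq_sum_int α
  have h1 : rootVec b e α = fun j => f (e j) := by
    apply eq_rootVec
    rw [h, ← Finset.sum_coe_sort, ← Equiv.sum_comp e]
  rcases hf with hf | hf
  · rw [h1]; exact fun j => hf.le _
  · exfalso
    rw [RootPairing.Base.IsPos, height_eq_sum_rootVec b e, h1] at hα
    exact absurd hα (not_lt.2 (Finset.sum_nonpos fun j _ => hf.le _))

variable {b e}

/-- This identifies the substitution on exponents with the Weyl group action on the roots. In a
simply-laced system the Cartan integer of `α` against `α_i` is twice the `i`-th coordinate of `α`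
minus the sum of the adjacent coordinates. -/
theorem rootVec_reflectionPerm (hsl : b.cartanMatrix.IsSimplyLaced) (i : Fin r) (α : ι) :
    rootVec b e (P.reflectionPerm (e i) α) = latRefl (Adj b e) i (rootVec b e α) := by
  classical
  have hp : P.pairingIn ℤ α (e i) = 2 * rootVec b e α i - adjSum (Adj b e) i (rootVec b e α) := by
    have h1 : (P.pairing α (e i) : ℝ) = ∑ j, rootVec b e α j * P.pairing (e j) (e i) := by
      rw [← P.root_coroot_eq_pairing, sum_rootVec b e α, map_sum, LinearMap.sum_apply]
      refine Finset.sum_congr rfl fun j _ => ?_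
      rw [← P.root_coroot_eq_pairing, map_zsmul, LinearMap.smul_apply, zsmul_eq_mul]
    have h2 : ∀ a c, P.pairing a c = (P.pairingIn ℤ a c : ℝ) := fun a c =>
      (P.algebraMap_pairingIn ℤ a c).symm
    simp only [h2] at h1
    have h3 : P.pairingIn ℤ α (e i) = ∑ j, rootVec b e α j * P.pairingIn ℤ (e j) (e i) := by
      exact_mod_cast h1
    have h4 : adjSum (Adj b e) i (rootVec b e α) =
      ∑ j, if Adj b e i j then rootVec b e α j else 0 := rfl
    rw [h3, h4, eq_sub_iff_add_eq, ← Finset.sum_add_distrib, Finset.sum_eq_single i]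
    · rw [if_neg (adj_irrefl i)]
      have := b.cartanMatrix_apply_same (e i)
      change P.pairingIn ℤ (e i) (e i) = 2 at this
      rw [this]; ring
    · intro j _ hj
      by_cases h : Adj b e i j
      · rw [if_pos h, ((adj_iff hsl).1 (adj_symm hsl h)).2]; ring
      · rw [if_neg h, pairing_of_not_adj hsl hj (fun h' => h (adj_symm hsl h'))]; ring
    · simp
  apply eq_rootVec
  rw [root_reflectionPerm_simple, hp, latRefl_eq_add]
  simp only [Pi.add_apply, add_smul, Finset.sum_add_distrib, ← sum_rootVec]
  rw [sub_eq_add_neg, ← neg_smul]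
  congr 1
  rw [Finset.sum_eq_single i]
  · simp
  · intro j _ hj; simp [hj]
  · simp

end RootVec

/-! ### The invariant function as a sum over the Weyl group -/

section InvFunc

variable {ι V V' : Type*} [Finite ι] [AddCommGroup V] [Module ℝ V] [AddCommGroup V'] [Module ℝ V']
  {P : RootPairing ι ℝ V V'} [P.IsCrystallographic] [P.IsReduced] {b : P.Base} {r : ℕ}
  {e : Fin r ≃ b.support} {q : ℕ} (hq : 0 < q)

theorem var_eq_div (j : Fin r) (hq : 0 < q) : (var j : RatFunc r) = zvar q j / csqrt q := by
  rw [zvar, mul_div_cancel_left₀ _ (csqrt_ne_zero hq)]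

/-- With `s = √q`, `u = z_i` and `q = s²`, the contributions of the even and the odd part are
regrouped by the substituted `f` and the substituted `ε_i`-image of `f`; the coefficients then
factor as `coefP` and `coefM`. -/
theorem slash_eq (i : Fin r) (f : RatFunc r) :
    slash b e q i f = slashEnd hq (adj_irrefl (b := b) (e := e)) i f := by
  have hs := csqrt_ne_zero (r := r) hq
  have hz := zvar_ne_zero hq i
  have h1 := csqrt_sub_zvar_ne hq i
  have two : (2 : RatFunc r) ≠ 0 := two_ne_zero
  rw [slash, evenPart, oddPart, subst_epsVec hq, subst_sigmaVec hq, subst_sigmaVec hq, slashEnd_apply,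
    slashOp, map_div₀, map_div₀, map_add, map_sub, map_ofNat, ← csqrt_mul_self, var_eq_div i hq,
    coefP, coefM]
  change _ = _ * (sigmaHom hq (adj_irrefl (b := b) (e := e)) i) f +
    _ * (sigmaHom hq (adj_irrefl (b := b) (e := e)) i) (epsHom (Adj b e) hq i f)
  generalize (sigmaHom hq (adj_irrefl (b := b) (e := e)) i) f = X
  generalize (sigmaHom hq (adj_irrefl (b := b) (e := e)) i) (epsHom (Adj b e) hq i f) = Y
  have h2 : 1 - zvar q i / csqrt q = (csqrt q - zvar q i) / csqrt q := by field_simp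
  rw [h2]
  field_simp
  ring

variable {hq} in
theorem slashEnd_div {A : Fin r → Fin r → Prop} {hA : ∀ i, ¬ A i i} (i : Fin r)
    {g : RatFunc r} (hg : epsHom A hq i g = g) (h : RatFunc r) :
    slashEnd hq hA i (h / g) = slashEnd hq hA i h / sigmaHom hq hA i g := by
  rw [slashEnd_apply, slashEnd_apply, slashOp, slashOp]
  simp only [RingHom.coe_coe, map_div₀, hg]
  ring

theorem epsHom_sigmaHom_of_forall {A : Fin r → Fin r → Prop} (hA : ∀ i, ¬ A i i) {g : RatFunc r}
    (hg : ∀ i, epsHom A hq i g = g) (i j : Fin r) :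
    epsHom A hq i (sigmaHom hq hA j g) = sigmaHom hq hA j g := by
  by_cases h : A i j
  · rw [epsHom_sigmaHom_of_adj hq hA h, hg, hg]
  · rw [epsHom_sigmaHom_of_not_adj hq hA h, hg]

/-- An `ε`-even denominator passes through the slash operator by plain substitution, and its image
is again even under all sign changes. For `g = Δ` this absorbs the cocycle: `(1 | w)(x) / Δ(w x)` is
`(1 / Δ) | w`. -/
theorem foldl_slash_div (l : List (Fin r)) (h g : RatFunc r)
    (hg : ∀ i, epsHom (Adj b e) hq i g = g) :
    l.foldl (fun g i => slash b e q i g) h / l.foldl (fun g i => subst (sigmaVec b e q i) g) g =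
      l.foldl (fun g i => slash b e q i g) (h / g) := by
  induction l generalizing h g with
  | nil => rfl
  | cons i t ih =>
    simp only [List.foldl_cons]
    rw [subst_sigmaVec hq, ih _ _ (fun j => epsHom_sigmaHom_of_forall hq _ hg j i), slash_eq hq,
      slash_eq hq, slashEnd_div i (hg i)]

/-- `foldl` applies the first letter first, whereas a product of operators applies its last factor
first. The reversed word represents the inverse, because simple reflections are involutions. -/
theorem foldl_slash_eq {U : P.weylGroup →* AddMonoid.End (RatFunc r)}
    (hU : ∀ i, U (simpleReflection b e i) = slashEnd hq (adj_irrefl (b := b) (e := e)) i)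
    (l : List (Fin r)) (f : RatFunc r) :
    l.foldl (fun g i => slash b e q i g) f = U ((l.map (simpleReflection b e)).prod)⁻¹ f := by
  induction l generalizing f with
  | nil => simp
  | cons i t ih =>
    rw [List.foldl_cons, ih, slash_eq hq, ← hU, List.map_cons, List.prod_cons, mul_inv_rev,
      simpleReflection_inv, map_mul]
    rfl

/-- The slash action does not depend on the words chosen in `word`; this is what the Coxeter
relations are for. -/
theorem exists_slashHom (hsl : b.cartanMatrix.IsSimplyLaced) :
    ∃ U : P.weylGroup →* AddMonoid.End (RatFunc r),
      ∀ i, U (simpleReflection b e i) = slashEnd hq (adj_irrefl (b := b) (e := e)) i :=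
  exists_hom _ (slashEnd_sq hq _) (fun _ _ hij h => slashEnd_comm hq _ hij h
    fun h' => h (adj_symm hsl h')) (fun _ _ h => slashEnd_braid hq _ h (adj_symm hsl h)) hsl

variable (b e) in
/-- The product of `1 - c z^{2 α}` over the roots `α ∈ Ψ`. -/
def rootProd (c : ℂ) (Ψ : Finset ι) : Laur r := ∏ α ∈ Ψ, (1 - mono (2 • rootVec b e α) c)

variable (b) in
/-- The positive roots. -/
def posRoots : Finset ι := (Set.toFinite {α | b.IsPos α}).toFinset

theorem mem_posRoots {α : ι} : α ∈ posRoots b ↔ b.IsPos α := by simp [posRoots]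

/-- `q^{d(α)} x^{2α} = z^{2α}`, because `d(α)` is the sum of the coordinates of `α`. -/
theorem Delta_eq : Delta b e q = toRat hq (rootProd b e 1 (posRoots b)) := by
  have hfin : Delta b e q = ∏ α ∈ posRoots b, (1 - cq q ^ b.height α *
      ∏ j : Fin r, var j ^ (2 * b.toWeightBasisInt.repr (P.rootSpanMem ℤ α) (e j))) := by
    unfold Delta
    exact finprod_mem_eq_finite_toFinset_prod _ (Set.toFinite {α | b.IsPos α})
  rw [hfin, rootProd, map_prod]
  refine Finset.prod_congr rfl fun α _ => ?_
  rw [map_sub, map_one, toRat_mono, map_one, one_mul, height_eq_sum_rootVec b e]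
  congr 1
  have h0 : cq q ≠ (0 : RatFunc r) := by
    rw [← csqrt_mul_self]; exact mul_ne_zero (csqrt_ne_zero hq) (csqrt_ne_zero hq)
  have h1 : ∀ T : Finset (Fin r), (cq q : RatFunc r) ^ (∑ j ∈ T, rootVec b e α j) =
      ∏ j ∈ T, csqrt q ^ (2 * rootVec b e α j) := by
    intro T
    induction T using Finset.cons_induction with
    | empty => simp
    | cons j T hj ih =>
      rw [Finset.sum_cons, Finset.prod_cons, zpow_add₀ h0, ih, zpow_mul, ← csqrt_mul_self]
      congr 2
      norm_cast
      rw [pow_two]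
  rw [h1, ← Finset.prod_mul_distrib]
  refine Finset.prod_congr rfl fun j _ => ?_
  rw [Pi.smul_apply, zvar, mul_zpow]
  simp [rootVec]

theorem eps_rootProd (i : Fin r) (c : ℂ) (Ψ : Finset ι) :
    eps (Adj b e) i (rootProd b e c Ψ) = rootProd b e c Ψ := by
  rw [rootProd, map_prod]
  refine Finset.prod_congr rfl fun α _ => ?_
  rw [map_sub, map_one, eps_mono, two_smul, sgn_add, sgn_mul_self, one_mul]

theorem refl_rootProd [DecidableEq ι] (hsl : b.cartanMatrix.IsSimplyLaced) (i : Fin r) (c : ℂ) (Ψ : Finset ι) :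
    refl (Adj b e) i (rootProd b e c Ψ) =
      rootProd b e c (Ψ.image (P.reflectionPerm (e i))) := by
  rw [rootProd, map_prod, rootProd, Finset.prod_image
    (fun _ _ _ _ h => (P.reflectionPerm (e i)).injective h)]
  refine Finset.prod_congr rfl fun α _ => ?_
  rw [map_sub, map_one, refl_mono, map_nsmul, rootVec_reflectionPerm hsl]

theorem rootProd_ne_zero (c : ℂ) {Ψ : Finset ι} (hΨ : ∀ α ∈ Ψ, b.IsPos α) : rootProd b e c Ψ ≠ 0 := by
  have : IsDomain (Laur r) := (toRat_injective (r := r) (q := 1) one_pos).isDomain _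
  rw [rootProd, Finset.prod_ne_zero_iff]
  intro α hα h
  have h2 : 2 • rootVec b e α ≠ 0 := by
    intro h0
    have h1 : rootVec b e α = 0 := (smul_eq_zero.1 h0).resolve_left two_ne_zero
    have h3 := hΨ α hα
    rw [RootPairing.Base.IsPos, height_eq_sum_rootVec b e, h1] at h3
    simp at h3
  refine toRat_ne_zero_of_two (q := 1) one_pos h2 (a := 1) (c := -c) one_ne_zero ?_
  have h4 : mono (2 • rootVec b e α) (-c) = - mono (2 • rootVec b e α) c :=
    AddMonoidAlgebra.single_neg _ _
  rw [h4, mono_zero_one, ← sub_eq_add_neg, h, map_zero]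

theorem image_erase_posRoots [DecidableEq ι] (i : Fin r) :
    ((posRoots b).erase (e i)).image (P.reflectionPerm (e i)) = (posRoots b).erase (e i) := by
  have key : ∀ α ∈ (posRoots b).erase (e i), P.reflectionPerm (e i) α ∈ (posRoots b).erase (e i) := by
    intro α hα
    rw [Finset.mem_erase, mem_posRoots] at hα ⊢
    refine ⟨?_, isPos_simpleReflection b e hα.2 hα.1⟩
    intro h
    have h2 : α = P.reflectionPerm (e i) (e i) := by
      have := congrArg (P.reflectionPerm (e i)) h
      rwa [P.reflectionPerm_self] at this
    have h3 := isPos_neg_of_perm b 1 (e i)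
    simp only [map_one, Equiv.Perm.one_apply] at h3
    have h4 := isPos_simple b e i
    have h5 := hα.2
    rw [RootPairing.Base.IsPos] at h4 h5
    rw [h2] at h5
    omega
  ext α
  constructor
  · intro h
    obtain ⟨β, hβ, rfl⟩ := Finset.mem_image.1 h
    exact key β hβ
  · intro h
    exact Finset.mem_image.2 ⟨_, key α h, P.reflectionPerm_self _ _⟩

theorem refl_rootProd_erase [DecidableEq ι] (hsl : b.cartanMatrix.IsSimplyLaced) (i : Fin r) (c : ℂ) :
    refl (Adj b e) i (rootProd b e c ((posRoots b).erase (e i))) =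
      rootProd b e c ((posRoots b).erase (e i)) := by
  rw [refl_rootProd hsl, image_erase_posRoots]

theorem rootProd_erase [DecidableEq ι] (i : Fin r) (c : ℂ) :
    rootProd b e c (posRoots b) = (1 - mono (2 • Pi.single i 1) c) *
      rootProd b e c ((posRoots b).erase (e i)) := by
  rw [rootProd, ← Finset.mul_prod_erase _ _ (mem_posRoots.2 (isPos_simple b e i)), rootVec_simple]
  rfl

theorem zvar_sq (i : Fin r) : toRat hq (mono (2 • Pi.single i 1) 1) = zvar q i ^ 2 := by
  rw [two_smul, toRat_var_mul, pow_two]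

theorem toRat_mono_smul (l : Fin r → ℤ) (c : ℂ) :
    toRat hq (mono l c) = algebraMap ℂ (RatFunc r) c * toRat hq (mono l 1) := by
  rw [toRat_mono, toRat_mono, map_one, one_mul]

/-- `σ_i` permutes the factors of the positive roots other than `α_i`, and the remaining factor `1 -
z_i²` becomes `1 - z_i⁻²`. -/
theorem sigmaHom_Delta (hsl : b.cartanMatrix.IsSimplyLaced) (i : Fin r) :
    sigmaHom hq (adj_irrefl (b := b) (e := e)) i (Delta b e q) * zvar q i ^ 2 = - Delta b e q := by
  classical
  have hz := zvar_ne_zero hq i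
  rw [Delta_eq hq, sigmaHom_toRat, rootProd_erase i, map_mul, refl_rootProd_erase hsl, map_mul, map_mul,
    ← sigmaHom_toRat hq (adj_irrefl (b := b) (e := e)), map_sub, map_sub, map_one, map_one, zvar_sq,
    map_pow, sigmaHom_zvar_self]
  field_simp
  ring

variable (b e) in
theorem epsHom_Delta (i : Fin r) : epsHom (Adj b e) hq i (Delta b e q) = Delta b e q := by
  rw [Delta_eq hq, epsHom_toRat, eps_rootProd]

include hq in
theorem Delta_ne_zero : Delta b e q ≠ 0 := by
  rw [Delta_eq hq, map_ne_zero_iff _ (toRat_injective hq)]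
  exact rootProd_ne_zero _ fun α => mem_posRoots.1

/-- The factor `Δ(x)` of the cocycle cancels the outer division and leaves the terms `(1 / Δ) | w`.
Replacing `w` by `w⁻¹` in the sum turns this right action into the left action `U`. -/
theorem invFunc_eq [P.IsRootSystem] {U : P.weylGroup →* AddMonoid.End (RatFunc r)}
    (hU : ∀ i, U (simpleReflection b e i) = slashEnd hq (adj_irrefl (b := b) (e := e)) i) :
    invFunc b e q = ∑ᶠ w : P.weylGroup, U w (1 / Delta b e q) := by
  have : Finite P.weylGroup := finite_weylGroup
  rw [invFunc, invFunc₀, div_eq_mul_inv, finsum_mul]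
  rw [← finsum_comp_equiv (Equiv.inv P.weylGroup)]
  refine finsum_congr fun w => ?_
  have h1 : ∀ w, slashW b e q w 1 / substW b e q w (Delta b e q) = U w⁻¹ (1 / Delta b e q) := by
    intro w
    rw [slashW, substW, foldl_slash_div hq _ _ _ (epsHom_Delta b e hq), foldl_slash_eq hq hU]
    rw [word, (exists_word b e w).choose_spec]
  have h2 := h1 w⁻¹
  rw [inv_inv] at h2
  rw [Equiv.inv_apply, ← h2, cocycle]
  have := Delta_ne_zero (b := b) (e := e) hq
  field_simp

/-- Left multiplication by `s_i` permutes the terms of the sum in `invFunc_eq`. -/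
theorem slashEnd_invFunc [P.IsRootSystem] (hsl : b.cartanMatrix.IsSimplyLaced) (i : Fin r) :
    slashEnd hq (adj_irrefl (b := b) (e := e)) i (invFunc b e q) = invFunc b e q := by
  obtain ⟨U, hU⟩ := exists_slashHom (b := b) (e := e) hq hsl
  have : Finite P.weylGroup := finite_weylGroup
  have := Fintype.ofFinite P.weylGroup
  rw [invFunc_eq hq hU, finsum_eq_sum_of_fintype, map_sum]
  rw [← Equiv.sum_comp (Equiv.mulLeft (simpleReflection b e i))]
  refine Finset.sum_congr rfl fun w _ => ?_
  rw [Equiv.coe_mulLeft, map_mul, hU, AddMonoid.End.coe_mul, Function.comp_apply, ← Function.comp_apply (f := slashEnd hq _ i),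
    ← AddMonoid.End.coe_mul, slashEnd_sq]
  rfl

end InvFunc

/-! ### The numerator of the invariant function -/

section Numerator

variable {ι V V' : Type*} [Finite ι] [AddCommGroup V] [Module ℝ V] [AddCommGroup V'] [Module ℝ V']
  {P : RootPairing ι ℝ V V'} [P.IsCrystallographic] [P.IsReduced] {b : P.Base} {r : ℕ}
  {e : Fin r ≃ b.support} {q : ℕ} (hq : 0 < q)

theorem one_le_rootQ : 1 ≤ Real.sqrt q ↔ 1 ≤ q := by
  rw [Real.one_le_sqrt]; exact_mod_cast Iff.rfl

theorem norm_rootQ : ‖rootQ q‖ = Real.sqrt q := by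
  rw [Complex.norm_real, Real.norm_of_nonneg (Real.sqrt_nonneg _)]

/-- The recursion for the numerators: the effect of `f ↦ Δ (f / Δ | σᵢ)` on the numerator. -/
def stepNum (A : Fin r → Fin r → Prop) (q : ℕ) (i : Fin r) (n : Laur r) : Laur r :=
  mono (Pi.single i 1) 1 * ((-(1 / (2 * (q : ℂ)))) • ((mono 0 (rootQ q) + mono (Pi.single i 1) 1) *
    ((mono 0 (rootQ q - 1) * ((1 + mono (Pi.single i 1) 1) * refl A i n)) +
      (mono 0 (rootQ q + 1) * ((mono (Pi.single i 1) 1 - 1) * refl A i (eps A i n))))))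

/-- The factor `-z_i²` is `Δ(x) / Δ(σ_i x)`, and `1 - z_i² / q = (√q - z_i)(√q + z_i) / q` clears
the pole of the slash coefficients at `z_i = √q`. Their pole at `z_i = 0` uses up only one power of
`z_i`; the other is the outer factor of `stepNum`, which later kills constant terms. -/
theorem toRat_stepNum {A : Fin r → Fin r → Prop} (hA : ∀ i, ¬ A i i) (i : Fin r) (n : Laur r) :
    toRat hq (stepNum A q i n) =
      -zvar q i ^ 2 * (1 - zvar q i ^ 2 / cq q) * slashEnd hq hA i (toRat hq n) := by
  have hs := csqrt_ne_zero (r := r) hq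
  have hz := zvar_ne_zero hq i
  have h1 := csqrt_sub_zvar_ne hq i
  have two : (2 : RatFunc r) ≠ 0 := two_ne_zero
  have hc : ∀ c : ℂ, toRat hq (mono (0 : Fin r → ℤ) c) = algebraMap ℂ (RatFunc r) c := by
    intro c; rw [toRat_mono]; simp
  have hs' : algebraMap ℂ (RatFunc r) (rootQ q) = csqrt q := rfl
  have hq' : algebraMap ℂ (RatFunc r) (q : ℂ) = cq q := rfl
  rw [stepNum, Algebra.smul_def]
  simp only [map_mul, map_add, map_sub, map_one, toRat_var, hc, slashEnd_apply, slashOp,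
    AlgHom.commutes, map_neg, map_div₀, map_ofNat, hs', hq', RingHom.coe_coe, sigmaHom_toRat,
    epsHom_toRat, coefP, coefM, ← csqrt_mul_self]
  field_simp
  ring

/-- With `s = √q ≥ 1` the factors contribute `(1 / (2 s²)) (s + 1) (2 (s - 1) + 2 (s + 1)) = 2 (1 +
1 / s) ≤ 4`, a bound independent of `q`. -/
theorem norm1_stepNum_le (hq : 0 < q) (A : Fin r → Fin r → Prop) (i : Fin r) (n : Laur r) :
    norm1 (stepNum A q i n) ≤ 4 * norm1 n := by
  set s := Real.sqrt q with hs
  have hs1 : 1 ≤ s := one_le_rootQ.2 hq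
  have hss : s * s = q := Real.mul_self_sqrt (Nat.cast_nonneg q)
  have h1 : ∀ c : Laur r, norm1 ((1 + mono (Pi.single i 1) 1) * c) ≤ 2 * norm1 c := by
    intro c
    have := norm1_sub_mono_mul_le (Pi.single i 1) (a := -1) (by simp) c
    have h : mono (Pi.single i (1 : ℤ) : Fin r → ℤ) (-1) = - mono (Pi.single i 1) 1 :=
      AddMonoidAlgebra.single_neg _ _
    rwa [h, sub_neg_eq_add] at this
  have h2 : ∀ c : Laur r, norm1 ((mono (Pi.single i 1) 1 - 1) * c) ≤ 2 * norm1 c := by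
    intro c
    have := norm1_sub_mono_mul_le (Pi.single i 1) (a := 1) (by simp) (-c)
    have hneg : norm1 (-c) = norm1 c := by
      unfold norm1; simp
    rw [hneg] at this
    convert this using 2
    ring
  have h3 : ∀ c : Laur r, norm1 ((mono 0 (rootQ q) + mono (Pi.single i 1) 1) * c) ≤
      (s + 1) * norm1 c := by
    intro c
    rw [add_mul]
    refine (norm1_add_le _ _).trans ?_
    have e1 := norm1_mono_mul_le (0 : Fin r → ℤ) (rootQ q) c
    have e2 := norm1_mono_mul_le (Pi.single i (1 : ℤ) : Fin r → ℤ) 1 c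
    rw [norm_rootQ] at e1
    rw [norm_one] at e2
    linarith
  have h4 : ‖rootQ q - 1‖ = s - 1 := by
    rw [show rootQ q - 1 = ((s - 1 : ℝ) : ℂ) by rw [Complex.ofReal_sub, Complex.ofReal_one],
      Complex.norm_real, Real.norm_of_nonneg (by linarith)]
  have h5 : ‖rootQ q + 1‖ = s + 1 := by
    rw [show rootQ q + 1 = ((s + 1 : ℝ) : ℂ) by rw [Complex.ofReal_add, Complex.ofReal_one],
      Complex.norm_real, Real.norm_of_nonneg (by linarith)]
  have h6 : ∀ (a : ℂ) (c : Laur r), norm1 (a • c) ≤ ‖a‖ * norm1 c := by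
    intro a c
    have : a • c = mono 0 a * c := by
      rw [Algebra.smul_def]; simp
    rw [this]
    exact norm1_mono_mul_le _ _ _
  have h7 : ‖(-(1 / (2 * (q : ℂ))))‖ = 1 / (2 * (s * s)) := by
    rw [hss]; simp
  have hN := norm1_nonneg n
  rw [stepNum]
  refine (norm1_mono_mul_le _ _ _).trans ?_
  rw [norm_one, one_mul]
  refine (h6 _ _).trans ?_
  rw [h7]
  have e1 := (norm1_mono_mul_le (0 : Fin r → ℤ) (rootQ q - 1) _).trans
    (mul_le_mul_of_nonneg_left ((h1 (refl A i n)).trans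
      (mul_le_mul_of_nonneg_left (norm1_refl_le i n) two_pos.le)) (norm_nonneg (rootQ q - 1)))
  have e2 := (norm1_mono_mul_le (0 : Fin r → ℤ) (rootQ q + 1) _).trans
    (mul_le_mul_of_nonneg_left ((h2 (refl A i (eps A i n))).trans
      (mul_le_mul_of_nonneg_left ((norm1_refl_le i _).trans (norm1_eps_le i n)) two_pos.le))
      (norm_nonneg (rootQ q + 1)))
  rw [h4] at e1
  rw [h5] at e2
  have e3 := (h3 _).trans (mul_le_mul_of_nonneg_left ((norm1_add_le _ _).trans (add_le_add e1 e2))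
    (by linarith : (0 : ℝ) ≤ s + 1))
  refine (mul_le_mul_of_nonneg_left e3 (by positivity)).trans ?_
  rw [div_mul_eq_mul_div, one_mul, div_le_iff₀ (by positivity)]
  nlinarith [mul_nonneg hN (by nlinarith : 0 ≤ s * (s - 1))]

theorem stepNum_mem_suppAlg {A : Fin r → Fin r → Prop} {i : Fin r} {H H' : AddSubmonoid (Fin r → ℤ)}
    (h : ∀ l ∈ H, latRefl A i l ∈ H') (hi : Pi.single i 1 ∈ H') {n : Laur r} (hn : n ∈ suppAlg H) :
    stepNum A q i n ∈ suppAlg H' := by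
  have h1 := mono_mem_suppAlg hi (1 : ℂ)
  have h0 : ∀ c : ℂ, mono 0 c ∈ suppAlg H' := fun c => mono_mem_suppAlg H'.zero_mem c
  have hr := refl_mem_suppAlg h hn
  have hre := refl_mem_suppAlg h (eps_mem_suppAlg (A := A) (i := i) hn)
  exact mul_mem h1 (Subalgebra.smul_mem _ (mul_mem (add_mem (h0 _) h1) (add_mem
    (mul_mem (h0 _) (mul_mem (add_mem (one_mem _) h1) hr))
    (mul_mem (h0 _) (mul_mem (sub_mem h1 (one_mem _)) hre)))) _)

theorem coeff_zero_stepNum {A : Fin r → Fin r → Prop} {i : Fin r} {H : AddSubmonoid (Fin r → ℤ)}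
    (h : ∀ l ∈ H, latRefl A i l ∈ posCone r) {n : Laur r} (hn : n ∈ suppAlg H) :
    (stepNum A q i n).coeff 0 = 0 := by
  have hi : Pi.single i 1 ∈ posCone r := by
    rw [mem_posCone]; exact Pi.single_nonneg.2 zero_le_one
  have h1 := mono_mem_suppAlg hi (1 : ℂ)
  have h0 : ∀ c : ℂ, mono 0 c ∈ suppAlg (posCone r) :=
    fun c => mono_mem_suppAlg (posCone r).zero_mem c
  have hr := refl_mem_suppAlg h hn
  have hre := refl_mem_suppAlg h (eps_mem_suppAlg (A := A) (i := i) hn)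
  exact coeff_zero_mono_mul (Subalgebra.smul_mem _ (mul_mem (add_mem (h0 _) h1) (add_mem
    (mul_mem (h0 _) (mul_mem (add_mem (one_mem _) h1) hr))
    (mul_mem (h0 _) (mul_mem (sub_mem h1 (one_mem _)) hre)))) _)

variable (b e) in
/-- The cone spanned by the roots in `Ψ`. -/
def rootCone (Ψ : Set ι) : AddSubmonoid (Fin r → ℤ) := AddSubmonoid.closure (rootVec b e '' Ψ)

theorem rootCone_le_posCone {Ψ : Set ι} (h : ∀ α ∈ Ψ, b.IsPos α) : rootCone b e Ψ ≤ posCone r := by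
  rw [rootCone, AddSubmonoid.closure_le]
  rintro _ ⟨α, hα, rfl⟩
  exact rootVec_nonneg b e (h α hα)

theorem latRefl_mem_rootCone (hsl : b.cartanMatrix.IsSimplyLaced) (i : Fin r) {Ψ : Set ι} :
    ∀ l ∈ rootCone b e Ψ, latRefl (Adj b e) i l ∈ rootCone b e (P.reflectionPerm (e i) '' Ψ) := by
  intro l hl
  induction hl using AddSubmonoid.closure_induction with
  | mem x hx =>
    obtain ⟨α, hα, rfl⟩ := hx
    rw [← rootVec_reflectionPerm hsl]
    exact AddSubmonoid.subset_closure ⟨_, ⟨α, hα, rfl⟩, rfl⟩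
  | zero => rw [map_zero]; exact AddSubmonoid.zero_mem _
  | add x y _ _ hx hy => rw [map_add]; exact AddSubmonoid.add_mem _ hx hy

variable (b) in
/-- The set of inversions as a finite set. -/
def invFinset (w : P.weylGroup) : Finset ι := (Set.toFinite (inversions b w)).toFinset

theorem mem_invFinset {w : P.weylGroup} {α : ι} : α ∈ invFinset b w ↔ α ∈ inversions b w := by
  simp [invFinset]

theorem invFinset_subset (w : P.weylGroup) : invFinset b w ⊆ posRoots b := fun _ h =>
  mem_posRoots.2 (mem_invFinset.1 h).1

theorem len_eq (w : P.weylGroup) : len b w = (invFinset b w).card :=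
  Set.ncard_eq_toFinset_card _ _

theorem end_mul_apply {M : Type*} [AddMonoid M] (f g : AddMonoid.End M) (x : M) :
    (f * g) x = f (g x) := rfl

theorem rootProd_insert {c : ℂ} [DecidableEq ι] {α : ι} {Ψ : Finset ι} (h : α ∉ Ψ) :
    rootProd b e c (insert α Ψ) = (1 - mono (2 • rootVec b e α) c) * rootProd b e c Ψ :=
  Finset.prod_insert h

/-- The induction step for the numerators. `σ_i` carries the denominators of `g` to those of the
roots `s_i Ψ`, the pole of the slash coefficients adds the factor of `α_i`, and `Δ / σ_i Δ = -z_i²`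
restores the factor `Δ`. -/
theorem numerator_step (hsl : b.cartanMatrix.IsSimplyLaced) (i : Fin r) {Ψ Ψ' : Finset ι}
    [DecidableEq ι] (hΨ : ∀ α ∈ Ψ, b.IsPos α) (hi : (e i : ι) ∉ Ψ.image (P.reflectionPerm (e i)))
    {g : RatFunc r} {n : Laur r}
    (hn : Delta b e q * g * toRat hq (rootProd b e (q : ℂ)⁻¹ Ψ) = toRat hq n)
    (hΨ' : Ψ' = insert (e i : ι) (Ψ.image (P.reflectionPerm (e i)))) :
    Delta b e q * slashEnd hq (adj_irrefl (b := b) (e := e)) i g *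
      toRat hq (rootProd b e (q : ℂ)⁻¹ Ψ') = toRat hq (stepNum (Adj b e) q i n) := by
  have hz := zvar_ne_zero hq i
  have hΔ := Delta_ne_zero (b := b) (e := e) hq
  have hD0 : toRat hq (rootProd b e (q : ℂ)⁻¹ Ψ) ≠ 0 := by
    rw [map_ne_zero_iff _ (toRat_injective hq)]
    exact rootProd_ne_zero _ hΨ
  have hX : g = toRat hq n / (Delta b e q * toRat hq (rootProd b e (q : ℂ)⁻¹ Ψ)) := by
    rw [eq_div_iff (mul_ne_zero hΔ hD0), ← hn]
    ring
  have hev : epsHom (Adj b e) hq i (Delta b e q * toRat hq (rootProd b e (q : ℂ)⁻¹ Ψ)) =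
      Delta b e q * toRat hq (rootProd b e (q : ℂ)⁻¹ Ψ) := by
    rw [map_mul, epsHom_Delta, epsHom_toRat, eps_rootProd]
  have hD1 : toRat hq (refl (Adj b e) i (rootProd b e (q : ℂ)⁻¹ Ψ)) ≠ 0 := by
    rw [map_ne_zero_iff _ (toRat_injective hq),
      map_ne_zero_iff _ (refl_injective (adj_irrefl (b := b) (e := e)) i)]
    exact rootProd_ne_zero _ hΨ
  have hS0 : sigmaHom hq (adj_irrefl (b := b) (e := e)) i (Delta b e q) ≠ 0 :=
    (map_ne_zero _).2 hΔ
  have hqi : algebraMap ℂ (RatFunc r) (q : ℂ)⁻¹ = (cq q)⁻¹ := map_inv₀ _ _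
  have hR : toRat hq (rootProd b e (q : ℂ)⁻¹ Ψ') = (1 - zvar q i ^ 2 * (cq q)⁻¹) *
      toRat hq (refl (Adj b e) i (rootProd b e (q : ℂ)⁻¹ Ψ)) := by
    rw [hΨ', rootProd_insert hi, map_mul, refl_rootProd hsl, rootVec_simple,
      map_sub, map_one, toRat_mono_smul, hqi, zvar_sq, mul_comm (cq q)⁻¹]
  rw [hR, toRat_stepNum hq (adj_irrefl (b := b) (e := e)), hX, slashEnd_div i hev, map_mul,
    sigmaHom_toRat]
  have hsig := sigmaHom_Delta (b := b) (e := e) hq hsl i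
  generalize sigmaHom hq (adj_irrefl (b := b) (e := e)) i (Delta b e q) = W at *
  generalize toRat hq (refl (Adj b e) i (rootProd b e (q : ℂ)⁻¹ Ψ)) = R at *
  generalize slashEnd hq (adj_irrefl (b := b) (e := e)) i (toRat hq n) = X at *
  generalize Delta b e q = Y at *
  generalize zvar q i = z at *
  have hY : Y = -(W * z ^ 2) := by rw [hsig, neg_neg]
  rw [hY]
  field_simp

/-- Induction on the length by `descent_induction`. Nonnegativity of the exponents alone would not
survive `latRefl`; the cone spanned by the inversions does, because `s_i` keeps the inversions of
`w` positive when `i` is not a descent of `w`. Each step costs a factor `4` in the norm and brings a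
factor `z_i`, so only `w = 1` has a constant term. -/
theorem exists_numerator (hsl : b.cartanMatrix.IsSimplyLaced)
    {U : P.weylGroup →* AddMonoid.End (RatFunc r)}
    (hU : ∀ i, U (simpleReflection b e i) = slashEnd hq (adj_irrefl (b := b) (e := e)) i)
    (w : P.weylGroup) :
    ∃ n : Laur r, Delta b e q * U w (1 / Delta b e q) *
        toRat hq (rootProd b e (q : ℂ)⁻¹ (invFinset b w)) = toRat hq n ∧
      n ∈ suppAlg (rootCone b e (inversions b w)) ∧ norm1 n ≤ 4 ^ len b w ∧
      (w = 1 → n = 1) ∧ (w ≠ 1 → n.coeff 0 = 0) := by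
  classical
  have hΔ := Delta_ne_zero (b := b) (e := e) hq
  refine descent_induction b e (p := fun w => ∃ n : Laur r, Delta b e q * U w (1 / Delta b e q) *
        toRat hq (rootProd b e (q : ℂ)⁻¹ (invFinset b w)) = toRat hq n ∧
      n ∈ suppAlg (rootCone b e (inversions b w)) ∧ norm1 n ≤ 4 ^ len b w ∧
      (w = 1 → n = 1) ∧ (w ≠ 1 → n.coeff 0 = 0)) ?_ ?_ w
  · have h0 : inversions b (1 : P.weylGroup) = ∅ := by
      ext α
      simp only [inversions, Set.mem_ofPred_eq, inv_one, map_one, Equiv.Perm.one_apply,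
        Set.mem_empty_iff_false, iff_false, not_and, RootPairing.Base.IsPos]
      omega
    have h1 : invFinset b (1 : P.weylGroup) = ∅ := by
      ext α; rw [mem_invFinset, h0]; simp
    refine ⟨1, ?_, one_mem _, ?_, fun _ => rfl, fun h => absurd rfl h⟩
    · rw [h1, rootProd, Finset.prod_empty, map_one, map_one, mul_one]
      change Delta b e q * (1 / Delta b e q) = _
      field_simp
    · rw [← mono_zero_one, norm1_mono, norm_one, len, h0, Set.ncard_empty, pow_zero]
  · rintro i w hd ⟨n, hn, hsupp, hnorm, -, -⟩
    have hinv := inversions_simpleReflection_mul b e hd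
    have hz := zvar_ne_zero hq i
    have hne : simpleReflection b e i * w ≠ 1 := by
      intro h
      have := (descent_simpleReflection_mul b e w i).2 hd
      rw [h] at this
      exact not_descent_one b e i this
    have hfin : invFinset b (simpleReflection b e i * w) =
        insert (e i : ι) ((invFinset b w).image (P.reflectionPerm (e i))) := by
      ext α
      rw [mem_invFinset, hinv, Finset.mem_insert, Finset.mem_image, Set.mem_insert_iff,
        Set.mem_image]
      simp only [mem_invFinset]
    have hnot : (e i : ι) ∉ (invFinset b w).image (P.reflectionPerm (e i)) := by
      intro h
      have hl := len_simpleReflection_mul b e hd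
      rw [len_eq, len_eq, hfin, Finset.insert_eq_self.2 h] at hl
      have := Finset.card_image_le (s := invFinset b w) (f := P.reflectionPerm (e i))
      omega
    have hpos : ∀ α ∈ P.reflectionPerm (e i) '' inversions b w, b.IsPos α := by
      intro α hα
      have : α ∈ inversions b (simpleReflection b e i * w) := by rw [hinv]; exact Or.inr hα
      exact this.1
    refine ⟨stepNum (Adj b e) q i n, ?_, ?_, ?_, fun h => absurd h hne, fun _ => ?_⟩
    · have hstep : U (simpleReflection b e i * w) (1 / Delta b e q) =
          slashEnd hq (adj_irrefl (b := b) (e := e)) i (U w (1 / Delta b e q)) := by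
        rw [U.map_mul, hU, end_mul_apply]
      rw [hstep]
      refine numerator_step hq hsl i (fun α h => mem_posRoots.1 (invFinset_subset w h)) hnot hn ?_
      exact hfin
    · rw [hinv]
      refine stepNum_mem_suppAlg (fun l hl => ?_) ?_ hsupp
      · exact (AddSubmonoid.closure_mono (Set.image_mono (Set.subset_insert _ _)))
          (latRefl_mem_rootCone hsl i l hl)
      · exact AddSubmonoid.subset_closure ⟨_, Set.mem_insert _ _, rootVec_simple b e i⟩
    · refine (norm1_stepNum_le hq _ i n).trans ?_
      rw [len_simpleReflection_mul b e hd, pow_succ']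
      linarith
    · exact coeff_zero_stepNum (fun l hl => rootCone_le_posCone hpos
        (latRefl_mem_rootCone hsl i l hl)) hsupp

theorem rootProd_mem_suppAlg (c : ℂ) {Ψ : Finset ι} (hΨ : ∀ α ∈ Ψ, b.IsPos α) :
    rootProd b e c Ψ ∈ suppAlg (posCone r) :=
  prod_mem fun α hα => sub_mem (one_mem _) (mono_mem_suppAlg (by
    rw [two_smul]
    exact add_mem (rootVec_nonneg b e (hΨ α hα)) (rootVec_nonneg b e (hΨ α hα))) _)

theorem norm1_rootProd_mul_le {c : ℂ} (hc : ‖c‖ ≤ 1) (Ψ : Finset ι) (n : Laur r) :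
    norm1 (rootProd b e c Ψ * n) ≤ 2 ^ Ψ.card * norm1 n := by
  classical
  unfold rootProd
  induction Ψ using Finset.induction_on with
  | empty => simp
  | insert α Ψ hα ih =>
    rw [Finset.prod_insert hα, Finset.card_insert_of_notMem hα, mul_assoc, pow_succ']
    refine (norm1_sub_mono_mul_le _ hc _).trans ?_
    linarith

theorem coeff_zero_mul {c d : Laur r} (hc : c ∈ suppAlg (posCone r)) (hd : d ∈ suppAlg (posCone r)) :
    (c * d).coeff 0 = c.coeff 0 * d.coeff 0 := by
  classical
  have hpos : ∀ {c : Laur r}, c ∈ suppAlg (posCone r) → ∀ x ∈ c.coeff.support, 0 ≤ x :=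
    fun hc x hx => hc x (Finsupp.mem_support_iff.1 hx)
  rw [AddMonoidAlgebra.coeff_mul, Finsupp.sum, Finset.sum_eq_single 0]
  · rw [Finsupp.sum, Finset.sum_eq_single 0]
    · simp
    · intro y _ hy; simp [hy]
    · intro h; simp [Finsupp.notMem_support_iff.1 h]
  · intro x hx hx0
    refine Finset.sum_eq_zero fun y hy => if_neg fun h => hx0 ?_
    have h1 := hpos hc x hx
    have h2 := hpos hd y hy
    ext j
    have := congrFun h j
    have h3 := h1 j
    have h4 := h2 j
    simp only [Pi.add_apply, Pi.zero_apply] at this h3 h4 ⊢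
    omega
  · intro h
    simp [Finsupp.notMem_support_iff.1 h]

theorem coeff_zero_rootProd (c : ℂ) {Ψ : Finset ι} (hΨ : ∀ α ∈ Ψ, b.IsPos α) :
    (rootProd b e c Ψ).coeff 0 = 1 := by
  classical
  induction Ψ using Finset.induction_on with
  | empty => rw [rootProd, Finset.prod_empty, ← mono_zero_one, coeff_mono, if_pos rfl]
  | insert α Ψ hα ih =>
    have hΨ' := fun β hβ => hΨ β (Finset.mem_insert_of_mem hβ)
    have hαp := hΨ α (Finset.mem_insert_self _ _)
    rw [rootProd_insert hα]
    have h6 := rootProd_mem_suppAlg (e := e) c (Ψ := {α}) (by simpa using hαp)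
    rw [rootProd, Finset.prod_singleton] at h6
    rw [coeff_zero_mul h6 (rootProd_mem_suppAlg _ hΨ')]
    rw [ih hΨ', mul_one, ← mono_zero_one, AddMonoidAlgebra.coeff_sub, Finsupp.sub_apply,
      coeff_mono, coeff_mono, if_pos rfl, if_neg, sub_zero]
    intro h0
    have h1 : rootVec b e α = 0 := (smul_eq_zero.1 h0).resolve_left two_ne_zero
    rw [RootPairing.Base.IsPos, height_eq_sum_rootVec b e, h1] at hαp
    simp at hαp

variable (P) in
/-- A bound for the numerator of `f(x; q)`, uniform in `q`. -/
def numBound : ℝ := Nat.card P.weylGroup * 8 ^ Nat.card ι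

/-- The terms of `invFunc_eq` are brought over one denominator that involves all positive roots: the
term of `w` is multiplied by the factors of the positive roots that are not inversions of `w`. The
constant term comes from `w = 1` alone. -/
theorem exists_invFunc_eq [P.IsRootSystem] (hsl : b.cartanMatrix.IsSimplyLaced) :
    ∃ n : Laur r, invFunc b e q * toRat hq (rootProd b e 1 (posRoots b) *
        rootProd b e (q : ℂ)⁻¹ (posRoots b)) = toRat hq n ∧
      n ∈ suppAlg (posCone r) ∧ norm1 n ≤ numBound P ∧ n.coeff 0 = 1 := by
  classical
  obtain ⟨U, hU⟩ := exists_slashHom (b := b) (e := e) hq hsl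
  have : Finite P.weylGroup := finite_weylGroup
  have := Fintype.ofFinite P.weylGroup
  choose n h1 h2 h3 h4 h5 using exists_numerator (b := b) (e := e) hq hsl hU
  have hqn : ‖(q : ℂ)⁻¹‖ ≤ 1 := by
    rw [norm_inv, Complex.norm_natCast]
    exact inv_le_one_of_one_le₀ (by exact_mod_cast hq)
  have hcomp : ∀ w, ∀ α ∈ posRoots b \ invFinset b w, b.IsPos α := fun w α h =>
    mem_posRoots.1 (Finset.mem_sdiff.1 h).1
  have hsplit : ∀ w, rootProd b e (q : ℂ)⁻¹ (posRoots b) =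
      rootProd b e (q : ℂ)⁻¹ (posRoots b \ invFinset b w) *
        rootProd b e (q : ℂ)⁻¹ (invFinset b w) := fun w =>
    (Finset.prod_sdiff (invFinset_subset w)).symm
  have hcone : ∀ w, n w ∈ suppAlg (posCone r) := fun w =>
    suppAlg_mono (rootCone_le_posCone fun α h => h.1) (h2 w)
  have hcard : ∀ Ψ : Finset ι, Ψ.card ≤ Nat.card ι := fun Ψ => by
    have := Fintype.ofFinite ι
    rw [Nat.card_eq_fintype_card]
    exact Finset.card_le_univ Ψ
  refine ⟨∑ w, rootProd b e (q : ℂ)⁻¹ (posRoots b \ invFinset b w) * n w, ?_, ?_, ?_, ?_⟩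
  · rw [invFunc_eq hq hU, finsum_eq_sum_of_fintype, Finset.sum_mul, map_sum]
    refine Finset.sum_congr rfl fun w _ => ?_
    rw [map_mul, ← Delta_eq hq, hsplit w, map_mul, map_mul, ← h1]
    ring
  · exact sum_mem fun w _ => mul_mem (rootProd_mem_suppAlg _ (hcomp w)) (hcone w)
  · refine (norm1_sum_le _ _).trans ?_
    -- Each supplementary factor at most doubles the norm, and the numerator of `w` contributes at
    -- most `4 ^ len`; both counts are at most `Nat.card ι`, whence `8 = 2 * 4`.
    have : ∀ w ∈ (Finset.univ : Finset P.weylGroup),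
        norm1 (rootProd b e (q : ℂ)⁻¹ (posRoots b \ invFinset b w) * n w) ≤ 8 ^ Nat.card ι := by
      intro w _
      refine (norm1_rootProd_mul_le hqn _ _).trans ?_
      have e1 : (2 : ℝ) ^ (posRoots b \ invFinset b w).card ≤ 2 ^ Nat.card ι :=
        pow_le_pow_right₀ (by norm_num) (hcard _)
      have e2 : norm1 (n w) ≤ 4 ^ Nat.card ι := by
        refine (h3 w).trans (pow_le_pow_right₀ (by norm_num) ?_)
        rw [len_eq]
        exact hcard _
      calc _ ≤ (2 : ℝ) ^ Nat.card ι * 4 ^ Nat.card ι :=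
            mul_le_mul e1 e2 (norm1_nonneg _) (by positivity)
        _ = 8 ^ Nat.card ι := by rw [← mul_pow]; norm_num
    refine (Finset.sum_le_card_nsmul _ _ _ this).trans ?_
    rw [numBound, nsmul_eq_mul, Finset.card_univ, Nat.card_eq_fintype_card (α := P.weylGroup)]
  · have hsum : ∀ (T : Finset P.weylGroup) (g : P.weylGroup → Laur r),
        (∑ w ∈ T, g w).coeff 0 = ∑ w ∈ T, (g w).coeff 0 := by
      intro T g
      rw [AddMonoidAlgebra.coeff_sum, Finsupp.finsetSum_apply]
    rw [hsum, Finset.sum_eq_single 1]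
    · rw [coeff_zero_mul (rootProd_mem_suppAlg _ (hcomp 1)) (hcone 1), h4 1 rfl]
      rw [coeff_zero_rootProd _ (hcomp 1), ← mono_zero_one, coeff_mono, if_pos rfl, mul_one]
    · intro w _ hw
      rw [coeff_zero_mul (rootProd_mem_suppAlg _ (hcomp w)) (hcone w), h5 w hw, mul_zero]
    · simp

end Numerator

/-! ### Laurent polynomials acting on functions on the lattice -/

section Lattice

variable {r : ℕ} {A : Fin r → Fin r → Prop}

/-- The translations of functions on the lattice. -/
def shiftHom (r : ℕ) : Multiplicative (Fin r → ℤ) →* Module.End ℂ ((Fin r → ℤ) → ℂ) where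
  toFun μ := LinearMap.funLeft ℂ ℂ fun l => l - μ.toAdd
  map_one' := by
    ext F l
    simp [LinearMap.funLeft_apply]
  map_mul' μ ν := by
    refine LinearMap.ext fun F => funext fun l => ?_
    change F (l - (μ * ν).toAdd) = F (l - μ.toAdd - ν.toAdd)
    rw [toAdd_mul, sub_sub]

/-- The action of Laurent polynomials on functions on the lattice by convolution. -/
def act : Laur r →ₐ[ℂ] Module.End ℂ ((Fin r → ℤ) → ℂ) := AddMonoidAlgebra.lift _ _ _ (shiftHom r)

theorem act_mono (μ : Fin r → ℤ) (a : ℂ) (F : (Fin r → ℤ) → ℂ) (l : Fin r → ℤ) :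
    act (mono μ a) F l = a * F (l - μ) := by
  unfold act
  rw [AddMonoidAlgebra.lift_single]
  rfl

theorem act_one (F : (Fin r → ℤ) → ℂ) : act (1 : Laur r) F = F := by rw [map_one]; rfl

theorem act_mul (c d : Laur r) (F : (Fin r → ℤ) → ℂ) : act (c * d) F = act c (act d F) := by
  rw [map_mul]; rfl

theorem act_comm (c d : Laur r) (F : (Fin r → ℤ) → ℂ) : act c (act d F) = act d (act c F) := by
  rw [← act_mul, mul_comm, act_mul]

theorem act_add (c d : Laur r) (F : (Fin r → ℤ) → ℂ) : act (c + d) F = act c F + act d F := by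
  rw [map_add]; rfl

theorem act_sub (c d : Laur r) (F : (Fin r → ℤ) → ℂ) : act (c - d) F = act c F - act d F := by
  rw [map_sub]; rfl

theorem act_one_sub_mono (μ : Fin r → ℤ) (a : ℂ) (F : (Fin r → ℤ) → ℂ) (l : Fin r → ℤ) :
    act (1 - mono μ a) F l = F l - a * F (l - μ) := by
  rw [act_sub, Pi.sub_apply, act_mono, act_one]

theorem laur_induction {p : Laur r → Prop} (hm : ∀ l a, p (mono l a)) (h0 : p 0)
    (hadd : ∀ c d, p c → p d → p (c + d)) (c : Laur r) : p c := by
  rw [← sum_mono c]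
  exact Finset.sum_induction _ p hadd h0 fun l _ => hm _ _

theorem act_coeff (c d : Laur r) : act c (fun l => d.coeff l) = fun l => (c * d).coeff l := by
  classical
  induction c using laur_induction with
  | hm μ a =>
    funext l
    rw [act_mono]
    induction d using laur_induction with
    | hm ν b =>
      rw [mono_mul, coeff_mono, coeff_mono, mul_ite, mul_zero]
      exact if_congr ⟨fun h => by rw [h]; abel, fun h => by rw [← h]; abel⟩ rfl rfl
    | h0 => simp
    | hadd c d hc hd =>
      rw [mul_add, AddMonoidAlgebra.coeff_add, AddMonoidAlgebra.coeff_add, Finsupp.add_apply,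
        Finsupp.add_apply, mul_add, hc, hd]
  | h0 => rw [map_zero, zero_mul]; rfl
  | hadd c d hc hd =>
    rw [act_add, hc, hd, add_mul, AddMonoidAlgebra.coeff_add]
    rfl

/-- The reflection of a function on the lattice. -/
def reflF (A : Fin r → Fin r → Prop) (i : Fin r) (F : (Fin r → ℤ) → ℂ) (l : Fin r → ℤ) : ℂ :=
  F (latRefl A i l)

/-- The sign change of a function on the lattice. -/
def epsF (A : Fin r → Fin r → Prop) (i : Fin r) (F : (Fin r → ℤ) → ℂ) (l : Fin r → ℤ) : ℂ :=
  sgn A i l * F l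

theorem act_refl (hA : ∀ i, ¬ A i i) (i : Fin r) (c : Laur r) (F : (Fin r → ℤ) → ℂ) :
    act (refl A i c) (reflF A i F) = reflF A i (act c F) := by
  induction c using laur_induction with
  | hm μ a =>
    funext l
    rw [refl_mono, act_mono, reflF, reflF, act_mono, map_sub, latRefl_latRefl hA]
  | h0 => rw [map_zero, map_zero]; rfl
  | hadd c d hc hd => rw [map_add, act_add, act_add, hc, hd]; rfl

theorem sgn_mul_sgn_sub (i : Fin r) (l μ : Fin r → ℤ) :
    sgn A i μ * sgn A i (l - μ) = sgn A i l := by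
  rw [← sgn_add, add_sub_cancel]

theorem act_eps (i : Fin r) (c : Laur r) (F : (Fin r → ℤ) → ℂ) :
    act (eps A i c) (epsF A i F) = epsF A i (act c F) := by
  induction c using laur_induction with
  | hm μ a =>
    funext l
    rw [eps_mono, act_mono, epsF, epsF, act_mono, ← sgn_mul_sgn_sub i l μ]
    ring
  | h0 => rw [map_zero, map_zero]; funext l; simp [epsF]
  | hadd c d hc hd =>
    rw [map_add, act_add, act_add, hc, hd]
    funext l
    simp only [epsF, Pi.add_apply, mul_add]

theorem refl_coeff (hA : ∀ i, ¬ A i i) (i : Fin r) (c : Laur r) :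
    (fun l => (refl A i c).coeff l) = reflF A i fun l => c.coeff l := by
  classical
  induction c using laur_induction with
  | hm μ a =>
    funext l
    rw [refl_mono, reflF, coeff_mono, coeff_mono]
    exact if_congr ⟨fun h => by rw [← h, latRefl_latRefl hA],
      fun h => by rw [h, latRefl_latRefl hA]⟩ rfl rfl
  | h0 => simp only [map_zero]; rfl
  | hadd c d hc hd =>
    rw [map_add]
    funext l
    have h1 := congrFun hc l
    have h2 := congrFun hd l
    simp only [reflF, AddMonoidAlgebra.coeff_add, Finsupp.add_apply] at *
    rw [h1, h2]

theorem eps_coeff (i : Fin r) (c : Laur r) :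
    (fun l => (eps A i c).coeff l) = epsF A i fun l => c.coeff l := by
  classical
  induction c using laur_induction with
  | hm μ a =>
    funext l
    rw [eps_mono, epsF, coeff_mono, coeff_mono]
    split_ifs with h
    · rw [h]
    · simp
  | h0 => simp only [map_zero]; funext l; simp [epsF]
  | hadd c d hc hd =>
    rw [map_add]
    funext l
    have h1 := congrFun hc l
    have h2 := congrFun hd l
    simp only [epsF, AddMonoidAlgebra.coeff_add, Finsupp.add_apply] at *
    rw [h1, h2, mul_add]

/-- A Laurent polynomial is zero in a given direction. -/
theorem coeff_eventually_zero (c : Laur r) (i : Fin r) (l : Fin r → ℤ) :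
    ∃ n : ℕ, ∀ k : ℤ, n ≤ k → c.coeff (l + k • Pi.single i 1) = 0 := by
  induction c using laur_induction with
  | hm μ a =>
    classical
    refine ⟨(μ i - l i).toNat + 1, fun k hk => ?_⟩
    rw [coeff_mono, if_neg]
    intro h
    have := congrFun h i
    simp at this
    omega
  | h0 => exact ⟨0, fun k _ => rfl⟩
  | hadd c d hc hd =>
    obtain ⟨n, hn⟩ := hc
    obtain ⟨m, hm⟩ := hd
    refine ⟨n + m, fun k hk => ?_⟩
    rw [AddMonoidAlgebra.coeff_add, Finsupp.add_apply, hn k (by push_cast at hk; omega),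
      hm k (by push_cast at hk; omega), add_zero]

/-- `F` vanishes far out in the direction `i`. -/
def EvZero (i : Fin r) (F : (Fin r → ℤ) → ℂ) : Prop :=
  ∀ l : Fin r → ℤ, ∃ n : ℕ, ∀ k : ℤ, n ≤ k → F (l + k • Pi.single i 1) = 0

theorem EvZero.add {i : Fin r} {F G : (Fin r → ℤ) → ℂ} (hF : EvZero i F) (hG : EvZero i G) :
    EvZero i (F + G) := by
  intro l
  obtain ⟨n, hn⟩ := hF l
  obtain ⟨m, hm⟩ := hG l
  refine ⟨n + m, fun k hk => ?_⟩
  rw [Pi.add_apply, hn k (by push_cast at hk; omega), hm k (by push_cast at hk; omega), add_zero]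

theorem EvZero.neg {i : Fin r} {F : (Fin r → ℤ) → ℂ} (hF : EvZero i F) : EvZero i (-F) := by
  intro l
  obtain ⟨n, hn⟩ := hF l
  exact ⟨n, fun k hk => by rw [Pi.neg_apply, hn k hk, neg_zero]⟩

theorem EvZero.act {i : Fin r} {F : (Fin r → ℤ) → ℂ} (hF : EvZero i F) (c : Laur r) :
    EvZero i (act c F) := by
  induction c using laur_induction with
  | hm μ a =>
    intro l
    obtain ⟨n, hn⟩ := hF (l - μ)
    refine ⟨n, fun k hk => ?_⟩
    rw [act_mono, add_sub_right_comm, hn k hk, mul_zero]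
  | h0 => rw [map_zero]; exact fun l => ⟨0, fun k _ => rfl⟩
  | hadd c d hc hd => rw [act_add]; exact hc.add hd

/-- Multiplication by `1 - c z^{2 β}` is injective on functions supported in a half space. -/
theorem eq_zero_of_act_one_sub {β : Fin r → ℤ} {c : ℂ} {j : Fin r} (hβ : 0 < β j)
    {F : (Fin r → ℤ) → ℂ} (hF : ∀ l, l j < 0 → F l = 0) (h : act (1 - mono (2 • β) c) F = 0) :
    F = 0 := by
  have h1 : ∀ l, F l = c * F (l - 2 • β) := fun l => by
    have := congrFun h l
    rw [act_one_sub_mono] at this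
    exact sub_eq_zero.1 this
  have h2 : ∀ (n : ℕ) (l : Fin r → ℤ), l j < n → F l = 0 := by
    intro n
    induction n with
    | zero => intro l hl; exact hF l (by exact_mod_cast hl)
    | succ n ih =>
      intro l hl
      rw [h1, ih, mul_zero]
      push_cast at hl
      simp
      omega
  funext l
  exact h2 ((l j).toNat + 1) l (by push_cast; omega)

theorem act_supp {μ : Fin r → ℤ} {j : Fin r} {F : (Fin r → ℤ) → ℂ}
    (hF : ∀ l, l j < 0 → F l = 0) (hμ : 0 ≤ μ j) (c : ℂ) (l : Fin r → ℤ) (hl : l j < 0) :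
    act (1 - mono μ c) F l = 0 := by
  rw [act_one_sub_mono, hF l hl, hF _ (by simp; omega), mul_zero, sub_zero]

theorem act_apply (c : Laur r) (F : (Fin r → ℤ) → ℂ) (l : Fin r → ℤ) :
    act c F l = ∑ μ ∈ c.coeff.support, c.coeff μ * F (l - μ) := by
  conv_lhs => rw [← sum_mono c, map_sum, LinearMap.sum_apply, Finset.sum_apply]
  exact Finset.sum_congr rfl fun μ _ => act_mono _ _ _ _

theorem act_supp_of_mem {c : Laur r} (hc : c ∈ suppAlg (posCone r)) {j : Fin r}
    {F : (Fin r → ℤ) → ℂ} (hF : ∀ l, l j < 0 → F l = 0) (l : Fin r → ℤ) (hl : l j < 0) :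
    act c F l = 0 := by
  rw [act_apply]
  refine Finset.sum_eq_zero fun μ hμ => ?_
  have h1 : 0 ≤ μ j := hc μ (Finsupp.mem_support_iff.1 hμ) j
  rw [hF _ (by rw [Pi.sub_apply]; omega), mul_zero]

/-- The reflection followed by a translation in the direction `i`. -/
def transRefl (A : Fin r → Fin r → Prop) (i : Fin r) (a : ℤ) (F : (Fin r → ℤ) → ℂ) :
    (Fin r → ℤ) → ℂ := act (mono (a • Pi.single i 1) 1) (reflF A i F)

theorem transRefl_apply (i : Fin r) (a : ℤ) (F : (Fin r → ℤ) → ℂ) (l : Fin r → ℤ) :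
    transRefl A i a F l = F (latRefl A i (l - a • Pi.single i 1)) := by
  rw [transRefl, act_mono, one_mul, reflF]

theorem adjSum_smul_single (hA : ∀ i, ¬ A i i) (i : Fin r) (a : ℤ) :
    adjSum A i (a • Pi.single i 1) = 0 := by
  classical
  rw [map_zsmul, adjSum_single, if_neg (hA i), smul_zero]

theorem latRefl_smul_single (hA : ∀ i, ¬ A i i) (i : Fin r) (a : ℤ) :
    latRefl A i (a • Pi.single i 1) = (-a) • Pi.single i 1 := by
  ext j
  rw [latRefl_apply, adjSum_smul_single hA]
  split_ifs with h
  · simp [h]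
  · simp [h]

theorem transRefl_transRefl (hA : ∀ i, ¬ A i i) (i : Fin r) (a : ℤ) (F : (Fin r → ℤ) → ℂ) :
    transRefl A i a (transRefl A i a F) = F := by
  funext l
  rw [transRefl_apply, transRefl_apply, map_sub, map_sub, map_sub, latRefl_latRefl hA,
    latRefl_smul_single hA, latRefl_smul_single hA]
  congr 1
  rw [neg_neg, neg_smul]
  abel

/-- Translations commute with convolution, so only the reflection twists `c`. -/
theorem transRefl_act (hA : ∀ i, ¬ A i i) (i : Fin r) (a : ℤ) (c : Laur r) (F : (Fin r → ℤ) → ℂ) :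
    transRefl A i a (act c F) = act (refl A i c) (transRefl A i a F) := by
  rw [transRefl, ← act_refl hA, act_comm]
  rfl

theorem transRefl_sub (i : Fin r) (a : ℤ) (F G : (Fin r → ℤ) → ℂ) :
    transRefl A i a (F - G) = transRefl A i a F - transRefl A i a G := by
  funext l
  simp only [transRefl_apply, Pi.sub_apply]

theorem transRefl_coord (i : Fin r) (a : ℤ) (hA : ∀ i, ¬ A i i) (l : Fin r → ℤ) :
    latRefl A i (l - a • Pi.single i 1) i = adjSum A i l + a - l i := by
  rw [latRefl_self, map_sub, adjSum_smul_single hA]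
  simp
  ring

theorem mono_eq_C_mul (l : Fin r → ℤ) (c : ℂ) : mono l c = mono 0 c * mono l 1 := by
  rw [mono_mul, zero_add, mul_one]

theorem monoC_mul (c d : ℂ) : mono (0 : Fin r → ℤ) c * mono 0 d = mono 0 (c * d) := by
  rw [mono_mul, zero_add]

variable {q : ℕ}

/-! ### Uniqueness behind the one-variable functional equation. -/

section Uniqueness

variable {i : Fin r}

/-- A function killed by `1 - q z_i²` is multiplied by `q` after every two steps in direction `i`,
so it cannot become zero unless it is zero everywhere. -/
theorem eq_zero_of_evZero (hq : q ≠ 0) {G : (Fin r → ℤ) → ℂ} (hG : EvZero i G)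
    (h : act (1 - mono (2 • Pi.single i 1) (q : ℂ)) G = 0) : G = 0 := by
  funext l
  have h1 : ∀ l, G (l + (2 : ℤ) • Pi.single i 1) = q * G l := fun l => by
    have := congrFun h (l + (2 : ℤ) • Pi.single i 1)
    rw [act_one_sub_mono, Pi.zero_apply, sub_eq_zero] at this
    rw [this]
    congr 2
    ext j
    simp
  have h2 : ∀ n : ℕ, G (l + (2 * n : ℤ) • Pi.single i 1) = q ^ n * G l := by
    intro n
    induction n with
    | zero => simp
    | succ n ih =>
      have e : l + (2 * (n + 1 : ℕ) : ℤ) • (Pi.single i 1 : Fin r → ℤ) =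
          (l + (2 * n : ℤ) • Pi.single i 1) + (2 : ℤ) • Pi.single i 1 := by
        rw [add_assoc, ← add_smul]; push_cast; ring_nf
      rw [e, h1, ih, pow_succ']
      ring
  obtain ⟨n, hn⟩ := hG l
  have h3 := h2 n
  rw [hn _ (by omega)] at h3
  have hqn : ((q : ℂ) ^ n) ≠ 0 := pow_ne_zero _ (Nat.cast_ne_zero.2 hq)
  exact (mul_eq_zero.1 h3.symm).resolve_left hqn

theorem refl_one_sub (hA : ∀ i, ¬ A i i) (c : ℂ) :
    refl A i (1 - mono (2 • Pi.single i 1) c) = 1 - mono (-(2 • Pi.single i 1)) c := by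
  have := latRefl_smul_single hA i 2
  rw [map_sub, map_one, refl_mono]
  congr 2
  ext j
  have := congrFun this j
  simpa using this

/-- The uniqueness argument behind the functional equation in one variable. -/
theorem eq_reflF (hA : ∀ i, ¬ A i i) (hq : 2 ≤ q) {E ν : Laur r} (a : ℤ)
    {u : (Fin r → ℤ) → ℂ} (hE : refl A i E = E)
    (hEinj : ∀ F : (Fin r → ℤ) → ℂ, (∀ l, ∀ j ≠ i, l j < 0 → F l = 0) → act E F = 0 → F = 0)
    (hEsupp : E ∈ suppAlg (posCone r))
    (hu : ∀ l j, l j < 0 → u l = 0)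
    (hν : act ((1 - mono (2 • Pi.single i 1) 1) * (1 - mono (2 • Pi.single i 1) (q : ℂ)⁻¹) * E) u =
      fun l => ν.coeff l)
    (hνeq : ν * (1 - mono (2 • Pi.single i 1) (q : ℂ)) = mono (2 • Pi.single i 1) 1 *
      mono (2 • Pi.single i 1) 1 * (mono 0 (q : ℂ) - mono (2 • Pi.single i 1) 1) *
        (mono (a • Pi.single i 1) 1 * refl A i ν))
    (hpar : ∀ l, u l ≠ 0 → Even (adjSum A i l + a)) (l : Fin r → ℤ) :
    u l = u (latRefl A i (l - a • Pi.single i 1)) := by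
  have hq0 : (q : ℂ) ≠ 0 := Nat.cast_ne_zero.2 (by omega)
  -- With `X = z_i²`, `Y = X⁻¹`, `c = q` and `c' = q⁻¹`, the denominator that acts on `u` is `(1 -
  -- X)(1 - c' X) E`, where the reflection fixes `E` and exchanges `X` and `Y`.
  set X : Laur r := mono (2 • Pi.single i 1) 1 with hX
  set Y : Laur r := mono (-(2 • Pi.single i 1)) 1 with hY
  have hXY : X * Y = 1 := mono_one_mul_inv _
  set c : Laur r := mono 0 (q : ℂ) with hc
  set c' : Laur r := mono 0 (q : ℂ)⁻¹ with hc'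
  have hcc : c * c' = 1 := by rw [hc, hc', monoC_mul, mul_inv_cancel₀ hq0, mono_zero_one]
  have e1 : mono (2 • Pi.single i 1 : Fin r → ℤ) (q : ℂ)⁻¹ = c' * X := mono_eq_C_mul _ _
  have e2 : mono (2 • Pi.single i 1 : Fin r → ℤ) (q : ℂ) = c * X := mono_eq_C_mul _ _
  have r1 : refl A i (1 - X) = 1 - Y := refl_one_sub hA 1
  have r2 : refl A i (1 - c' * X) = 1 - c' * Y := by
    rw [← e1, refl_one_sub hA, mono_eq_C_mul (-(2 • Pi.single i 1))]
  rw [e1] at hν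
  rw [e2] at hνeq
  -- The claim is `v = 0`. By construction `v` is odd under `transRefl`.
  set v := u - transRefl A i a u with hv
  have hRv : transRefl A i a v = -v := by
    rw [hv, transRefl_sub, transRefl_transRefl hA, neg_sub]
  have hvl : ∀ l, v l = u l - u (latRefl A i (l - a • Pi.single i 1)) := fun l => by
    rw [hv, Pi.sub_apply, transRefl_apply]
  have p1 : X * (1 - Y) = X - 1 := by linear_combination -hXY
  have p2 : X * (1 - c' * Y) = X - c' := by linear_combination -c' * hXY
  have p3 : c - X = c * (1 - c' * X) := by linear_combination X * hcc
  have p4 : X - c' = -c' * (1 - c * X) := by linear_combination -X * hcc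
  -- The operator `(1 - c X)(1 - X)(1 - c' X) E` sends both `u` and its reflection to the
  -- coefficients of `ν (1 - c X)`; for the reflection this is the functional equation `hνeq`.
  have hkill : act (1 - c * X) (act ((1 - X) * (1 - c' * X)) (act E v)) = 0 := by
    rw [← act_mul, ← act_mul, hv, map_sub, sub_eq_zero]
    have h1 : act ((1 - c * X) * ((1 - X) * (1 - c' * X) * E)) u =
        fun l => (ν * (1 - c * X)).coeff l := by
      rw [act_mul, hν, act_coeff, mul_comm]
    have h2 : (1 - c * X) * ((1 - X) * (1 - c' * X) * E) =
        X * X * (c - X) * refl A i ((1 - X) * (1 - c' * X) * E) := by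
      rw [map_mul, map_mul, r1, r2, hE]
      have e : X * X * (c - X) * ((1 - Y) * (1 - c' * Y) * E) =
          (X * (1 - Y)) * (X * (1 - c' * Y)) * (c - X) * E := by ring
      rw [e, p1, p2, p3, p4]
      linear_combination -((1 - c * X) * (1 - X) * (1 - c' * X) * E) * hcc
    rw [mul_assoc, h1, h2, act_mul, ← transRefl_act hA, hν, transRefl, ← refl_coeff hA, act_coeff,
      act_coeff, hνeq]
  -- In direction `i` the coefficients of `ν` end, and the reflection of `u` vanishes far out
  -- because `u` vanishes at negative `i`-th coordinates. So `eq_zero_of_evZero` applies.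
  have hev : EvZero i (act ((1 - X) * (1 - c' * X)) (act E v)) := by
    have h1 : act E v = act E u - transRefl A i a (act E u) := by
      rw [hv, map_sub, transRefl_act hA, hE]
    rw [h1, map_sub, ← act_mul, hν, sub_eq_add_neg]
    refine EvZero.add (fun l => coeff_eventually_zero ν i l) (EvZero.neg (EvZero.act ?_ _))
    intro l
    refine ⟨(adjSum A i l + a - l i).toNat + 1, fun k hk => ?_⟩
    rw [transRefl_apply]
    refine act_supp_of_mem hEsupp (fun l => hu l i) _ ?_
    rw [transRefl_coord i a hA, map_add, adjSum_smul_single hA]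
    simp
    omega
  have hz := eq_zero_of_evZero (q := q) (by omega) hev (by rw [e2]; exact hkill)
  -- Reflecting yields a second annihilator of `E v`, namely `(1 - Y)(1 - c' Y)`.
  have hR := congrArg (transRefl A i a) hz
  rw [transRefl_act hA, transRefl_act hA, hE, hRv, map_mul, r1, r2, map_neg, map_neg] at hR
  have hR0 : transRefl A i a 0 = 0 := by funext l; rw [transRefl_apply]; rfl
  rw [hR0, neg_eq_zero] at hR
  -- Up to monomials both annihilators are multiples of `1 - X`, and a combination of them is `(q² -
  -- 1)(1 - X)`. The constant is invertible because `q ≥ 2`.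
  have hT : act E (act (1 - X) v) = 0 := by
    have h1 : act (c * X * X * ((1 - Y) * (1 - c' * Y))) (act E v) = 0 := by
      rw [act_mul, hR, map_zero]
    have h2 : act (c * c * ((1 - X) * (1 - c' * X))) (act E v) = 0 := by
      rw [act_mul, hz, map_zero]
    have h3 : act ((c * c - 1) * (1 - X)) (act E v) = 0 := by
      have e : (c * c - 1) * (1 - X) = c * c * ((1 - X) * (1 - c' * X)) -
          c * X * X * ((1 - Y) * (1 - c' * Y)) := by
        have e : c * X * X * ((1 - Y) * (1 - c' * Y)) =
            c * ((X * (1 - Y)) * (X * (1 - c' * Y))) := by ring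
        rw [e, p1, p2]
        linear_combination (1 - X) * (c * X + 1) * hcc
      rw [e, act_sub, h1, h2, sub_zero]
    have hne : (q : ℂ) * q - 1 ≠ 0 := by
      rw [sub_ne_zero]
      norm_cast
      nlinarith
    have h4 : mono 0 ((q : ℂ) * q - 1)⁻¹ * (c * c - 1) = 1 := by
      have : c * c - 1 = mono 0 ((q : ℂ) * q - 1) := by
        rw [hc, monoC_mul, ← mono_zero_one]
        exact (AddMonoidAlgebra.single_sub _ _ _).symm
      rw [this, monoC_mul, inv_mul_cancel₀ hne, mono_zero_one]
    have h5 : 1 - X = mono 0 ((q : ℂ) * q - 1)⁻¹ * ((c * c - 1) * (1 - X)) := by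
      rw [← mul_assoc, h4, one_mul]
    rw [act_comm, h5, act_mul, h3, map_zero]
  have hcoord : ∀ l : Fin r → ℤ, ∀ j ≠ i, latRefl A i (l - a • Pi.single i 1) j = l j := by
    intro l j hj
    rw [latRefl_of_ne (A := A) hj]
    simp [hj]
  -- In direction `i` the support of `v` need not be bounded below, but the reflection leaves the
  -- other coordinates alone. The support conditions there suffice to cancel `E`.
  have hv0 : act (1 - X) v = 0 := by
    refine hEinj _ (fun l j hj hl => act_supp (fun l hl => ?_) (by simp [hj]) 1 l hl) hT
    rw [hvl, hu l j hl, hu _ j (by rw [hcoord l j hj]; exact hl), sub_zero]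
  have hper : ∀ l, v l = v (l - 2 • Pi.single i 1) := fun l => by
    have := congrFun hv0 l
    rw [hX, act_one_sub_mono, one_mul] at this
    exact sub_eq_zero.1 this
  have hperN : ∀ (n : ℕ) (l), v l = v (l - (2 * n : ℤ) • Pi.single i 1) := by
    intro n
    induction n with
    | zero => intro l; simp
    | succ n ih =>
      intro l
      rw [ih, hper]
      congr 1
      ext j
      by_cases hj : j = i
      · subst hj; simp; ring
      · simp [hj]
  have hperZ : ∀ (n : ℤ) (l), v l = v (l + (2 * n) • Pi.single i 1) := by
    intro n l
    rcases le_total 0 n with hn | hn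
    · lift n to ℕ using hn
      rw [hperN n (l + _)]
      congr 1
      abel
    · obtain ⟨m, rfl⟩ : ∃ m : ℕ, n = -m := ⟨n.natAbs, by omega⟩
      rw [hperN m l]
      congr 1
      rw [sub_eq_add_neg, ← neg_smul, mul_neg]
  rw [← sub_eq_zero, ← hvl]
  -- The reflection moves `l` by `adjSum A i l + a - 2 * l i` in direction `i`. If this is even, `v`
  -- has equal values at the two points by periodicity and opposite values by oddness. If it is odd,
  -- `u` vanishes at both points by `hpar`.
  by_cases hp : Even (adjSum A i l + a)
  · obtain ⟨n, hn⟩ := hp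
    have h1 := congrFun hRv l
    rw [transRefl_apply, Pi.neg_apply, hperZ (n - l i) l] at h1
    have h2 : latRefl A i (l - a • Pi.single i 1) = l + (2 * (n - l i)) • Pi.single i 1 := by
      ext j
      by_cases hj : j = i
      · subst hj
        rw [transRefl_coord _ a hA]
        simp
        omega
      · rw [hcoord l j hj]
        simp [hj]
    rw [h2] at h1
    have h3 := self_eq_neg.1 h1
    rw [hperZ (n - l i) l, h3]
  · rw [hvl]
    have h1 : u l = 0 := by
      by_contra h
      exact hp (hpar l h)
    have h2 : u (latRefl A i (l - a • Pi.single i 1)) = 0 := by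
      by_contra h
      have := hpar _ h
      rw [adjSum_latRefl_self hA, map_sub, adjSum_smul_single hA, sub_zero] at this
      exact hp this
    rw [h1, h2, sub_zero]

end Uniqueness

end Lattice

/-! ### Power series as functions on the lattice -/

section Expansion

variable {r : ℕ} {q : ℕ}

open Classical in
/-- The coefficients, in the variables `z`, of a power series in `x`, extended by zero. -/
def tilde (q : ℕ) (p : MvPowerSeries (Fin r) ℂ) (l : Fin r → ℤ) : ℂ :=
  if 0 ≤ l then (rootQ q)⁻¹ ^ (∑ j, (l j).toNat) *
    MvPowerSeries.coeff (Finsupp.equivFunOnFinite.symm fun j => (l j).toNat) p else 0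

theorem tilde_add (p p' : MvPowerSeries (Fin r) ℂ) : tilde q (p + p') = tilde q p + tilde q p' := by
  funext l
  simp only [tilde, Pi.add_apply, map_add]
  split_ifs
  · ring
  · simp

theorem act_tilde (c : MvPolynomial (Fin r) ℂ) (p : MvPowerSeries (Fin r) ℂ) :
    act (ofPoly q c) (tilde q p) = tilde q ((c : MvPowerSeries (Fin r) ℂ) * p) := by
  induction c using MvPolynomial.induction_on' with
  | monomial k a =>
    funext l
    rw [ofPoly_monomial, act_mono, MvPolynomial.coe_monomial, tilde, tilde,
      MvPowerSeries.coeff_monomial_mul]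
    by_cases h : ∀ j, (k j : ℤ) ≤ l j
    · have h1 : 0 ≤ l - fun j => (k j : ℤ) := fun j => by
        have := h j
        rw [Pi.sub_apply]
        exact sub_nonneg.2 this
      have h2 : 0 ≤ l := fun j => (Int.natCast_nonneg _).trans (h j)
      have h3 : k ≤ Finsupp.equivFunOnFinite.symm fun j => (l j).toNat := fun j => by
        have := h j
        change k j ≤ (l j).toNat
        omega
      rw [if_pos h1, if_pos h2, if_pos h3]
      have h4 : (Finsupp.equivFunOnFinite.symm fun j => ((l - fun j => (k j : ℤ)) j).toNat) =
          (Finsupp.equivFunOnFinite.symm fun j => (l j).toNat) - k := by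
        ext j
        change (l j - k j).toNat = (l j).toNat - k j
        have := h j
        omega
      have h5 : ∑ j, (l j).toNat = ∑ j, k j + ∑ j, ((l - fun j => (k j : ℤ)) j).toNat := by
        rw [← Finset.sum_add_distrib]
        refine Finset.sum_congr rfl fun j _ => ?_
        have := h j
        rw [Pi.sub_apply]
        omega
      rw [h4, h5, pow_add]
      ring
    · have h1 : ¬ 0 ≤ l - fun j => (k j : ℤ) := fun h' => h fun j => by
        have := h' j
        rw [Pi.sub_apply] at this
        exact sub_nonneg.1 this
      rw [if_neg h1, mul_zero]
      by_cases h2 : 0 ≤ l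
      · rw [if_pos h2, if_neg, mul_zero]
        intro h3
        refine h fun j => ?_
        have e1 : k j ≤ (l j).toNat := h3 j
        have e2 : 0 ≤ l j := h2 j
        omega
      · rw [if_neg h2]
  | add c d hc hd =>
    rw [map_add, act_add, hc, hd, MvPolynomial.coe_add, add_mul, tilde_add]

theorem tilde_coe (c : MvPolynomial (Fin r) ℂ) :
    tilde q (c : MvPowerSeries (Fin r) ℂ) = fun l => (ofPoly q c).coeff l := by
  classical
  have h1 : tilde q (1 : MvPowerSeries (Fin r) ℂ) = fun l => (1 : Laur r).coeff l := by
    funext l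
    rw [← mono_zero_one, coeff_mono, tilde]
    by_cases h : 0 = l
    · subst h
      have h : (Finsupp.equivFunOnFinite.symm fun j : Fin r => ((0 : Fin r → ℤ) j).toNat) = 0 := by
        ext j; rfl
      rw [if_pos rfl, if_pos le_rfl, h, MvPowerSeries.coeff_zero_one]
      simp
    · rw [if_neg h]
      split_ifs with h0
      · rw [MvPowerSeries.coeff_one, if_neg, mul_zero]
        intro h2
        apply h
        ext j
        have := DFunLike.congr_fun h2 j
        change (l j).toNat = 0 at this
        have h3 : 0 ≤ l j := h0 j
        rw [Pi.zero_apply]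
        omega
      · rfl
  have := act_tilde (q := q) c 1
  rw [h1, act_coeff, mul_one, mul_one] at this
  exact this.symm

theorem tilde_eq_zero (p : MvPowerSeries (Fin r) ℂ) (l : Fin r → ℤ) (j : Fin r) (h : l j < 0) :
    tilde q p l = 0 := by
  rw [tilde, if_neg]
  intro h0
  exact absurd (h0 j) (not_le.2 h)

theorem coeff_eq_tilde (hq : 0 < q) (p : MvPowerSeries (Fin r) ℂ) (k : Fin r → ℕ) :
    MvPowerSeries.coeff (Finsupp.equivFunOnFinite.symm k) p =
      rootQ q ^ (∑ j, k j) * tilde q p fun j => (k j : ℤ) := by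
  rw [tilde, if_pos (show (0 : Fin r → ℤ) ≤ _ from fun j => Int.natCast_nonneg _)]
  simp only [Int.toNat_natCast]
  rw [← mul_assoc, ← mul_pow, mul_inv_cancel₀ (rootQ_ne_zero hq), one_pow, one_mul]

/-- The expansion of `f` solves every presentation of `f` as a fraction. -/
theorem mul_expansion_eq {f : RatFunc r} {p : MvPowerSeries (Fin r) ℂ} (hp : IsExpansion f p)
    {n d : MvPolynomial (Fin r) ℂ} (h : f * algebraMap _ (RatFunc r) d = algebraMap _ (RatFunc r) n) :
    (d : MvPowerSeries (Fin r) ℂ) * p = n := by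
  obtain ⟨n₂, d₂, h0, rfl, h2⟩ := hp
  have hd : d₂ ≠ 0 := by rintro rfl; simp at h0
  have hd' : algebraMap _ (RatFunc r) d₂ ≠ 0 := by
    rwa [Ne, IsFractionRing.to_map_eq_zero_iff]
  have h3 : n₂ * d = n * d₂ := by
    apply IsFractionRing.injective (MvPolynomial (Fin r) ℂ) (RatFunc r)
    rw [map_mul, map_mul, ← h]
    field_simp
  have h4 : (d₂ : MvPowerSeries (Fin r) ℂ) * (d * p) = d₂ * n := by
    rw [mul_left_comm, h2, ← MvPolynomial.coe_mul, ← MvPolynomial.coe_mul, mul_comm d, h3, mul_comm]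
  have hd2 : (d₂ : MvPowerSeries (Fin r) ℂ) ≠ 0 := by
    intro h
    apply hd
    apply MvPolynomial.coe_injective
    rw [h, MvPolynomial.coe_zero]
  exact mul_left_cancel₀ hd2 h4

theorem exists_expansion {f : RatFunc r} {n d : MvPolynomial (Fin r) ℂ}
    (h0 : MvPolynomial.constantCoeff d ≠ 0)
    (h : f * algebraMap _ (RatFunc r) d = algebraMap _ (RatFunc r) n) :
    ∃ p, IsExpansion f p := by
  have hd : d ≠ 0 := by rintro rfl; simp at h0
  refine ⟨(d : MvPowerSeries (Fin r) ℂ)⁻¹ * n, n, d, h0, ?_, ?_⟩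
  · rw [eq_div_iff, h]
    rwa [Ne, IsFractionRing.to_map_eq_zero_iff]
  · rw [← mul_assoc, MvPowerSeries.mul_inv_cancel, one_mul]
    exact h0

end Expansion

/-! ### The numerator equation for the coefficients of the invariant function. -/

section Coefficients

variable {ι V V' : Type*} [Finite ι] [AddCommGroup V] [Module ℝ V] [AddCommGroup V'] [Module ℝ V']
  {P : RootPairing ι ℝ V V'} [P.IsCrystallographic] [P.IsReduced] {b : P.Base} {r : ℕ}
  {e : Fin r ≃ b.support} {q : ℕ} (hq : 0 < q)

variable (b e) in
/-- The denominator of the invariant function. -/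
def denom (q : ℕ) : Laur r :=
  rootProd b e 1 (posRoots b) * rootProd b e (q : ℂ)⁻¹ (posRoots b)

theorem denom_mem_suppAlg : denom b e q ∈ suppAlg (posCone r) :=
  mul_mem (rootProd_mem_suppAlg _ fun _ => mem_posRoots.1)
    (rootProd_mem_suppAlg _ fun _ => mem_posRoots.1)

theorem coeff_zero_denom : (denom b e q).coeff 0 = 1 := by
  rw [denom, coeff_zero_mul (rootProd_mem_suppAlg _ fun _ => mem_posRoots.1)
    (rootProd_mem_suppAlg _ fun _ => mem_posRoots.1),
    coeff_zero_rootProd _ (fun _ => mem_posRoots.1), coeff_zero_rootProd _ (fun _ => mem_posRoots.1),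
    one_mul]

theorem coeff_zero_ofPoly (c : MvPolynomial (Fin r) ℂ) :
    (ofPoly q c).coeff 0 = MvPolynomial.constantCoeff c := by
  have := congrFun (tilde_coe (q := q) c) 0
  rw [← this, tilde, if_pos le_rfl]
  have h : (Finsupp.equivFunOnFinite.symm fun j : Fin r => ((0 : Fin r → ℤ) j).toNat) = 0 := by
    ext j; rfl
  rw [h]
  simp [MvPolynomial.constantCoeff_eq]

/-- The coefficients of the invariant function, as a function on the lattice. -/
theorem exists_coeff_eq {n : Laur r}
    (hn : invFunc b e q * toRat hq (denom b e q) = toRat hq n) (hnc : n ∈ suppAlg (posCone r)) :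
    ∃ p : (Fin r → ℤ) → ℂ, act (denom b e q) p = (fun l => n.coeff l) ∧
      (∀ l j, l j < 0 → p l = 0) ∧
      ∀ k : Fin r → ℕ, coeff b e q k = rootQ q ^ (∑ j, k j) * p fun j => (k j : ℤ) := by
  obtain ⟨n', hn'⟩ := exists_ofPoly_of_nonneg hq n fun l hl => hnc l (Finsupp.mem_support_iff.1 hl)
  obtain ⟨d', hd'⟩ := exists_ofPoly_of_nonneg hq (denom b e q) fun l hl =>
    denom_mem_suppAlg l (Finsupp.mem_support_iff.1 hl)
  rw [← hn', ← hd', toRat_ofPoly, toRat_ofPoly] at hn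
  -- The denominator has constant term `1`, so the expansion exists and the definition of `coeff`
  -- takes its first branch.
  have h0 : MvPolynomial.constantCoeff d' ≠ 0 := by
    rw [← coeff_zero_ofPoly (q := q), hd', coeff_zero_denom]
    exact one_ne_zero
  have hex := exists_expansion h0 hn
  refine ⟨tilde q hex.choose, ?_, tilde_eq_zero _, fun k => ?_⟩
  · rw [← hd', act_tilde, mul_expansion_eq hex.choose_spec hn, tilde_coe, hn']
  · rw [← coeff_eq_tilde hq, coeff, dif_pos hex]

/-- The functional equation of the numerator. -/
theorem numerator_functional [P.IsRootSystem] (hsl : b.cartanMatrix.IsSimplyLaced) (i : Fin r)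
    {n : Laur r} (hn : invFunc b e q * toRat hq (denom b e q) = toRat hq n) :
    n * (1 - mono (2 • Pi.single i 1) (q : ℂ)) =
      -(mono (2 • Pi.single i 1) (q : ℂ) * stepNum (Adj b e) q i n) := by
  classical
  have hA := adj_irrefl (b := b) (e := e)
  set E : Laur r := rootProd b e 1 ((posRoots b).erase (e i)) *
    rootProd b e (q : ℂ)⁻¹ ((posRoots b).erase (e i)) with hE
  set X : Laur r := mono (2 • Pi.single i 1) 1 with hX
  set Y : Laur r := mono (-(2 • Pi.single i 1)) 1 with hY
  set c : Laur r := mono 0 (q : ℂ) with hc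
  set c' : Laur r := mono 0 (q : ℂ)⁻¹ with hc'
  have hq0 : (q : ℂ) ≠ 0 := Nat.cast_ne_zero.2 hq.ne'
  have hXY : X * Y = 1 := mono_one_mul_inv _
  have hcc : c * c' = 1 := by rw [hc, hc', monoC_mul, mul_inv_cancel₀ hq0, mono_zero_one]
  have e1 : mono (2 • Pi.single i 1 : Fin r → ℤ) (q : ℂ)⁻¹ = c' * X := mono_eq_C_mul _ _
  have e2 : mono (2 • Pi.single i 1 : Fin r → ℤ) (q : ℂ) = c * X := mono_eq_C_mul _ _
  have hd : denom b e q = (1 - X) * (1 - c' * X) * E := by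
    rw [denom, rootProd_erase i, rootProd_erase i, e1]
    ring
  have hEr : refl (Adj b e) i E = E := by
    rw [hE, map_mul, refl_rootProd_erase hsl, refl_rootProd_erase hsl]
  have hdr : refl (Adj b e) i (denom b e q) = (1 - Y) * (1 - c' * Y) * E := by
    rw [hd, map_mul, map_mul, hEr, ← e1, refl_one_sub hA, refl_one_sub hA,
      mono_eq_C_mul (-(2 • Pi.single i 1)) (q : ℂ)⁻¹]
  have hd0 : denom b e q ≠ 0 := mul_ne_zero (rootProd_ne_zero _ fun _ => mem_posRoots.1)
    (rootProd_ne_zero _ fun _ => mem_posRoots.1)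
  have hdr0 : refl (Adj b e) i (denom b e q) ≠ 0 := by
    rwa [map_ne_zero_iff _ (refl_injective hA i)]
  have hD0 : toRat hq (denom b e q) ≠ 0 := by rwa [map_ne_zero_iff _ (toRat_injective hq)]
  have hD1 : toRat hq (refl (Adj b e) i (denom b e q)) ≠ 0 := by
    rwa [map_ne_zero_iff _ (toRat_injective hq)]
  have hev : epsHom (Adj b e) hq i (toRat hq (denom b e q)) = toRat hq (denom b e q) := by
    rw [epsHom_toRat, denom, map_mul, eps_rootProd, eps_rootProd]
  have hf : invFunc b e q = toRat hq n / toRat hq (denom b e q) := by rw [← hn]; field_simp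
  -- For `f = n / d` with `d` even under `ε_i`, invariance reads `(n | σ_i) / σ_i d = n / d`.
  have h1 := slashEnd_invFunc (b := b) (e := e) hq hsl i
  rw [hf, slashEnd_div i hev, sigmaHom_toRat, div_eq_div_iff hD1 hD0] at h1
  have h2 : -X * (1 - c' * X) * n * refl (Adj b e) i (denom b e q) =
      stepNum (Adj b e) q i n * denom b e q := by
    apply toRat_injective hq
    rw [map_mul, map_mul, map_mul, map_mul, toRat_stepNum hq hA, mul_assoc _ _ (toRat hq _), ← h1,
      map_neg, hX, zvar_sq, map_sub, map_one, ← e1, toRat_mono_smul, zvar_sq, map_inv₀]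
    have : algebraMap ℂ (RatFunc r) (q : ℂ) = cq q := rfl
    rw [this]
    ring
  have hne : (1 - X) * (1 - c' * X) * E ≠ 0 := by rwa [← hd]
  rw [hdr, hd] at h2
  -- `σ_i d = (1 - Y)(1 - c' Y) E` and `-X (1 - Y) = 1 - X`, so the factor `(1 - X)(1 - c' X) E` is
  -- common to both sides.
  have h3 : n * (1 - c' * Y) = stepNum (Adj b e) q i n := by
    apply mul_right_cancel₀ hne
    rw [← h2]
    linear_combination (n * (1 - c' * Y) * (1 - c' * X) * E) * -hXY
  rw [e2, ← h3]
  linear_combination (n * c * c') * -hXY - n * hcc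

end Coefficients

/-! ### The functional equation of the coefficients -/

section Parity

variable {r : ℕ} {A : Fin r → Fin r → Prop} {q : ℕ}

theorem eps_refl (hA : ∀ i, ¬ A i i) (i : Fin r) (c : Laur r) :
    eps A i (refl A i c) = refl A i (eps A i c) := by
  induction c using laur_induction with
  | hm μ a =>
    rw [refl_mono, eps_mono, eps_mono, refl_mono]
    unfold sgn
    rw [adjSum_latRefl_self hA]
  | h0 => simp
  | hadd c d hc hd => simp only [map_add, hc, hd]

theorem eps_mono_single (hA : ∀ i, ¬ A i i) (i : Fin r) (a : ℤ) (c : ℂ) :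
    eps A i (mono (a • Pi.single i 1) c) = mono (a • Pi.single i 1) c := by
  rw [eps_mono]
  unfold sgn
  rw [adjSum_smul_single hA, zpow_zero, one_mul]

/-- The functional equations of the even and the odd part of the numerator. -/
theorem numerator_parts (hq : 0 < q) (hA : ∀ i, ¬ A i i) (i : Fin r) {n : Laur r}
    (h : n * (1 - mono (2 • Pi.single i 1) (q : ℂ)) =
      -(mono (2 • Pi.single i 1) (q : ℂ) * stepNum A q i n)) :
    (∀ ν, ν = (1 - mono (Pi.single i 1) (rootQ q)⁻¹) * (mono 0 (1 / 2) * (n + eps A i n)) →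
      ν * (1 - mono (2 • Pi.single i 1) (q : ℂ)) = mono (2 • Pi.single i 1) 1 *
      mono (2 • Pi.single i 1) 1 * (mono 0 (q : ℂ) - mono (2 • Pi.single i 1) 1) *
        (mono ((0 : ℤ) • Pi.single i 1) 1 * refl A i ν)) ∧
    (∀ ν, ν = mono 0 (1 / 2) * (n - eps A i n) →
      ν * (1 - mono (2 • Pi.single i 1) (q : ℂ)) = mono (2 • Pi.single i 1) 1 *
      mono (2 • Pi.single i 1) 1 * (mono 0 (q : ℂ) - mono (2 • Pi.single i 1) 1) *
        (mono ((-1 : ℤ) • Pi.single i 1) 1 * refl A i ν)) := by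
  have hs0 := rootQ_ne_zero hq
  have hq0 : (q : ℂ) ≠ 0 := Nat.cast_ne_zero.2 hq.ne'
  set t : Laur r := mono (Pi.single i 1) 1 with ht
  set t' : Laur r := mono ((-1 : ℤ) • Pi.single i 1) 1 with ht'
  set S : Laur r := mono 0 (rootQ q) with hS
  set S' : Laur r := mono 0 (rootQ q)⁻¹ with hS'
  set k : Laur r := mono 0 (1 / 2) with hk
  have e0 : mono ((0 : ℤ) • Pi.single i 1 : Fin r → ℤ) 1 = (1 : Laur r) := by
    rw [zero_smul, mono_zero_one]
  have htt : t * t' = 1 := by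
    rw [ht, ht', mono_mul, neg_one_smul, add_neg_cancel, mul_one, mono_zero_one]
  have hSS : S * S' = 1 := by rw [hS, hS', monoC_mul, mul_inv_cancel₀ hs0, mono_zero_one]
  have hkk : k + k = 1 := by
    rw [hk, ← mono_zero_one]
    refine (AddMonoidAlgebra.single_add _ _ _).symm.trans ?_
    norm_num
  have e1 : mono (2 • Pi.single i 1 : Fin r → ℤ) 1 = t * t := by
    rw [ht, mono_mul, two_smul, mul_one]
  have e2 : mono (0 : Fin r → ℤ) (q : ℂ) = S * S := by rw [hS, monoC_mul, rootQ_mul_self]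
  have e3 : mono (2 • Pi.single i 1 : Fin r → ℤ) (q : ℂ) = S * S * (t * t) := by
    rw [mono_eq_C_mul, e1, e2]
  have e4 : mono (Pi.single i 1 : Fin r → ℤ) (rootQ q)⁻¹ = S' * t := mono_eq_C_mul _ _
  have e5 : mono (0 : Fin r → ℤ) (rootQ q - 1) = S - 1 := by
    rw [hS, ← mono_zero_one]; exact AddMonoidAlgebra.single_sub _ _ _
  have e6 : mono (0 : Fin r → ℤ) (rootQ q + 1) = S + 1 := by
    rw [hS, ← mono_zero_one]; exact AddMonoidAlgebra.single_add _ _ _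
  have h1 : ∀ a : ℂ, refl A i (mono 0 a) = mono 0 a := fun a => by rw [refl_mono, map_zero]
  have h2 : refl A i t = t' := by
    have := latRefl_smul_single hA i 1
    rw [one_smul] at this
    rw [ht, refl_mono, this]
  have h3 : ∀ a : ℂ, eps A i (mono 0 a) = mono 0 a := fun a => by
    have := eps_mono_single hA i 0 a
    rwa [zero_smul] at this
  have h4 : eps A i t = t := by
    have := eps_mono_single hA i 1 1
    rwa [one_smul] at this
  have hneg : mono (0 : Fin r → ℤ) (-(1 / (2 * (q : ℂ)))) = -(k * (S' * S')) := by
    rw [hk, hS', monoC_mul, monoC_mul, ← mul_inv, rootQ_mul_self]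
    refine Eq.trans ?_ (AddMonoidAlgebra.single_neg _ _)
    congr 1
    field_simp
  have hsm : ∀ (a : ℂ) (x : Laur r), a • x = mono 0 a * x := fun a x => by
    rw [Algebra.smul_def]; simp
  rw [e3, stepNum, hsm, hneg, e5, e6, ← hS, ← ht] at h
  set ρ := refl A i n with hρ
  set ρ' := refl A i (eps A i n) with hρ'
  -- In terms of `t = z_i` and `S = √q`, the factor `1 / q` of `stepNum` has cancelled against `q
  -- z_i²`.
  have g : n * (1 - S * S * (t * t)) =
      k * (t * t * t) * (S + t) * ((S - 1) * ((1 + t) * ρ) + (S + 1) * ((t - 1) * ρ')) := by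
    rw [h]
    linear_combination (k * (t * t * t) * (S + t) *
      ((S - 1) * ((1 + t) * ρ) + (S + 1) * ((t - 1) * ρ'))) * (S * S' + 1) * hSS
  -- `ε_i` commutes with the reflection and interchanges `ρ` and `ρ'`.
  have g' : eps A i n * (1 - S * S * (t * t)) =
      k * (t * t * t) * (S + t) * ((S - 1) * ((1 + t) * ρ') + (S + 1) * ((t - 1) * ρ)) := by
    have := congrArg (eps A i) g
    simp only [map_mul, map_sub, map_add, map_one, h4, hS, hk, h3, hρ, hρ', eps_refl hA,
      eps_eps] at this
    exact this
  rw [e1, e2, e3, e4, e0]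
  constructor
  -- Adding `g` and `g'` gives the factor `(S + t)(S t - 1)` for the even part. Multiplication by `1
  -- - t / S` supplies the missing `S - t`, and `S t - 1` turns into the reflected factor `1 - 1 /
  -- (S t)`.
  · rintro ν rfl
    have hr : refl A i ((1 - S' * t) * (k * (n + eps A i n))) =
        (1 - S' * t') * (k * (ρ + ρ')) := by
      simp only [map_mul, map_sub, map_add, map_one, h2, hS', hk, h1, hρ, hρ']
    rw [hr]
    linear_combination (1 - S' * t) * k * (g + g') +
      k * (ρ + ρ') * ((1 - S' * t) * t ^ 3 * (S + t) * (S * t - 1)) * hkk +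
      k * (ρ + ρ') * (t ^ 3 * (S + t) * (1 - t ^ 2)) * hSS +
      k * (ρ + ρ') * (t ^ 3 * (S ^ 2 - t ^ 2) * S') * htt
  -- Subtracting gives `(S + t)(S - t) = q - z_i²` directly, so no extra factor is needed. The
  -- translation by `-1` compensates for `t³` in place of `t⁴`.
  · rintro ν rfl
    have hr : refl A i (k * (n - eps A i n)) = k * (ρ - ρ') := by
      simp only [map_mul, map_sub, hk, h1, hρ, hρ']
    rw [hr]
    linear_combination k * (g - g') + k * (ρ - ρ') * (t ^ 3 * (S + t) * (S - t)) * hkk -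
      k * (ρ - ρ') * (t ^ 3 * (S ^ 2 - t ^ 2)) * htt

end Parity

/-! ### Growth of functions on the lattice -/

section Growth

variable {r : ℕ}

/-- `F` grows at most like `C 2^{|l|}` on the positive cone. -/
def Growth (C : ℝ) (F : (Fin r → ℤ) → ℂ) : Prop :=
  ∀ l : Fin r → ℤ, 0 ≤ l → ‖F l‖ ≤ C * 2 ^ (∑ j, (l j).toNat)

/-- Induction on the coordinate sum `n` of `l`. In `F l = (F l - c F (l - β)) + c F (l - β)` the
bracket is at most `C 2^n`; the point `l - β` has smaller sum, so the other term is at most `2 C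
2^(n - 1)`. -/
theorem Growth.of_act {C : ℝ} (hC : 0 ≤ C) {β : Fin r → ℤ} (hβ : 0 ≤ β) (hβ0 : β ≠ 0) {c : ℂ}
    (hc : ‖c‖ ≤ 1) {F : (Fin r → ℤ) → ℂ} (hF : ∀ l j, l j < 0 → F l = 0)
    (h : Growth C (act (1 - mono β c) F)) : Growth (2 * C) F := by
  obtain ⟨j₀, hj₀⟩ : ∃ j, β j ≠ 0 := by
    by_contra! h
    exact hβ0 (funext h)
  have hj₁ : 0 < β j₀ := lt_of_le_of_ne (hβ j₀) (Ne.symm hj₀)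
  have key : ∀ (n : ℕ) (l : Fin r → ℤ), ∑ j, (l j).toNat = n → 0 ≤ l → ‖F l‖ ≤ 2 * C * 2 ^ n := by
    intro n
    induction n using Nat.strong_induction_on with
    | _ n ih =>
      intro l hl h0
      have h1 := h l h0
      rw [act_one_sub_mono, hl] at h1
      have h2 : ‖F (l - β)‖ ≤ C * 2 ^ n := by
        by_cases h3 : 0 ≤ l - β
        · have h4 : ∑ j, ((l - β) j).toNat < n := by
            rw [← hl]
            refine Finset.sum_lt_sum (fun j _ => ?_) ⟨j₀, Finset.mem_univ _, ?_⟩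
            · have := hβ j
              simp only [Pi.sub_apply, Pi.zero_apply] at *
              omega
            · have := h3 j₀
              simp only [Pi.sub_apply, Pi.zero_apply] at *
              omega
          refine (ih _ h4 _ rfl h3).trans ?_
          have h5 : (2 : ℝ) ^ (∑ j, ((l - β) j).toNat + 1) ≤ 2 ^ n :=
            pow_le_pow_right₀ (by norm_num) h4
          rw [pow_succ] at h5
          nlinarith
        · obtain ⟨j, hj⟩ : ∃ j, (l - β) j < 0 := by
            by_contra! h
            exact h3 h
          rw [hF _ j hj, norm_zero]
          positivity
      have h6 : ‖c * F (l - β)‖ ≤ C * 2 ^ n := by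
        rw [norm_mul]
        exact (mul_le_of_le_one_left (norm_nonneg _) hc).trans h2
      have h7 : F l = (F l - c * F (l - β)) + c * F (l - β) := by ring
      rw [h7]
      refine (norm_add_le _ _).trans ?_
      linarith
  exact fun l hl => key _ l rfl hl

theorem act_apply_zero {c : Laur r} (hc : c ∈ suppAlg (posCone r)) {F : (Fin r → ℤ) → ℂ}
    (hF : ∀ l j, l j < 0 → F l = 0) : act c F 0 = c.coeff 0 * F 0 := by
  rw [act_apply, Finset.sum_eq_single 0]
  · rw [sub_zero]
  · intro μ hμ h0
    have h1 : 0 ≤ μ := hc μ (Finsupp.mem_support_iff.1 hμ)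
    obtain ⟨j, hj⟩ : ∃ j, μ j ≠ 0 := by
      by_contra! h
      exact h0 (funext h)
    have h2 : 0 ≤ μ j := h1 j
    rw [hF _ j (by simp; omega), mul_zero]
  · intro h
    rw [Finsupp.notMem_support_iff.1 h, zero_mul]

end Growth

/-! ### Growth and symmetries of the coefficients. -/

section Coefficients

variable {ι V V' : Type*} [Finite ι] [AddCommGroup V] [Module ℝ V] [AddCommGroup V'] [Module ℝ V']
  {P : RootPairing ι ℝ V V'} [P.IsCrystallographic] [P.IsReduced] {b : P.Base} {r : ℕ}
  {e : Fin r ≃ b.support} {q : ℕ} (hq : 0 < q)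

theorem rootVec_ne_zero {α : ι} (hα : b.IsPos α) : rootVec b e α ≠ 0 := by
  intro h
  rw [RootPairing.Base.IsPos, height_eq_sum_rootVec b e, h] at hα
  simp at hα

/-- A positive root other than `αᵢ` involves another simple root. -/
theorem exists_rootVec_pos (hsl : b.cartanMatrix.IsSimplyLaced) {i : Fin r} {α : ι}
    (hα : b.IsPos α) (h : α ≠ e i) : ∃ j ≠ i, 0 < rootVec b e α j := by
  classical
  by_contra! hc
  have h0 := rootVec_nonneg b e hα
  have h1 : ∀ j ≠ i, rootVec b e α j = 0 := fun j hj => le_antisymm (hc j hj) (h0 j)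
  -- `s_i α` is positive too, but when all other coordinates vanish its `i`-th coordinate is the
  -- negative of that of `α`.
  have h2 := rootVec_nonneg b e (isPos_simpleReflection b e hα h) i
  rw [rootVec_reflectionPerm hsl, latRefl_self] at h2
  have h3 : adjSum (Adj b e) i (rootVec b e α) = 0 := by
    change (∑ j, if Adj b e i j then rootVec b e α j else 0) = 0
    refine Finset.sum_eq_zero fun j _ => ?_
    split_ifs with hj
    · exact h1 j hj.1.symm
    · rfl
  have h4 : 0 ≤ rootVec b e α i := h0 i
  rw [h3, Pi.zero_apply, zero_sub, Left.nonneg_neg_iff] at h2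
  refine rootVec_ne_zero (e := e) hα (funext fun j => ?_)
  by_cases hj : j = i
  · subst hj
    exact le_antisymm h2 h4
  · exact h1 j hj

/-- Each root of `Ψ` involves some `α_j` with `j ≠ i`, and its factor is cancelled in that
direction. No support condition in direction `i` is available in `eq_reflF`, and none is needed
here. -/
theorem rootProd_act_injective (hsl : b.cartanMatrix.IsSimplyLaced) {i : Fin r} {Ψ : Finset ι}
    (hΨ : ∀ α ∈ Ψ, b.IsPos α ∧ α ≠ e i) (c : ℂ) {F : (Fin r → ℤ) → ℂ}
    (hF : ∀ l, ∀ j ≠ i, l j < 0 → F l = 0) (h : act (rootProd b e c Ψ) F = 0) : F = 0 := by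
  classical
  induction Ψ using Finset.induction_on with
  | empty => rwa [rootProd, Finset.prod_empty, act_one] at h
  | insert α Ψ hα ih =>
    refine ih (fun β hβ => hΨ β (Finset.mem_insert_of_mem hβ)) ?_
    obtain ⟨hp, hne⟩ := hΨ α (Finset.mem_insert_self _ _)
    obtain ⟨j, hj, hpos⟩ := exists_rootVec_pos hsl hp hne
    rw [rootProd_insert hα, act_mul] at h
    exact eq_zero_of_act_one_sub hpos (act_supp_of_mem
      (rootProd_mem_suppAlg c fun β hβ => (hΨ β (Finset.mem_insert_of_mem hβ)).1)
      fun l hl => hF l j hj hl) h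

theorem Growth.of_act_rootProd {C : ℝ} (hC : 0 ≤ C) {Ψ : Finset ι} (hΨ : ∀ α ∈ Ψ, b.IsPos α)
    {c : ℂ} (hc : ‖c‖ ≤ 1) {F : (Fin r → ℤ) → ℂ} (hF : ∀ l j, l j < 0 → F l = 0)
    (h : Growth C (act (rootProd b e c Ψ) F)) : Growth (2 ^ Ψ.card * C) F := by
  classical
  induction Ψ using Finset.induction_on generalizing C with
  | empty => 
    rw [rootProd, Finset.prod_empty, act_one] at h
    rwa [Finset.card_empty, pow_zero, one_mul]
  | insert α Ψ hα ih =>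
    have hΨ' := fun β hβ => hΨ β (Finset.mem_insert_of_mem hβ)
    have hp := hΨ α (Finset.mem_insert_self _ _)
    rw [rootProd_insert hα, act_mul] at h
    have h1 := Growth.of_act hC (by
      have := rootVec_nonneg b e hp
      rw [two_smul]
      exact add_nonneg this this) (fun h0 => rootVec_ne_zero (e := e) hp
        ((smul_eq_zero.1 h0).resolve_left two_ne_zero)) hc
      (fun l j hl => act_supp_of_mem (rootProd_mem_suppAlg c hΨ') (fun l hl => hF l j hl) l hl) h
    have h2 := ih (by positivity) hΨ' h1
    rwa [Finset.card_insert_of_notMem hα, pow_succ, mul_assoc]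

variable (P) in
/-- The constant in the bound for the coefficients. -/
def growthConst : ℝ := 4 ^ Nat.card ι * numBound P

theorem numBound_nonneg : 0 ≤ numBound P := by unfold numBound; positivity

theorem growthConst_nonneg : 0 ≤ growthConst P := mul_nonneg (by positivity) numBound_nonneg

theorem norm_coeff_le_norm1 (n : Laur r) (l : Fin r → ℤ) : ‖n.coeff l‖ ≤ norm1 n := by
  by_cases h : l ∈ n.coeff.support
  · exact Finset.single_le_sum (f := fun l => ‖n.coeff l‖) (fun _ _ => norm_nonneg _) h
  · rw [Finsupp.notMem_support_iff.1 h, norm_zero]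
    exact norm1_nonneg n

theorem epsF_apply (A : Fin r → Fin r → Prop) (i : Fin r) (F : (Fin r → ℤ) → ℂ) (l : Fin r → ℤ) :
    epsF A i F l = if Even (adjSum A i l) then F l else -F l := by
  unfold epsF sgn
  split_ifs with h
  · rw [h.neg_one_zpow, one_mul]
  · rw [(Int.not_even_iff_odd.1 h).neg_one_zpow, neg_one_mul]

/-- The coefficients of the invariant function, their growth and their symmetries. -/
theorem exists_lattice_coeff [P.IsRootSystem] (hsl : b.cartanMatrix.IsSimplyLaced) (hq2 : 2 ≤ q) :
    ∃ p : (Fin r → ℤ) → ℂ, (∀ l j, l j < 0 → p l = 0) ∧ p 0 = 1 ∧ Growth (growthConst P) p ∧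
      (∀ k : Fin r → ℕ, coeff b e q k = rootQ q ^ (∑ j, k j) * p fun j => (k j : ℤ)) ∧
      ∀ i l, (Even (adjSum (Adj b e) i l) → p l - (rootQ q)⁻¹ * p (l - Pi.single i 1) =
          p (latRefl (Adj b e) i l) - (rootQ q)⁻¹ * p (latRefl (Adj b e) i l - Pi.single i 1)) ∧
        (¬ Even (adjSum (Adj b e) i l) → p l = p (latRefl (Adj b e) i (l + Pi.single i 1))) := by
  classical
  have hq : 0 < q := by omega
  have hA := adj_irrefl (b := b) (e := e)
  obtain ⟨n, hn, hnc, hn1, hn0⟩ := exists_invFunc_eq (b := b) (e := e) hq hsl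
  change invFunc b e q * toRat hq (denom b e q) = _ at hn
  obtain ⟨p, hp, hsupp, hcoeff⟩ := exists_coeff_eq hq hn hnc
  have hqn : ‖(q : ℂ)⁻¹‖ ≤ 1 := by
    rw [norm_inv, Complex.norm_natCast]
    exact inv_le_one_of_one_le₀ (by exact_mod_cast hq)
  refine ⟨p, hsupp, ?_, ?_, hcoeff, fun i l => ?_⟩
  · have := congrFun hp 0
    rwa [act_apply_zero denom_mem_suppAlg hsupp, coeff_zero_denom, one_mul, hn0] at this
  · have h1 : Growth (numBound P) (act (denom b e q) p) := by
      intro l hl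
      rw [hp]
      refine ((norm_coeff_le_norm1 n l).trans hn1).trans ?_
      exact le_mul_of_one_le_right numBound_nonneg (one_le_pow₀ (by norm_num))
    -- Removing each of the two products over the positive roots costs at most `2 ^ Nat.card ι`.
    rw [denom, act_mul] at h1
    have h2 := Growth.of_act_rootProd numBound_nonneg (fun _ => mem_posRoots.1)
      (by rw [norm_one]) (fun l j hl => act_supp_of_mem
        (rootProd_mem_suppAlg _ fun _ => mem_posRoots.1) (fun l hl => hsupp l j hl) l hl) h1
    have h3 := Growth.of_act_rootProd (mul_nonneg (by positivity) numBound_nonneg)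
      (fun _ => mem_posRoots.1) hqn hsupp h2
    intro l hl
    refine (h3 l hl).trans (mul_le_mul_of_nonneg_right ?_ (by positivity))
    have hcard : (posRoots b).card ≤ Nat.card ι := by
      have := Fintype.ofFinite ι
      rw [Nat.card_eq_fintype_card]
      exact Finset.card_le_univ _
    have h4 : (2 : ℝ) ^ (posRoots b).card ≤ 2 ^ Nat.card ι :=
      pow_le_pow_right₀ (by norm_num) hcard
    rw [growthConst, ← mul_assoc]
    refine mul_le_mul_of_nonneg_right ?_ numBound_nonneg
    calc (2 : ℝ) ^ (posRoots b).card * 2 ^ (posRoots b).card ≤ 2 ^ Nat.card ι * 2 ^ Nat.card ι :=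
          mul_le_mul h4 h4 (by positivity) (by positivity)
      _ = 4 ^ Nat.card ι := by rw [← mul_pow]; norm_num
  set E : Laur r := rootProd b e 1 ((posRoots b).erase (e i)) *
    rootProd b e (q : ℂ)⁻¹ ((posRoots b).erase (e i)) with hE
  have hd : denom b e q = (1 - mono (2 • Pi.single i 1) 1) *
      (1 - mono (2 • Pi.single i 1) (q : ℂ)⁻¹) * E := by
    rw [denom, rootProd_erase i, rootProd_erase i]
    ring
  have hEr : refl (Adj b e) i E = E := by
    rw [hE, map_mul, refl_rootProd_erase hsl, refl_rootProd_erase hsl]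
  have hΨ : ∀ α ∈ (posRoots b).erase (e i), b.IsPos α ∧ α ≠ e i := fun α hα =>
    ⟨mem_posRoots.1 (Finset.mem_of_mem_erase hα), Finset.ne_of_mem_erase hα⟩
  have hEinj : ∀ F : (Fin r → ℤ) → ℂ, (∀ l, ∀ j ≠ i, l j < 0 → F l = 0) → act E F = 0 → F = 0 := by
    intro F hF h
    rw [hE, act_mul] at h
    refine rootProd_act_injective hsl hΨ _ hF (rootProd_act_injective hsl hΨ _ (fun l j hj hl => ?_) h)
    exact act_supp_of_mem (rootProd_mem_suppAlg _ fun α hα => (hΨ α hα).1)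
      (fun l hl => hF l j hj hl) l hl
  have hEs : E ∈ suppAlg (posCone r) := mul_mem
    (rootProd_mem_suppAlg _ fun α hα => (hΨ α hα).1) (rootProd_mem_suppAlg _ fun α hα => (hΨ α hα).1)
  obtain ⟨heven, hodd⟩ := numerator_parts hq hA i (numerator_functional hq hsl i hn)
  -- The denominator is even under `ε_i`, so it relates the even and odd parts of `p` to those of
  -- `n` separately.
  have hpe : act (denom b e q) (epsF (Adj b e) i p) = fun l => (eps (Adj b e) i n).coeff l := by
    have hde : eps (Adj b e) i (denom b e q) = denom b e q := by
      rw [denom, map_mul, eps_rootProd, eps_rootProd]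
    rw [eps_coeff, ← hp, ← act_eps, hde]
  -- `σ = 1` and `σ = -1` select the even and the odd part, that is, the restriction of `p` to the
  -- `l` with even or odd sum of adjacent coordinates.
  have hpar : ∀ (σ : ℂ) (l), act (mono 0 (1 / 2)) (p + σ • epsF (Adj b e) i p) l =
      (1 / 2) * (p l + σ * if Even (adjSum (Adj b e) i l) then p l else -p l) := fun σ l => by
    rw [act_mono, sub_zero, Pi.add_apply, Pi.smul_apply, epsF_apply, smul_eq_mul]
  have hD : ∀ σ : ℂ, act (denom b e q) (act (mono 0 (1 / 2)) (p + σ • epsF (Adj b e) i p)) =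
      fun l => (mono 0 (1 / 2) * (n + σ • eps (Adj b e) i n)).coeff l := fun σ => by
    rw [act_comm, map_add, map_smul, hp, hpe, ← act_coeff]
    congr 1
  have hadj1 : adjSum (Adj b e) i (Pi.single i 1) = 0 := by
    rw [adjSum_single, if_neg (hA i)]
  constructor
  · intro hl
    -- The even part is multiplied by `1 - z_i / √q = 1 - x_i`; it is then symmetric without
    -- translation (`a = 0`).
    set u := act (1 - mono (Pi.single i 1) (rootQ q)⁻¹)
      (act (mono 0 (1 / 2)) (p + (1 : ℂ) • epsF (Adj b e) i p)) with hu
    have hul : ∀ l, u l = if Even (adjSum (Adj b e) i l) then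
        p l - (rootQ q)⁻¹ * p (l - Pi.single i 1) else 0 := fun l => by
      rw [hu, act_one_sub_mono, hpar, hpar, map_sub, hadj1, sub_zero]
      split_ifs <;> ring
    have := eq_reflF hA hq2 (i := i) (E := E) (u := u) 0 hEr hEinj hEs (fun l j hj => ?_)
      (by rw [← hd, hu, act_comm, hD, act_coeff, one_smul]) (heven _ rfl) (fun l hl => ?_) l
    · rw [hul, hul, zero_smul, sub_zero, if_pos hl, if_pos (by rwa [adjSum_latRefl_self hA])] at this
      exact this
    · rw [hul, hsupp l j hj, hsupp (l - Pi.single i 1) j]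
      · simp
      · rw [Pi.sub_apply]
        have : 0 ≤ (Pi.single i 1 : Fin r → ℤ) j :=
          (Pi.single_nonneg.2 zero_le_one : 0 ≤ (Pi.single i 1 : Fin r → ℤ)) j
        omega
    · rw [add_zero]
      by_contra h
      rw [hul, if_neg h] at hl
      exact hl rfl
  · intro hl
    -- The odd part itself is symmetric, with translation `a = -1`.
    set u := act (mono 0 (1 / 2)) (p + (-1 : ℂ) • epsF (Adj b e) i p) with hu
    have hul : ∀ l, u l = if Even (adjSum (Adj b e) i l) then 0 else p l := fun l => by
      rw [hu, hpar]
      split_ifs <;> ring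
    have := eq_reflF hA hq2 (i := i) (E := E) (u := u) (-1) hEr hEinj hEs (fun l j hj => ?_)
      (by rw [← hd, hu, hD, neg_one_smul, ← sub_eq_add_neg]) (hodd _ rfl) (fun l hl => ?_) l
    · rw [hul, hul, if_neg hl, if_neg, neg_one_smul, sub_neg_eq_add] at this
      · exact this
      · rwa [adjSum_latRefl_self hA, neg_one_smul, sub_neg_eq_add, map_add, hadj1, add_zero]
    · rw [hul, hsupp l j hj, ite_self]
    · by_contra h
      rw [hul, if_pos] at hl
      · exact hl rfl
      · by_contra h2
        apply h
        have := Int.not_even_iff_odd.1 h2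
        exact this.add_odd (by decide)

end Coefficients

/-! ### The local polynomials -/

section LocalPoly

variable {ι V V' : Type*} [Finite ι] [AddCommGroup V] [Module ℝ V] [AddCommGroup V'] [Module ℝ V']
  {P : RootPairing ι ℝ V V'} [P.IsCrystallographic] [P.IsReduced] (b : P.Base) {r : ℕ}
  (e : Fin r ≃ b.support) {q : ℕ}

open Classical in
/-- The sum of the exponents adjacent to `i`. -/
def adjDeg (i : Fin r) (k : Fin r → ℕ) : ℕ := ∑ j, if Adj b e i j then k j else 0

/-- The sum of the exponents other than the one at `i`. -/
def restDeg (i : Fin r) (k : Fin r → ℕ) : ℕ := ∑ j, Function.update k i 0 j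

variable {b e}

theorem sum_update (i : Fin r) (k : Fin r → ℕ) (l : ℕ) :
    ∑ j, Function.update k i l j = restDeg i k + l := by
  rw [restDeg, Finset.sum_update_of_mem (Finset.mem_univ i),
    Finset.sum_update_of_mem (Finset.mem_univ i)]
  omega

theorem adjDeg_le_restDeg (i : Fin r) (k : Fin r → ℕ) : adjDeg b e i k ≤ restDeg i k := by
  classical
  refine Finset.sum_le_sum fun j _ => ?_
  split_ifs with h
  · rw [Function.update_of_ne h.1.symm]
  · exact Nat.zero_le _

/-- The point with coordinates `k` outside `i` and coordinate `l` at `i`. -/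
def latPoint (i : Fin r) (k : Fin r → ℕ) (l : ℤ) : Fin r → ℤ :=
  Function.update (fun j => (k j : ℤ)) i l

theorem latPoint_natCast (i : Fin r) (k : Fin r → ℕ) (l : ℕ) :
    latPoint i k l = fun j => ((Function.update k i l j : ℕ) : ℤ) := by
  ext j
  by_cases h : j = i
  · subst h; simp [latPoint]
  · simp [latPoint, h]

theorem latPoint_sub (i : Fin r) (k : Fin r → ℕ) (l : ℤ) :
    latPoint i k l - Pi.single i 1 = latPoint i k (l - 1) := by
  ext j
  by_cases h : j = i
  · subst h; simp [latPoint]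
  · simp [latPoint, h]

theorem latPoint_add (i : Fin r) (k : Fin r → ℕ) (l : ℤ) :
    latPoint i k l + Pi.single i 1 = latPoint i k (l + 1) := by
  ext j
  by_cases h : j = i
  · subst h; simp [latPoint]
  · simp [latPoint, h]

theorem adjSum_latPoint (i : Fin r) (k : Fin r → ℕ) (l : ℤ) :
    adjSum (Adj b e) i (latPoint i k l) = adjDeg b e i k := by
  classical
  rw [adjDeg]
  push_cast
  change (∑ j, if Adj b e i j then latPoint i k l j else 0) = _
  refine Finset.sum_congr rfl fun j _ => ?_
  split_ifs with h
  · rw [latPoint, Function.update_of_ne h.1.symm]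
  · rfl

theorem latRefl_latPoint (i : Fin r) (k : Fin r → ℕ) (l : ℤ) :
    latRefl (Adj b e) i (latPoint i k l) = latPoint i k (adjDeg b e i k - l) := by
  ext j
  by_cases h : j = i
  · subst h
    rw [latRefl_self, adjSum_latPoint]
    simp [latPoint]
  · rw [latRefl_of_ne (A := Adj b e) h]
    simp [latPoint, h]

theorem norm_coeff_le [P.IsRootSystem] (hsl : b.cartanMatrix.IsSimplyLaced) (hq : 2 ≤ q)
    (k : Fin r → ℕ) : ‖coeff b e q k‖ ≤ growthConst P * (2 * Real.sqrt q) ^ (∑ j, k j) := by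
  obtain ⟨p, -, -, hg, hc, -⟩ := exists_lattice_coeff (b := b) (e := e) hsl hq
  rw [hc, norm_mul, norm_pow, norm_rootQ]
  have := hg (fun j => (k j : ℤ)) fun j => Int.natCast_nonneg _
  simp only [Int.toNat_natCast] at this
  rw [mul_pow]
  calc _ ≤ Real.sqrt q ^ (∑ j, k j) * (growthConst P * 2 ^ (∑ j, k j)) :=
        mul_le_mul_of_nonneg_left this (by positivity)
    _ = _ := by ring

theorem coeff_zero_eq_one [P.IsRootSystem] (hsl : b.cartanMatrix.IsSimplyLaced) (hq : 2 ≤ q) :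
    coeff b e q 0 = 1 := by
  obtain ⟨p, -, h0, -, hc, -⟩ := exists_lattice_coeff (b := b) (e := e) hsl hq
  rw [hc]
  simp only [Pi.zero_apply, Finset.sum_const_zero, pow_zero, one_mul, Nat.cast_zero]
  exact h0

/-- The generating function of the coefficients in the direction `i` is a polynomial, up to a
simple pole, and it has a functional equation. -/
theorem exists_localPoly [P.IsRootSystem] (hsl : b.cartanMatrix.IsSimplyLaced) (hq : 2 ≤ q)
    (i : Fin r) (k : Fin r → ℕ) :
    ∃ F : Polynomial ℂ,
      (∀ l, F.coeff l = coeff b e q (Function.update k i l) -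
        if Even (adjDeg b e i k) ∧ l ≠ 0 then coeff b e q (Function.update k i (l - 1)) else 0) ∧
      F.natDegree ≤ 2 * (adjDeg b e i k / 2) ∧
      (∀ x : ℂ, x ≠ 0 → F.eval x =
        (rootQ q * x) ^ (2 * (adjDeg b e i k / 2)) * F.eval (1 / (q * x))) := by
  obtain ⟨p, hsupp, h0, hg, hc, hsym⟩ := exists_lattice_coeff (b := b) (e := e) hsl hq
  have hs0 : rootQ q ≠ 0 := rootQ_ne_zero (by omega)
  set m := adjDeg b e i k with hm
  -- `M` is `m` or `m - 1` according to the parity of `m`; the difference is the translation in the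
  -- symmetry of the odd part.
  set M := 2 * (m / 2) with hM
  set K := restDeg i k with hK
  set g : ℤ → ℂ := fun l => p (latPoint i k l) with hgdef
  have hneg : ∀ l < 0, g l = 0 := fun l hl => hsupp _ i (by simpa [latPoint] using hl)
  have ha : ∀ l : ℕ, coeff b e q (Function.update k i l) = rootQ q ^ (K + l) * g l := fun l => by
    rw [hc, sum_update, hgdef]
    simp only [latPoint_natCast, hK]
  have hpar : Even (m : ℤ) ↔ Even m := Int.even_coe_nat m
  -- The coefficients of the polynomial up to powers of `√q`; for even `m` the difference
  -- corresponds to the factor `1 - x`.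
  set u : ℤ → ℂ := fun l => if Even m then g l - (rootQ q)⁻¹ * g (l - 1) else g l with hu
  have huneg : ∀ l < 0, u l = 0 := fun l hl => by
    simp only [hu]
    rw [hneg l hl, hneg (l - 1) (by omega)]
    simp
  have husym : ∀ l, u l = u (M - l) := fun l => by
    by_cases h : Even m
    · have h1 := (hsym i (latPoint i k l)).1 (by rw [adjSum_latPoint]; exact hpar.2 h)
      rw [latRefl_latPoint, latPoint_sub, latPoint_sub] at h1
      have h2 : (M : ℤ) = m := by
        obtain ⟨n, hn⟩ := h
        omega
      simp only [hu, if_pos h, h2]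
      exact h1
    · have h1 := (hsym i (latPoint i k l)).2 (by rw [adjSum_latPoint]; exact fun h' => h (hpar.1 h'))
      rw [latPoint_add, latRefl_latPoint] at h1
      have h2 : (M : ℤ) - l = m - (l + 1) := by
        obtain ⟨n, hn⟩ := Nat.not_even_iff_odd.1 h
        omega
      simp only [hu, if_neg h, h2]
      exact h1
  -- The symmetry carries the vanishing at negative indices to vanishing beyond `M`, so the power
  -- series is a polynomial.
  have hularge : ∀ l : ℤ, M < l → u l = 0 := fun l hl => by rw [husym, huneg _ (by omega)]
  have hcoef : ∀ l : ℕ, rootQ q ^ (K + l) * u l = coeff b e q (Function.update k i l) -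
      if Even m ∧ l ≠ 0 then coeff b e q (Function.update k i (l - 1)) else 0 := fun l => by
    simp only [hu]
    rw [ha, ha]
    by_cases h : Even m
    · rw [if_pos h]
      rcases Nat.eq_zero_or_pos l with rfl | hl
      · rw [if_neg (by simp), hneg ((0 : ℕ) - 1) (by norm_num)]
        simp
      · rw [if_pos ⟨h, hl.ne'⟩]
        obtain ⟨n, rfl⟩ : ∃ n, l = n + 1 := ⟨l - 1, by omega⟩
        rw [Nat.add_sub_cancel, show K + (n + 1) = K + n + 1 by ring, pow_succ]
        push_cast
        rw [add_sub_cancel_right]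
        field_simp
    · rw [if_neg h, if_neg (fun h' => h h'.1), sub_zero]
  set F : Polynomial ℂ := ∑ l ∈ Finset.range (M + 1),
    Polynomial.monomial l (rootQ q ^ (K + l) * u l) with hF
  have hFc : ∀ l, F.coeff l = rootQ q ^ (K + l) * u l := fun l => by
    rw [hF, Polynomial.finsetSum_coeff]
    simp only [Polynomial.coeff_monomial]
    rw [Finset.sum_ite_eq' (Finset.range (M + 1)) l]
    split_ifs with h
    · rfl
    · rw [hularge l (by rw [Finset.mem_range] at h; omega), mul_zero]
  have hev : ∀ x : ℂ, F.eval x = rootQ q ^ K * ∑ l ∈ Finset.range (M + 1), u l * (rootQ q * x) ^ l :=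
    fun x => by
      rw [hF, Polynomial.eval_finsetSum, Finset.mul_sum]
      refine Finset.sum_congr rfl fun l _ => ?_
      rw [Polynomial.eval_monomial, pow_add, mul_pow]
      ring
  refine ⟨F, fun l => by rw [hFc, hcoef], ?_, fun x hx => ?_⟩
  · refine Polynomial.natDegree_sum_le_of_forall_le _ _ fun l hl => ?_
    refine (Polynomial.natDegree_monomial_le _).trans ?_
    rw [Finset.mem_range] at hl
    omega
  · rw [hev, hev, mul_left_comm]
    congr 1
    -- The map `x ↦ 1 / (q x)` inverts `√q x`, so the functional equation is the symmetry `l ↦ M -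
    -- l` of the coefficients.
    rw [Finset.mul_sum, ← Finset.sum_range_reflect]
    refine Finset.sum_congr rfl fun l hl => ?_
    rw [Finset.mem_range] at hl
    have h1 : rootQ q * (1 / (q * x)) = (rootQ q * x)⁻¹ := by
      rw [← rootQ_mul_self]
      field_simp
    have h2 : M + 1 - 1 - l = M - l := by omega
    have h3 : (((M - l : ℕ)) : ℤ) = M - l := by omega
    have h4 : rootQ q * x ≠ 0 := mul_ne_zero hs0 hx
    rw [h1, h2, h3, ← husym, pow_sub₀ _ h4 (by omega), inv_pow]
    ring

/-- The local polynomial in the direction `i`. -/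
def localPoly [P.IsRootSystem] (hsl : b.cartanMatrix.IsSimplyLaced) (e : Fin r ≃ b.support)
    (hq : 2 ≤ q) (i : Fin r) (k : Fin r → ℕ) : Polynomial ℂ :=
  (exists_localPoly (e := e) hsl hq i k).choose

section

variable [P.IsRootSystem] (hsl : b.cartanMatrix.IsSimplyLaced) (hq : 2 ≤ q) (i : Fin r)
  (k : Fin r → ℕ)

theorem localPoly_coeff (l : ℕ) : (localPoly hsl e hq i k).coeff l =
    coeff b e q (Function.update k i l) -
      if Even (adjDeg b e i k) ∧ l ≠ 0 then coeff b e q (Function.update k i (l - 1)) else 0 :=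
  (exists_localPoly (e := e) hsl hq i k).choose_spec.1 l

theorem natDegree_localPoly : (localPoly hsl e hq i k).natDegree ≤ 2 * (adjDeg b e i k / 2) :=
  (exists_localPoly (e := e) hsl hq i k).choose_spec.2.1

theorem localPoly_eval {x : ℂ} (hx : x ≠ 0) : (localPoly hsl e hq i k).eval x =
    (rootQ q * x) ^ (2 * (adjDeg b e i k / 2)) * (localPoly hsl e hq i k).eval (1 / (q * x)) :=
  (exists_localPoly (e := e) hsl hq i k).choose_spec.2.2 x hx

theorem one_le_two_sqrt (hq : 2 ≤ q) : 1 ≤ 2 * Real.sqrt q := by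
  have : 1 ≤ Real.sqrt q := one_le_rootQ.2 (by omega)
  linarith

theorem norm_localPoly_coeff_le (l : ℕ) : ‖(localPoly hsl e hq i k).coeff l‖ ≤
    2 * growthConst P * (2 * Real.sqrt q) ^ (restDeg i k + l) := by
  have hG := growthConst_nonneg (P := P)
  have hs := one_le_two_sqrt hq
  rw [localPoly_coeff]
  have h1 := norm_coeff_le (e := e) hsl hq (Function.update k i l)
  rw [sum_update] at h1
  have h2 : ‖if Even (adjDeg b e i k) ∧ l ≠ 0 then coeff b e q (Function.update k i (l - 1)) else 0‖ ≤
      growthConst P * (2 * Real.sqrt q) ^ (restDeg i k + l) := by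
    split_ifs
    · refine (norm_coeff_le (e := e) hsl hq _).trans (mul_le_mul_of_nonneg_left ?_ hG)
      rw [sum_update]
      exact pow_le_pow_right₀ hs (by omega)
    · rw [norm_zero]
      positivity
  refine (norm_sub_le _ _).trans ?_
  linarith

/-- The degree bound is `0` and the constant coefficient is `a(0) = 1`. This is the situation at the
primes not dividing `N`. -/
theorem localPoly_eq_one (hk : restDeg i k = 0) : localPoly hsl e hq i k = 1 := by
  have h1 : adjDeg b e i k = 0 := Nat.le_zero.1 (hk ▸ adjDeg_le_restDeg i k)
  have h2 := natDegree_localPoly (e := e) hsl hq i k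
  rw [h1] at h2
  have h3 := localPoly_coeff (e := e) hsl hq i k 0
  have h4 : Function.update k i 0 = 0 := by
    rw [restDeg, Finset.sum_eq_zero_iff] at hk
    ext j
    exact hk j (Finset.mem_univ j)
  rw [h4, coeff_zero_eq_one hsl hq, if_neg (by simp), sub_zero] at h3
  rw [Polynomial.eq_C_of_natDegree_le_zero h2, h3, Polynomial.C_1]

theorem norm_localPoly_eval_le (x : ℂ) {B : ℝ} (hB : 1 ≤ B) (hx : ‖x‖ ≤ B) :
    ‖(localPoly hsl e hq i k).eval x‖ ≤ (restDeg i k + 1) *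
      (2 * growthConst P * (2 * Real.sqrt q) ^ (2 * restDeg i k)) * B ^ restDeg i k := by
  have hG := growthConst_nonneg (P := P)
  have hs := one_le_two_sqrt hq
  have hdeg : (localPoly hsl e hq i k).natDegree ≤ restDeg i k := by
    have h1 := natDegree_localPoly (e := e) hsl hq i k
    have h2 := adjDeg_le_restDeg (b := b) (e := e) i k
    omega
  rw [Polynomial.eval_eq_sum_range' (Nat.lt_succ_of_le hdeg)]
  refine (norm_sum_le _ _).trans ?_
  have : ∀ l ∈ Finset.range (restDeg i k + 1), ‖(localPoly hsl e hq i k).coeff l * x ^ l‖ ≤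
      (2 * growthConst P * (2 * Real.sqrt q) ^ (2 * restDeg i k)) * B ^ restDeg i k := by
    intro l hl
    rw [Finset.mem_range] at hl
    rw [norm_mul, norm_pow]
    refine mul_le_mul ((norm_localPoly_coeff_le hsl hq i k l).trans ?_) ?_ (by positivity)
      (by positivity)
    · exact mul_le_mul_of_nonneg_left (pow_le_pow_right₀ hs (by omega)) (by positivity)
    · exact (pow_le_pow_left₀ (norm_nonneg _) hx l).trans (pow_le_pow_right₀ hB (by omega))
  refine (Finset.sum_le_card_nsmul _ _ _ this).trans (le_of_eq ?_)
  rw [Finset.card_range, nsmul_eq_mul]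
  push_cast
  ring

open Classical in
/-- The generating function of the coefficients in the direction `i`. -/
theorem hasSum_coeff {x : ℂ} (hx : ‖x‖ < 1) :
    HasSum (fun l => coeff b e q (Function.update k i l) * x ^ l)
      ((if Even (adjDeg b e i k) then (1 - x)⁻¹ else 1) * (localPoly hsl e hq i k).eval x) := by
  set F := localPoly hsl e hq i k with hF
  have hgeo : ∀ j : ℕ, HasSum (fun l => if j ≤ l then x ^ l else 0) (x ^ j * (1 - x)⁻¹) := by
    intro j
    have h1 := (hasSum_geometric_of_norm_lt_one hx).mul_left (x ^ j)
    have h2 : Function.Injective fun l : ℕ => l + j := add_left_injective j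
    refine (h2.hasSum_iff ?_).1 ?_
    · intro l hl
      rw [if_neg]
      intro h
      exact hl ⟨l - j, by simp only; omega⟩
    · have h3 : ((fun l => if j ≤ l then x ^ l else 0) ∘ fun l : ℕ => l + j) =
          fun l => x ^ j * x ^ l := by
        funext l
        rw [Function.comp_apply, if_pos (by omega), pow_add, mul_comm]
      rw [h3]
      exact h1
  by_cases h : Even (adjDeg b e i k)
  -- In the even case the coefficients of `F` are successive differences of the wanted coefficients,
  -- which are therefore their partial sums.
  · have hsum : ∀ l, coeff b e q (Function.update k i l) = ∑ j ∈ Finset.range (l + 1), F.coeff j := by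
      intro l
      induction l with
      | zero => rw [zero_add, Finset.sum_range_one, hF, localPoly_coeff, if_neg (by simp), sub_zero]
      | succ l ih =>
        rw [Finset.sum_range_succ, ← ih, hF, localPoly_coeff, if_pos ⟨h, by omega⟩,
          Nat.add_sub_cancel]
        ring
    rw [if_pos h, Polynomial.eval_eq_sum_range, Finset.mul_sum]
    have h3 := hasSum_sum (s := Finset.range (F.natDegree + 1))
      fun j _ => (hgeo j).mul_left (F.coeff j)
    have hfun : (fun l => coeff b e q (Function.update k i l) * x ^ l) =
        fun l => ∑ j ∈ Finset.range (F.natDegree + 1), F.coeff j * if j ≤ l then x ^ l else 0 := by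
      funext l
      rw [hsum, Finset.sum_mul]
      have h4 : ∀ j, F.coeff j * x ^ l = 0 ∨ j < F.natDegree + 1 := fun j => by
        by_cases hj : j < F.natDegree + 1
        · exact Or.inr hj
        · exact Or.inl (by rw [Polynomial.coeff_eq_zero_of_natDegree_lt (by omega), zero_mul])
      simp only [mul_ite, mul_zero]
      rw [← Finset.sum_filter]
      refine (Finset.sum_subset_zero_on_sdiff ?_ ?_ ?_).symm
      · intro j hj
        rw [Finset.mem_filter, Finset.mem_range] at hj
        rw [Finset.mem_range]
        omega
      · intro j hj
        rw [Finset.mem_sdiff, Finset.mem_range, Finset.mem_filter, Finset.mem_range] at hj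
        exact (h4 j).resolve_right fun h5 => hj.2 ⟨h5, by omega⟩
      · intro j _; rfl
    have hval : ∑ j ∈ Finset.range (F.natDegree + 1), (1 - x)⁻¹ * (F.coeff j * x ^ j) =
        ∑ j ∈ Finset.range (F.natDegree + 1), F.coeff j * (x ^ j * (1 - x)⁻¹) :=
      Finset.sum_congr rfl fun j _ => by ring
    rw [hfun, hval]
    exact h3
  · rw [if_neg h, one_mul, Polynomial.eval_eq_sum_range]
    have h5 : ∀ l, coeff b e q (Function.update k i l) = F.coeff l := fun l => by
      rw [hF, localPoly_coeff, if_neg (fun h' => h h'.1), sub_zero]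
    simp only [h5]
    refine hasSum_sum_of_ne_finset_zero fun l hl => ?_
    rw [Finset.mem_range] at hl
    rw [Polynomial.coeff_eq_zero_of_natDegree_lt (by omega), zero_mul]

end

end LocalPoly

/-! ### Euler products over finitely supported exponents -/

section EulerProduct

open Filter Topology

variable {W : Type*}

open Classical in
/-- Splitting off one exponent. -/
def suppInsertEquiv {v : W} {T : Finset W} (hv : v ∉ T) :
    {x : W →₀ ℕ | x.support ⊆ insert v T} ≃ ℕ × {x : W →₀ ℕ | x.support ⊆ T} where
  toFun x := (x.1 v, ⟨x.1.erase v, by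
    have := x.2
    rw [Set.mem_ofPred_eq] at this ⊢
    rw [Finsupp.support_erase]
    intro w hw
    rw [Finset.mem_erase] at hw
    exact (Finset.mem_insert.1 (this hw.2)).resolve_left hw.1⟩)
  invFun p := ⟨p.2.1.update v p.1, by
    have := p.2.2
    rw [Set.mem_ofPred_eq] at this ⊢
    intro w hw
    rw [Finset.mem_insert]
    by_cases h : w = v
    · exact Or.inl h
    · refine Or.inr (this ?_)
      rw [Finsupp.mem_support_iff, Finsupp.update_apply, if_neg h] at hw
      exact Finsupp.mem_support_iff.2 hw⟩
  left_inv x := by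
    apply Subtype.ext
    ext w
    by_cases h : w = v
    · subst h; simp
    · simp
  right_inv p := by
    have h0 : p.2.1 v = 0 := by
      by_contra h
      exact hv (p.2.2 (Finsupp.mem_support_iff.2 h))
    refine Prod.ext ?_ (Subtype.ext ?_)
    · simp
    · ext w
      by_cases h : w = v
      · subst h; simp [h0]
      · simp [h]

/-- Induction on `T`: splitting off one exponent gives a product of two absolutely convergent
families. Absolute convergence has to be carried along for this reason. -/
theorem hasSum_prod_of_finset {R : Type*} [NormedField R] [CompleteSpace R] (h : W → ℕ → R)
    (T : Finset W) (hs : ∀ v ∈ T, Summable fun l => ‖h v l‖) :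
    (Summable fun x : {x : W →₀ ℕ | x.support ⊆ T} => ‖∏ v ∈ T, h v (x.1 v)‖) ∧
      HasSum (fun x : {x : W →₀ ℕ | x.support ⊆ T} => ∏ v ∈ T, h v (x.1 v))
        (∏ v ∈ T, ∑' l, h v l) := by
  classical
  induction T using Finset.induction_on with
  | empty =>
    have : Unique {x : W →₀ ℕ | x.support ⊆ (∅ : Finset W)} :=
      { default := ⟨0, by simp⟩
        uniq := fun x => Subtype.ext (Finsupp.support_eq_empty.1 (Finset.subset_empty.1 x.2)) }
    refine ⟨Summable.of_finite, ?_⟩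
    simp only [Finset.prod_empty]
    exact hasSum_unique _
  | insert v T hv ih =>
    obtain ⟨h1, h2⟩ := ih fun w hw => hs w (Finset.mem_insert_of_mem hw)
    have h3 := hs v (Finset.mem_insert_self _ _)
    have hfun : ∀ p : ℕ × {x : W →₀ ℕ | x.support ⊆ T},
        ∏ w ∈ insert v T, h w (((suppInsertEquiv hv).symm p).1 w) =
          h v p.1 * ∏ w ∈ T, h w (p.2.1 w) := by
      intro p
      rw [Finset.prod_insert hv]
      congr 1
      · congr 1
        change (p.2.1.update v p.1) v = _
        simp
      · refine Finset.prod_congr rfl fun w hw => ?_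
        have hwv : w ≠ v := fun h => hv (h ▸ hw)
        congr 1
        change (p.2.1.update v p.1) w = _
        simp [Finsupp.update_apply, hwv]
    have h4 : Summable fun p : ℕ × {x : W →₀ ℕ | x.support ⊆ T} =>
        ‖h v p.1 * ∏ w ∈ T, h w (p.2.1 w)‖ := 
      Summable.mul_norm (f := h v)
        (g := fun x : {x : W →₀ ℕ | x.support ⊆ T} => ∏ w ∈ T, h w (x.1 w)) h3 h1
    constructor
    · rw [← (suppInsertEquiv hv).symm.summable_iff]
      refine h4.congr fun p => ?_
      rw [Function.comp_apply, hfun]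
    · rw [← (suppInsertEquiv hv).symm.hasSum_iff, Finset.prod_insert hv]
      have hfun' : (fun x : {x : W →₀ ℕ | x.support ⊆ insert v T} =>
          ∏ w ∈ insert v T, h w (x.1 w)) ∘ (suppInsertEquiv hv).symm =
          fun p => h v p.1 * ∏ w ∈ T, h w (p.2.1 w) := funext hfun
      rw [hfun']
      exact HasSum.mul (f := h v)
        (g := fun x : {x : W →₀ ℕ | x.support ⊆ T} => ∏ w ∈ T, h w (x.1 w))
        h3.of_norm.hasSum h2 h4.of_norm

variable (h : W → ℕ → ℂ) (T₀ : Finset W)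

open Classical in
/-- The term of an Euler product, the factors in `T₀` being always included. -/
def eulerTerm (x : W →₀ ℕ) : ℂ := ∏ v ∈ T₀ ∪ x.support, h v (x v)

variable {h T₀}

theorem eulerTerm_eq (h0 : ∀ v ∉ T₀, h v 0 = 1) {x : W →₀ ℕ} {T : Finset W} (hT : T₀ ⊆ T)
    (hx : x.support ⊆ T) : eulerTerm h T₀ x = ∏ v ∈ T, h v (x v) := by
  classical
  refine Finset.prod_subset (Finset.union_subset hT hx) fun v _ hv => ?_
  rw [Finset.mem_union, not_or, Finsupp.notMem_support_iff] at hv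
  rw [hv.2, h0 v hv.1]

/-- The product over a finite `T` containing `T₀` is the sum over the exponents supported in `T`.
For the norms, this bounds all partial sums by a constant times `exp (∑ B)`; dominated convergence
along growing `T` then identifies the infinite product with the whole sum. -/
theorem exists_hasSum_hasProd (h0 : ∀ v ∉ T₀, h v 0 = 1) (hs : ∀ v, Summable fun l => ‖h v l‖)
    {B : W → ℝ} (hB0 : ∀ v, 0 ≤ B v) (hB : Summable B)
    (hb : ∀ v ∉ T₀, ∑' l, ‖h v l‖ ≤ 1 + B v) :
    ∃ a, HasSum (eulerTerm h T₀) a ∧ HasProd (fun v => ∑' l, h v l) a := by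
  classical
  have hind : ∀ T, T₀ ⊆ T →
      HasSum ({x : W →₀ ℕ | x.support ⊆ T}.indicator fun x => ‖eulerTerm h T₀ x‖)
        (∏ v ∈ T, ∑' l, ‖h v l‖) := by
    intro T hT
    rw [← hasSum_subtype_iff_indicator]
    have h1 := (hasSum_prod_of_finset (fun v l => ‖h v l‖) T fun v _ => by simpa using hs v).2
    have hfun : (fun x => ‖eulerTerm h T₀ x‖) ∘ (↑) =
        fun x : {x : W →₀ ℕ | x.support ⊆ T} => ∏ v ∈ T, ‖h v (x.1 v)‖ := by
      funext x
      rw [Function.comp_apply, eulerTerm_eq h0 hT x.2, norm_prod]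
    rw [hfun]
    exact h1
  have hpos : ∀ v, 0 ≤ ∑' l, ‖h v l‖ := fun v => tsum_nonneg fun _ => norm_nonneg _
  have hsum : Summable fun x => ‖eulerTerm h T₀ x‖ := by
    refine summable_of_sum_le (c := (∏ v ∈ T₀, ∑' l, ‖h v l‖) * Real.exp (∑' v, B v))
      (fun _ => norm_nonneg _) fun u => ?_
    set T := T₀ ∪ u.biUnion Finsupp.support with hT
    have h1 := hind T Finset.subset_union_left
    have h2 : ∑ x ∈ u, ‖eulerTerm h T₀ x‖ ≤ ∏ v ∈ T, ∑' l, ‖h v l‖ := by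
      refine le_trans (le_of_eq (Finset.sum_congr rfl fun x hx => ?_))
        (sum_le_hasSum u (fun x _ => Set.indicator_nonneg (fun _ _ => norm_nonneg _) x) h1)
      rw [Set.indicator_of_mem]
      exact (Finset.subset_biUnion_of_mem Finsupp.support hx).trans Finset.subset_union_right
    refine h2.trans ?_
    rw [← Finset.prod_sdiff (Finset.subset_union_left : T₀ ⊆ T), mul_comm]
    refine mul_le_mul_of_nonneg_left ?_ (Finset.prod_nonneg fun v _ => hpos v)
    calc ∏ v ∈ T \ T₀, ∑' l, ‖h v l‖ ≤ ∏ v ∈ T \ T₀, Real.exp (B v) := by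
          refine Finset.prod_le_prod (fun v _ => hpos v) fun v hv => ?_
          refine (hb v (Finset.mem_sdiff.1 hv).2).trans ?_
          rw [add_comm]
          exact Real.add_one_le_exp _
      _ = Real.exp (∑ v ∈ T \ T₀, B v) := (Real.exp_sum _ _).symm
      _ ≤ Real.exp (∑' v, B v) := Real.exp_le_exp.2 (hB.sum_le_tsum _ fun v _ => hB0 v)
  refine ⟨∑' x, eulerTerm h T₀ x, hsum.of_norm.hasSum, ?_⟩
  have hlim : Tendsto (fun T : Finset W => ∑' x, {x : W →₀ ℕ | x.support ⊆ T}.indicator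
      (eulerTerm h T₀) x) atTop (𝓝 (∑' x, eulerTerm h T₀ x)) := by
    refine tendsto_tsum_of_dominated_convergence hsum (fun x => ?_)
      (Eventually.of_forall fun T x => norm_indicator_le_norm_self _ _)
    refine tendsto_const_nhds.congr' ?_
    filter_upwards [eventually_ge_atTop x.support] with T hT
    rw [Set.indicator_of_mem]
    exact hT
  refine hlim.congr' ?_
  filter_upwards [eventually_ge_atTop T₀] with T hT
  refine HasSum.tsum_eq ?_
  rw [← hasSum_subtype_iff_indicator]
  have hfun : eulerTerm h T₀ ∘ (↑) =
      fun x : {x : W →₀ ℕ | x.support ⊆ T} => ∏ v ∈ T, h v (x.1 v) := by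
    funext x
    rw [Function.comp_apply, eulerTerm_eq h0 hT x.2]
  rw [hfun]
  exact (hasSum_prod_of_finset h T fun v _ => hs v).2

end EulerProduct

/-! ### Convergence of the sum over the primes -/

section Convergence

open Filter Topology

variable (K : Type*) [Field K] [NumberField K]

/-- The number of ideals of norm at most `n` is `O(n)`, so the Dirichlet series counting ideals
converges for `σ > 1`, and the primes are a subfamily of the ideals. -/
theorem summable_nrm_rpow {σ : ℝ} (hσ : 1 < σ) :
    Summable fun v : Pl K => (nrm v.asIdeal : ℝ) ^ (-σ) := by
  classical
  set f : ℕ → ℝ := fun n => Nat.card {I : Ideal (𝓞 K) // Ideal.absNorm I = n} with hf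
  have hO : (fun n : ℕ => ∑ k ∈ Finset.Icc 1 n, f k) =O[atTop] fun n => (n : ℝ) ^ (1 : ℝ) := by
    simp only [Real.rpow_one]
    refine Asymptotics.isBigO_of_div_tendsto_nhds ?_
      ((2 ^ InfinitePlace.nrRealPlaces K * (2 * Real.pi) ^ InfinitePlace.nrComplexPlaces K *
        Units.regulator K * classNumber K) / (Units.torsionOrder K * Real.sqrt |discr K|)) ?_
    · filter_upwards [eventually_gt_atTop 0] with n hn h0
      exact absurd (Nat.cast_eq_zero.1 h0) hn.ne'
    · refine ((Ideal.tendsto_norm_le_div_atTop₀ K).comp tendsto_natCast_atTop_atTop).congr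
        fun n => ?_
      simp only [Function.comp_apply, Nat.cast_le, Pi.div_apply, hf, ← Nat.cast_sum]
      congr
      -- The asymptotic formula counts nonzero ideals; the added `1` is the zero ideal, the only
      -- ideal of norm `0`.
      rw [← add_left_inj 1, ← Ideal.card_norm_le_eq_card_norm_le_add_one,
        show Finset.Icc 1 n = Finset.Ioc 0 n from Finset.Icc_succ_left_eq_Ioc _ _,
        show 1 = Nat.card {I : Ideal (𝓞 K) // Ideal.absNorm I = 0} by
          simp [Ideal.absNorm_eq_zero_iff],
        Finset.sum_Ioc_add_eq_sum_Icc (n.zero_le),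
        ← Finset.card_preimage_eq_sum_card_image_eq
          (fun k _ => Ideal.finite_setOfPred_absNorm_eq k)]
      simp [Set.coe_eq_subtype]
  have hL := LSeriesSummable_of_sum_norm_bigO_and_nonneg hO (fun n => Nat.cast_nonneg _) zero_le_one
    (s := (σ : ℂ)) (by simpa using hσ)
  have hS : Summable fun n : ℕ => f n * (n : ℝ) ^ (-σ) := by
    refine hL.norm.congr fun n => ?_
    rcases Nat.eq_zero_or_pos n with rfl | hn
    · rw [LSeries.term_zero, norm_zero, Nat.cast_zero, Real.zero_rpow (by linarith), mul_zero]
    · rw [LSeries.term_of_ne_zero hn.ne', norm_div, Complex.norm_natCast_cpow_of_pos hn,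
        Complex.ofReal_re, Complex.norm_real, Real.norm_of_nonneg (Nat.cast_nonneg _),
        Real.rpow_neg (Nat.cast_nonneg _)]
      rfl
  refine summable_of_sum_le (c := ∑' n : ℕ, f n * (n : ℝ) ^ (-σ)) (fun v => by positivity)
    fun u => ?_
  -- The primes are grouped by norm, and each group injects into the ideals of that norm.
  rw [Finset.sum_comp (fun n : ℕ => (n : ℝ) ^ (-σ)) fun v : Pl K => nrm v.asIdeal]
  refine le_trans (Finset.sum_le_sum fun n hn => ?_)
    (hS.sum_le_tsum (u.image fun v : Pl K => nrm v.asIdeal) fun n _ => by positivity)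
  rw [nsmul_eq_mul]
  refine mul_le_mul_of_nonneg_right ?_ (by positivity)
  simp only [hf]
  norm_cast
  obtain ⟨v₀, -, hv₀⟩ := Finset.mem_image.1 hn
  have : Finite {I : Ideal (𝓞 K) // Ideal.absNorm I = n} := Ideal.finite_setOfPred_absNorm_eq n
  have : Fintype {I : Ideal (𝓞 K) // Ideal.absNorm I = n} := Fintype.ofFinite _
  rw [Nat.card_eq_fintype_card, ← Finset.card_univ]
  refine Finset.card_le_card_of_injOn
    (fun v => if h : Ideal.absNorm v.asIdeal = n then ⟨v.asIdeal, h⟩ else ⟨v₀.asIdeal, hv₀⟩)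
    (fun _ _ => Finset.mem_coe.2 (Finset.mem_univ _)) ?_
  intro v hv w hw hvw
  have h1 := (Finset.mem_filter.1 (Finset.mem_coe.1 hv)).2
  have h2 := (Finset.mem_filter.1 (Finset.mem_coe.1 hw)).2
  simp only at hvw
  rw [dif_pos h1, dif_pos h2] at hvw
  exact HeightOneSpectrum.ext (congrArg Subtype.val hvw)

end Convergence

/-! ### Residue symbols away from a prime -/

section Signs

variable {K : Type*} [Field K] [NumberField K] {S : Finset (Pl K)}

theorem EvenAt.even_count {v : Pl K} {a : Kˣ} (ha : EvenAt v a) :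
    Even (FractionalIdeal.count K v
      (toPrincipalIdeal (𝓞 K) K a : FractionalIdeal (𝓞 K)⁰ K)) := by
  obtain ⟨c, hc⟩ := ha
  have h1 := valuation_eq_count v (a * (c ^ 2)⁻¹)
  rw [Units.val_mul, Units.val_inv_eq_inv_val, Units.val_pow_eq_pow_val, ← div_eq_mul_inv, hc,
    ← WithZero.exp_zero, WithZero.exp_inj] at h1
  have h2 : countHom v (toPrincipalIdeal (𝓞 K) K (a * (c ^ 2)⁻¹)) =
      Multiplicative.ofAdd 0 := congrArg Multiplicative.ofAdd (neg_eq_zero.1 h1.symm)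
  rw [map_mul, map_inv, map_pow, map_mul, map_inv, map_pow, ofAdd_zero, mul_inv_eq_one] at h2
  have h3 := congrArg Multiplicative.toAdd h2
  rw [toAdd_pow, two_nsmul] at h3
  exact ⟨_, h3⟩

theorem quadSym_sq {v : Pl K} {a : Kˣ} (ha : EvenAt v a) : quadSym a v ^ 2 = 1 := by
  unfold quadSym
  rw [if_pos ha]
  split_ifs <;> norm_num

namespace SymbolChoices

variable (D : SymbolChoices K S)

/-- At `w` the element `m_E` has the same order as `E`, so `elt w` has the order of `P_w`, which is
`1`, up to the even order of `G²`. This is what makes `χ_I` ramify at `w` when `ord_w I` is odd. -/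
theorem odd_count_elt {w : Pl K} (hw : w ∉ S) :
    Odd (FractionalIdeal.count K w
      (toPrincipalIdeal (𝓞 K) K (D.elt w) : FractionalIdeal (𝓞 K)⁰ K)) := by
  have hm₀ : ∀ i, countHom w (toPrincipalIdeal (𝓞 K) K (D.m₀ i)) = countHom w (D.E₀ i) :=
    fun i => congrArg Multiplicative.ofAdd (D.m₀_spec i w hw)
  have h1 := congrArg (countHom w) (D.dec_spec w hw).2.2
  have h2 : countHom w (toPrincipalIdeal (𝓞 K) K (D.elt w)) * countHom w (D.decG w) ^ 2 =
      Multiplicative.ofAdd 1 := by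
    have h3 : countHom w (primeFrac w) = Multiplicative.ofAdd 1 := by
      change Multiplicative.ofAdd (FractionalIdeal.count K w
        ((primeFrac w : FracIdeals K) : FractionalIdeal (𝓞 K)⁰ K)) = _
      rw [primeFrac, FractionalIdeal.coe_mk0, FractionalIdeal.count_self]
    rw [← h3, h1, elt]
    simp only [map_mul, map_prod, map_zpow, map_pow, hm₀]
  have h4 := congrArg Multiplicative.toAdd h2
  simp only [toAdd_mul, toAdd_pow, toAdd_ofAdd] at h4
  change FractionalIdeal.count K w _ + 2 • FractionalIdeal.count K w _ = 1 at h4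
  rw [two_nsmul] at h4
  exact ⟨-FractionalIdeal.count K w (D.decG w : FractionalIdeal (𝓞 K)⁰ K), by linarith⟩

theorem gen₀_eq_prod {I : Ideal (𝓞 K)} {T : Finset (Pl K)} (hT : ∀ v, ord v I ≠ 0 → v ∈ T) :
    D.gen₀ I = ∏ v ∈ T, D.elt v ^ (ord v I % 2) := by
  refine finprod_eq_prod_of_mulSupport_subset _ fun v hv => hT v fun h => hv ?_
  simp only [h, Nat.zero_mod, pow_zero]

open Classical in
/-- The product of `(P / P_w) ^ ord_P I` over the primes `P ≠ P_w`. -/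
def away (I : Ideal (𝓞 K)) (w : Pl K) : ℂ :=
  ∏ᶠ v : Pl K, if v = w then 1 else (quadSym (D.elt v) w : ℂ) ^ ord v I

variable {D}

open Classical in
theorem away_eq_prod {I : Ideal (𝓞 K)} {T : Finset (Pl K)} (hT : ∀ v, ord v I ≠ 0 → v ∈ T)
    (w : Pl K) :
    D.away I w = ∏ v ∈ T, if v = w then 1 else (quadSym (D.elt v) w : ℂ) ^ ord v I := by
  refine finprod_eq_prod_of_mulSupport_subset _ fun v hv => hT v fun h => hv ?_
  simp only [h, pow_zero, ite_self]

theorem away_sq {I : Ideal (𝓞 K)} (hI : I ≠ ⊥) (hS : ∀ v ∈ S, ord v I = 0) {w : Pl K}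
    (hw : w ∉ S) : D.away I w * D.away I w = 1 := by
  classical
  rw [away_eq_prod (T := (ord_finite hI).toFinset) (fun v hv => by simpa using hv),
    ← Finset.prod_mul_distrib]
  refine Finset.prod_eq_one fun v hv => ?_
  split_ifs with h
  · rw [one_mul]
  · have hvS : v ∉ S := fun h => ((ord_finite hI).mem_toFinset.1 hv) (hS v h)
    rw [← mul_pow, ← pow_two]
    have := quadSym_sq (D.evenAt_elt hvS hw (Ne.symm h))
    rw [← Int.cast_pow, this, Int.cast_one, one_pow]

/-- For even `ord_w I` the prime `w` drops out of the squarefree part. The symbols of the other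
primes are `±1`, so their powers depend only on the parity of the exponents. -/
theorem chi_of_even {I : Ideal (𝓞 K)} (hI : I ≠ ⊥) (hS : ∀ v ∈ S, ord v I = 0) {w : Pl K}
    (hw : w ∉ S) (h : Even (ord w I)) : (D.chi I w : ℂ) = D.away I w := by
  classical
  have hT : ∀ v, ord v I ≠ 0 → v ∈ (ord_finite hI).toFinset := fun v hv => by simpa using hv
  have hev : ∀ v ∈ (ord_finite hI).toFinset, EvenAt w (D.elt v ^ (ord v I % 2)) ∧
      (quadSym (D.elt v ^ (ord v I % 2)) w : ℂ) =
        if v = w then 1 else (quadSym (D.elt v) w : ℂ) ^ ord v I := by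
    intro v hv
    split_ifs with hvw
    · subst hvw
      rw [Nat.even_iff.1 h, pow_zero, quadSym_one, Int.cast_one]
      exact ⟨evenAt_one v, rfl⟩
    · have hvS : v ∉ S := fun h => ((ord_finite hI).mem_toFinset.1 hv) (hS v h)
      have he := D.evenAt_elt hvS hw (Ne.symm hvw)
      refine ⟨(quadSym_pow he _).1, ?_⟩
      rw [(quadSym_pow he _).2, Int.cast_pow]
      conv_rhs => rw [← Nat.mod_add_div (ord v I) 2, pow_add, pow_mul, ← Int.cast_pow _ 2,
        quadSym_sq he, Int.cast_one, one_pow, mul_one]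
  rw [away_eq_prod hT, chi, gen₀_eq_prod D hT, (quadSym_prod _ _ fun v hv => (hev v hv).1).2,
    Int.cast_prod]
  exact Finset.prod_congr rfl fun v hv => (hev v hv).2

/-- In `gen₀ I` the factor of `w` has odd order at `w` and all other factors have even order, so the
symbol is `0` by definition. -/
theorem chi_of_odd {I : Ideal (𝓞 K)} (hI : I ≠ ⊥) (hS : ∀ v ∈ S, ord v I = 0) {w : Pl K}
    (hw : w ∉ S) (h : Odd (ord w I)) : D.chi I w = 0 := by
  classical
  have hT : ∀ v, ord v I ≠ 0 → v ∈ (ord_finite hI).toFinset := fun v hv => by simpa using hv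
  rw [chi, gen₀_eq_prod D hT, ← Finset.mul_prod_erase _ _ (hT w h.pos.ne'), Nat.odd_iff.1 h,
    pow_one]
  unfold quadSym
  refine if_neg fun hev => ?_
  have h1 : EvenAt w (∏ v ∈ (ord_finite hI).toFinset.erase w, D.elt v ^ (ord v I % 2)) := by
    refine (quadSym_prod _ _ fun v hv => ?_).1
    rw [Finset.mem_erase] at hv
    have hvS : v ∉ S := fun h => ((ord_finite hI).mem_toFinset.1 hv.2) (hS v h)
    exact (quadSym_pow (D.evenAt_elt hvS hw hv.1.symm) _).1
  have h2 := hev.even_count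
  rw [map_mul, fracCount_mul] at h2
  exact Int.not_even_iff_odd.2 ((D.odd_count_elt hw).add_even h1.even_count) h2

end SymbolChoices

/-! ### Values of quadratic idèle class characters -/

namespace QuadChar

variable (ψ : QuadChar K S)

theorem atPrime_sq (v : Pl K) : ψ.atPrime v * ψ.atPrime v = 1 := by
  unfold atPrime
  rw [← Units.val_mul, ← pow_two, ψ.map_sq, Units.val_one]

theorem atIdeal_eq_prod {I : Ideal (𝓞 K)} {T : Finset (Pl K)} (hT : ∀ v, ord v I ≠ 0 → v ∈ T) :
    ψ.atIdeal I = ∏ v ∈ T, ψ.atPrime v ^ ord v I := by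
  refine finprod_eq_prod_of_mulSupport_subset _ fun v hv => hT v fun h => hv ?_
  simp only [h, pow_zero]

end QuadChar

end Signs

/-! ### Ideals prime to `S` as families of exponents -/

section Exponents

variable {K : Type*} [Field K] [NumberField K]

theorem ideal_eq_prod {I : Ideal (𝓞 K)} (hI : I ≠ ⊥) {T : Finset (Pl K)}
    (hT : ∀ v, ord v I ≠ 0 → v ∈ T) : I = ∏ v ∈ T, v.asIdeal ^ ord v I := by
  have h := Ideal.finprod_heightOneSpectrum_factorization (R := 𝓞 K) hI
  rw [finprod_eq_prod_of_mulSupport_subset (s := T)] at h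
  · conv_lhs => rw [← h]
    refine Finset.prod_congr rfl fun v _ => ?_
    rw [HeightOneSpectrum.maxPowDividing_eq_pow_multiplicity hI]
    rfl
  · intro v hv
    refine hT v fun h0 => hv ?_
    dsimp only
    rw [HeightOneSpectrum.maxPowDividing_eq_pow_multiplicity hI]
    change v.asIdeal ^ ord v I = 1
    rw [h0, pow_zero]

theorem nrm_eq_prod {I : Ideal (𝓞 K)} (hI : I ≠ ⊥) {T : Finset (Pl K)}
    (hT : ∀ v, ord v I ≠ 0 → v ∈ T) : nrm I = ∏ v ∈ T, nrm v.asIdeal ^ ord v I := by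
  conv_lhs => rw [ideal_eq_prod hI hT]
  simp only [nrm, map_prod, map_pow]

theorem two_le_nrm (v : Pl K) : 2 ≤ nrm v.asIdeal := by
  have h0 : nrm v.asIdeal ≠ 0 := fun h => v.ne_bot (Ideal.absNorm_eq_zero_iff.1 h)
  have h1 : nrm v.asIdeal ≠ 1 := fun h => v.isPrime.ne_top (Ideal.absNorm_eq_one_iff.1 h)
  omega

theorem ord_one (v : Pl K) : ord v (1 : Ideal (𝓞 K)) = 0 := by
  by_contra h
  exact v.prime.not_isUnit (isUnit_of_dvd_one ((ord_ne_zero_iff v).1 h))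

theorem ord_pow (v : Pl K) {I : Ideal (𝓞 K)} (hI : I ≠ ⊥) (n : ℕ) :
    ord v (I ^ n) = n * ord v I := by
  induction n with
  | zero => rw [pow_zero, ord_one, zero_mul]
  | succ n ih => rw [pow_succ, ord_mul v (pow_ne_zero _ hI) hI, ih, Nat.succ_mul]

theorem ord_prod (v : Pl K) {α : Type*} (T : Finset α) (I : α → Ideal (𝓞 K))
    (hI : ∀ i ∈ T, I i ≠ ⊥) : ord v (∏ i ∈ T, I i) = ∑ i ∈ T, ord v (I i) := by
  classical
  induction T using Finset.induction_on with
  | empty => exact ord_one v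
  | insert i T hi ih =>
    rw [Finset.prod_insert hi, Finset.sum_insert hi, ord_mul v (hI i (Finset.mem_insert_self _ _))
      (Finset.prod_ne_zero_iff.2 fun j hj => hI j (Finset.mem_insert_of_mem hj)),
      ih fun j hj => hI j (Finset.mem_insert_of_mem hj)]

variable (S : Finset (Pl K))

/-- An ideal prime to `S` is given by its orders at the primes outside `S`. -/
def exponentsEquiv : IntegralIdeals S ≃ ({v : Pl K // v ∉ S} →₀ ℕ) where
  toFun J := Finsupp.ofSupportFinite (fun v => ord v.1 (J : Ideal (𝓞 K)))
    ((ord_finite J.2.1).preimage Subtype.val_injective.injOn)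
  invFun x := ⟨∏ v ∈ x.support, v.1.asIdeal ^ x v,
    Finset.prod_ne_zero_iff.2 fun v _ => pow_ne_zero _ v.1.ne_bot, fun w hw h => by
      classical
      have h1 := (ord_ne_zero_iff w).2 h
      rw [ord_prod w _ _ fun v _ => pow_ne_zero _ v.1.ne_bot] at h1
      refine h1 (Finset.sum_eq_zero fun v _ => ?_)
      rw [ord_pow w v.1.ne_bot, ord_prime, if_neg, mul_zero]
      rintro rfl
      exact v.2 hw⟩
  left_inv J := by
    apply Subtype.ext
    classical
    have h := ideal_eq_prod J.2.1 (T := (ord_finite J.2.1).toFinset) fun v hv => by simpa using hv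
    conv_rhs => rw [h]
    refine Finset.prod_bij (fun v _ => v.1) (fun v hv => ?_) (fun _ _ _ _ h => Subtype.ext h)
      (fun v hv => ?_) (fun _ _ => rfl)
    · exact (Set.Finite.mem_toFinset _).2 (Finsupp.mem_support_iff.1 hv)
    · have hv' : ord v (J : Ideal (𝓞 K)) ≠ 0 := by simpa using hv
      exact ⟨⟨v, fun h => hv' (ord_of_mem J v h)⟩, Finsupp.mem_support_iff.2 hv', rfl⟩
  right_inv x := by
    classical
    ext w
    change ord w.1 (∏ v ∈ x.support, v.1.asIdeal ^ x v) = x w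
    rw [ord_prod w.1 _ _ fun v _ => pow_ne_zero _ v.1.ne_bot]
    simp only [ord_pow w.1 (HeightOneSpectrum.ne_bot _), ord_prime, mul_ite, mul_one, mul_zero,
      Subtype.coe_inj, Finset.sum_ite_eq]
    split_ifs with h
    · rfl
    · exact (Finsupp.notMem_support_iff.1 h).symm

end Exponents

/-! ### The coefficients as products over the primes -/

section Factorization

variable {K : Type*} [Field K] [NumberField K] {S : Finset (Pl K)} {D : SymbolChoices K S}

theorem SymbolChoices.away_one (w : Pl K) : D.away 1 w = 1 := by
  classical
  rw [away_eq_prod (T := ∅) fun v hv => absurd (ord_one v) hv, Finset.prod_empty]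

theorem SymbolChoices.away_mul {I J : Ideal (𝓞 K)} (hI : I ≠ ⊥) (hJ : J ≠ ⊥) (w : Pl K) :
    D.away (I * J) w = D.away I w * D.away J w := by
  classical
  have h1 : ∀ v, ord v I ≠ 0 → v ∈ (ord_finite hI).toFinset ∪ (ord_finite hJ).toFinset :=
    fun v hv => by simp [hv]
  have h2 : ∀ v, ord v J ≠ 0 → v ∈ (ord_finite hI).toFinset ∪ (ord_finite hJ).toFinset :=
    fun v hv => by simp [hv]
  rw [away_eq_prod h1, away_eq_prod h2, away_eq_prod (T := (ord_finite hI).toFinset ∪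
    (ord_finite hJ).toFinset), ← Finset.prod_mul_distrib]
  · refine Finset.prod_congr rfl fun v _ => ?_
    rw [ord_mul v hI hJ]
    split_ifs
    · rw [one_mul]
    · rw [pow_add]
  · intro v hv
    rw [ord_mul v hI hJ] at hv
    by_cases h : ord v I = 0
    · exact h2 v (by omega)
    · exact h1 v h

theorem SymbolChoices.away_prod {α : Type*} (T : Finset α) (I : α → Ideal (𝓞 K))
    (hI : ∀ i ∈ T, I i ≠ ⊥) (w : Pl K) : D.away (∏ i ∈ T, I i) w = ∏ i ∈ T, D.away (I i) w := by
  classical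
  induction T using Finset.induction_on with
  | empty => exact SymbolChoices.away_one w
  | insert i T hi ih =>
    rw [Finset.prod_insert hi, Finset.prod_insert hi, away_mul (hI i (Finset.mem_insert_self _ _))
      (Finset.prod_ne_zero_iff.2 fun j hj => hI j (Finset.mem_insert_of_mem hj)),
      ih fun j hj => hI j (Finset.mem_insert_of_mem hj)]

/-- The double product is regrouped by the prime of the second argument; `cross` and `away` leave
out the same diagonal terms. -/
theorem cross_eq_away {I J : Ideal (𝓞 K)} (hI : I ≠ ⊥) {T : Finset (Pl K)}
    (hJ : ∀ v, ord v J ≠ 0 → v ∈ T) : cross D I J = ∏ w ∈ T, D.away I w ^ ord w J := by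
  classical
  have h1 : ∀ v, ord v I ≠ 0 → v ∈ T ∪ (ord_finite hI).toFinset := fun v hv => by simp [hv]
  rw [cross_eq_prod D h1 fun v hv => Finset.mem_union_left _ (hJ v hv), Finset.prod_comm]
  refine (Finset.prod_subset Finset.subset_union_left fun w _ hw => ?_).symm.trans ?_
  · have : ord w J = 0 := by
      by_contra h
      exact hw (hJ w h)
    simp [this]
  · refine Finset.prod_congr rfl fun w _ => ?_
    rw [SymbolChoices.away_eq_prod h1, ← Finset.prod_pow]
    refine Finset.prod_congr rfl fun v _ => ?_
    rw [symbol_prime]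
    split_ifs
    · rw [one_pow]
    · rw [pow_mul]

theorem natCast_prod_cpow {α : Type*} (T : Finset α) (n k : α → ℕ) (s : ℂ) :
    ((∏ v ∈ T, n v ^ k v : ℕ) : ℂ) ^ s = ∏ v ∈ T, ((n v : ℂ) ^ s) ^ k v := by
  classical
  have hpow : ∀ m l : ℕ, ((m ^ l : ℕ) : ℂ) ^ s = ((m : ℂ) ^ s) ^ l := fun m l => by
    induction l with
    | zero => simp
    | succ l ih => rw [pow_succ, Nat.cast_mul, Complex.natCast_mul_natCast_cpow, ih, pow_succ]
  induction T using Finset.induction_on with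
  | empty => simp
  | insert i T hi ih =>
    rw [Finset.prod_insert hi, Finset.prod_insert hi, Nat.cast_mul,
      Complex.natCast_mul_natCast_cpow, ih, hpow]

variable {ι V V' : Type*} [Finite ι] [AddCommGroup V] [Module ℝ V] [AddCommGroup V'] [Module ℝ V']
  {P : RootPairing ι ℝ V V'} [P.IsCrystallographic] [P.IsReduced] (b : P.Base) {r : ℕ}
  (e : Fin r ≃ b.support) (D) (ψ : QuadChar K S) (I : Fin r → IntegralIdeals S) (j₀ : Fin r)

/-- The orders at `v` of the ideals `I_j`. -/
def ordVec (v : Pl K) (j : Fin r) : ℕ := ord v (I j : Ideal (𝓞 K))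

open Classical in
/-- The contribution of `v` to the residue symbols between the ideals `I_j` with `j ≠ j₀`. -/
def localSign (v : Pl K) : ℂ :=
  ∏ i, ∏ j, if (i < j ∧ Adj b e i j) ∧ i ≠ j₀ ∧ j ≠ j₀ then
    D.away (I i : Ideal (𝓞 K)) v ^ ord v (I j : Ideal (𝓞 K)) else 1

/-- The argument at `v` of the local generating function. -/
def localArg (M : Ideal (𝓞 K)) (s : ℂ) (v : Pl K) : ℂ :=
  D.away M v * ψ.atPrime v * (nrm v.asIdeal : ℂ) ^ (-s)

/-- The local contribution to the Dirichlet series at `v`, for the exponent `l`. -/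
def localTerm (M : Ideal (𝓞 K)) (s : ℂ) (v : Pl K) (l : ℕ) : ℂ :=
  localSign D b e I j₀ v * (coeff b e (nrm v.asIdeal) (Function.update (ordVec I v) j₀ l) *
    localArg D ψ M s v ^ l)

variable {b e D ψ I j₀}

theorem norm_localSign {v : Pl K} (hv : v ∉ S) : ‖localSign D b e I j₀ v‖ = 1 := by
  rw [localSign, norm_prod]
  refine Finset.prod_eq_one fun i _ => ?_
  rw [norm_prod]
  refine Finset.prod_eq_one fun j _ => ?_
  split_ifs
  · have h := congrArg norm (SymbolChoices.away_sq (D := D) (I i).2.1 (ord_of_mem (I i)) hv)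
    rw [norm_mul, norm_one, mul_self_eq_one_iff] at h
    rw [norm_pow, h.resolve_right (by linarith [norm_nonneg (D.away (I i : Ideal (𝓞 K)) v)]),
      one_pow]
  · exact norm_one

theorem localSign_eq_one {v : Pl K} (hv : ∀ j ≠ j₀, ord v (I j : Ideal (𝓞 K)) = 0) :
    localSign D b e I j₀ v = 1 := by
  refine Finset.prod_eq_one fun i _ => Finset.prod_eq_one fun j _ => ?_
  split_ifs with h
  · rw [hv j h.2.2, pow_zero]
  · rfl

-- All neighbours of `j₀` precede it, so `J` enters the symbols only as lower argument. The
-- contributions of all neighbours combine to powers of `away M` at the primes of `J`, and no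
-- reciprocity law is needed. The symbols between the other ideals do not involve `J` and are
-- distributed over the primes as `localSign`.
open Classical in
theorem H_update_eq_prod [P.IsRootSystem] (hsl : b.cartanMatrix.IsSimplyLaced)
    (hj₀ : ∀ j, Adj b e j j₀ → j < j₀) {M : Ideal (𝓞 K)}
    (hM : M = ∏ j with Adj b e j j₀, (I j : Ideal (𝓞 K))) (J : IntegralIdeals S)
    {T : Finset (Pl K)} (hT : ∀ j ≠ j₀, ∀ v, ord v (I j : Ideal (𝓞 K)) ≠ 0 → v ∈ T)
    (hTJ : ∀ v, ord v (J : Ideal (𝓞 K)) ≠ 0 → v ∈ T) :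
    H b e D (Function.update (fun j => (I j : Ideal (𝓞 K))) j₀ J) =
      ∏ v ∈ T, localSign D b e I j₀ v *
        (coeff b e (nrm v.asIdeal)
            (Function.update (ordVec I v) j₀ (ord v (J : Ideal (𝓞 K)))) *
          D.away M v ^ ord v (J : Ideal (𝓞 K))) := by
  have hord : ∀ v, (fun i => ord v (Function.update (fun j => (I j : Ideal (𝓞 K))) j₀ J i)) =
      Function.update (ordVec I v) j₀ (ord v (J : Ideal (𝓞 K))) := fun v => by
    ext i
    by_cases h : i = j₀
    · subst h; simp
    · simp [h, ordVec]
  have h1 : (∏ᶠ (v : Pl K) (_ : ∃ i, ord v (Function.update (fun j => (I j : Ideal (𝓞 K))) j₀ J i) ≠ 0),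
      coeff b e (nrm v.asIdeal) fun i => ord v (Function.update (fun j => (I j : Ideal (𝓞 K))) j₀ J i)) =
      ∏ v ∈ T, coeff b e (nrm v.asIdeal)
        (Function.update (ordVec I v) j₀ (ord v (J : Ideal (𝓞 K)))) := by
    rw [finprod_eq_prod_of_mulSupport_subset (s := T)]
    · refine Finset.prod_congr rfl fun v _ => ?_
      rw [finprod_eq_if, hord]
      split_ifs with h
      · rfl
      -- A prime of `T` that divides none of the ideals contributes `a(0) = 1`.
      · rw [← hord]
        push Not at h
        rw [show (fun i => ord v (Function.update (fun j => (I j : Ideal (𝓞 K))) j₀ J i)) = 0 from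
          funext h, coeff_zero_eq_one hsl (two_le_nrm v)]
    · intro v hv
      by_contra hvT
      refine hv ?_
      dsimp only
      rw [finprod_eq_if, if_neg]
      rintro ⟨i, hi⟩
      by_cases h : i = j₀
      · subst h
        rw [Function.update_self] at hi
        exact hvT (hTJ v hi)
      · rw [Function.update_of_ne h] at hi
        exact hvT (hT i h v hi)
  have h2 : (∏ i, ∏ j, if i < j ∧ Adj b e i j then
      cross D (Function.update (fun j => (I j : Ideal (𝓞 K))) j₀ J i)
        (Function.update (fun j => (I j : Ideal (𝓞 K))) j₀ J j) else 1) =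
      (∏ i, ∏ j, if (i < j ∧ Adj b e i j) ∧ i ≠ j₀ ∧ j ≠ j₀ then
        cross D (I i : Ideal (𝓞 K)) (I j : Ideal (𝓞 K)) else 1) *
      ∏ i, if Adj b e i j₀ then cross D (I i : Ideal (𝓞 K)) (J : Ideal (𝓞 K)) else 1 := by
    rw [← Finset.prod_mul_distrib]
    refine Finset.prod_congr rfl fun i _ => ?_
    have h3 : (if Adj b e i j₀ then cross D (I i : Ideal (𝓞 K)) (J : Ideal (𝓞 K)) else 1) =
        ∏ j, if j = j₀ then (if Adj b e i j₀ then
          cross D (I i : Ideal (𝓞 K)) (J : Ideal (𝓞 K)) else 1) else 1 := by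
      rw [Finset.prod_ite_eq' Finset.univ j₀, if_pos (Finset.mem_univ _)]
    rw [h3, ← Finset.prod_mul_distrib]
    refine Finset.prod_congr rfl fun j _ => ?_
    by_cases hi : i = j₀
    · subst hi
      -- The index `j₀` is never the smaller one of an adjacent pair.
      have h4 : ¬(i < j ∧ Adj b e i j) := fun h =>
        lt_asymm h.1 (hj₀ j (adj_symm hsl h.2))
      have h5 : ¬Adj b e i i := fun h => h.1 rfl
      simp [h4, h5]
    · by_cases hj : j = j₀
      · subst hj
        have h4 : (i < j ∧ Adj b e i j) ↔ Adj b e i j := ⟨And.right, fun h => ⟨hj₀ i h, h⟩⟩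
        simp [h4, hi]
      · simp [hi, hj]
  have h6 : (∏ i, if Adj b e i j₀ then cross D (I i : Ideal (𝓞 K)) (J : Ideal (𝓞 K)) else 1) =
      ∏ v ∈ T, D.away M v ^ ord v (J : Ideal (𝓞 K)) := by
    rw [hM]
    simp only [cross_eq_away (I _).2.1 hTJ,
      SymbolChoices.away_prod _ _ fun i _ => (I i).2.1, ← Finset.prod_pow]
    rw [Finset.prod_comm, Finset.prod_filter]
  have h7 : (∏ i, ∏ j, if (i < j ∧ Adj b e i j) ∧ i ≠ j₀ ∧ j ≠ j₀ then
      cross D (I i : Ideal (𝓞 K)) (I j : Ideal (𝓞 K)) else 1) =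
      ∏ v ∈ T, localSign D b e I j₀ v := by
    refine Eq.trans ?_ Finset.prod_comm
    refine Finset.prod_congr rfl fun i _ => ?_
    refine Eq.trans ?_ Finset.prod_comm
    refine Finset.prod_congr rfl fun j _ => ?_
    split_ifs with h
    · exact cross_eq_away (I i).2.1 (hT j h.2.2)
    · exact Finset.prod_const_one.symm
  unfold H
  rw [h1, h2, h6, h7, ← Finset.prod_mul_distrib, ← Finset.prod_mul_distrib]
  exact Finset.prod_congr rfl fun v _ => by ring

open Classical in
/-- The terms of the Dirichlet series are products of local terms. -/
theorem dirichletTerm_eq_prod [P.IsRootSystem] (hsl : b.cartanMatrix.IsSimplyLaced)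
    (hj₀ : ∀ j, Adj b e j j₀ → j < j₀) {M : Ideal (𝓞 K)}
    (hM : M = ∏ j with Adj b e j j₀, (I j : Ideal (𝓞 K))) (s : ℂ) (J : IntegralIdeals S)
    {T : Finset (Pl K)} (hT : ∀ j ≠ j₀, ∀ v, ord v (I j : Ideal (𝓞 K)) ≠ 0 → v ∈ T)
    (hTJ : ∀ v, ord v (J : Ideal (𝓞 K)) ≠ 0 → v ∈ T) :
    H b e D (Function.update (fun j => (I j : Ideal (𝓞 K))) j₀ J) * ψ.atIdeal J /
        (nrm (J : Ideal (𝓞 K)) : ℂ) ^ s =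
      ∏ v ∈ T, localTerm D b e ψ I j₀ M s v (ord v (J : Ideal (𝓞 K))) := by
  rw [H_update_eq_prod hsl hj₀ hM J hT hTJ, ψ.atIdeal_eq_prod hTJ, nrm_eq_prod J.2.1 hTJ,
    natCast_prod_cpow, ← Finset.prod_mul_distrib, ← Finset.prod_div_distrib]
  refine Finset.prod_congr rfl fun v _ => ?_
  rw [localTerm, localArg, mul_pow, mul_pow, Complex.cpow_neg, inv_pow]
  ring

end Factorization

/-! ### The Dirichlet series -/

section Dirichlet

variable {K : Type*} [Field K] [NumberField K] {S : Finset (Pl K)} {D : SymbolChoices K S}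
  {ι V V' : Type*} [Finite ι] [AddCommGroup V] [Module ℝ V] [AddCommGroup V'] [Module ℝ V']
  {P : RootPairing ι ℝ V V'} [P.IsCrystallographic] [P.IsReduced] [P.IsRootSystem] {b : P.Base}
  {r : ℕ} {e : Fin r ≃ b.support} {ψ : QuadChar K S} {I : Fin r → IntegralIdeals S} {j₀ : Fin r}

/-- The local polynomial is `1` and the sum of adjacent exponents is `0`, hence even, so the
generating function is the geometric series. -/
theorem coeff_update_eq_one (hsl : b.cartanMatrix.IsSimplyLaced) {q : ℕ} (hq : 2 ≤ q) {i : Fin r}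
    {k : Fin r → ℕ} (hk : restDeg i k = 0) (l : ℕ) :
    coeff b e q (Function.update k i l) = 1 := by
  have h1 : adjDeg b e i k = 0 := Nat.le_zero.1 (hk ▸ adjDeg_le_restDeg i k)
  have h2 := fun l => localPoly_coeff (e := e) hsl hq i k l
  simp only [localPoly_eq_one hsl hq i k hk, Polynomial.coeff_one, h1, Even.zero, true_and] at h2
  induction l with
  | zero => simpa using (h2 0).symm
  | succ l ih =>
    have h3 := h2 (l + 1)
    rw [if_neg l.succ_ne_zero, if_pos l.succ_ne_zero, Nat.add_sub_cancel, ih] at h3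
    exact (sub_eq_zero.1 h3.symm)

theorem restDeg_ordVec {N : Ideal (𝓞 K)} (hN : N = ∏ j with j ≠ j₀, (I j : Ideal (𝓞 K)))
    (v : Pl K) : restDeg j₀ (ordVec I v) = ord v N := by
  rw [hN, ord_prod v _ _ fun j _ => (I j).2.1, restDeg, Finset.sum_filter]
  refine Finset.sum_congr rfl fun j _ => ?_
  by_cases h : j = j₀
  · subst h; simp
  · simp [h, ordVec]

open Classical in
theorem adjDeg_ordVec (hsl : b.cartanMatrix.IsSimplyLaced) {M : Ideal (𝓞 K)}
    (hM : M = ∏ j with Adj b e j j₀, (I j : Ideal (𝓞 K))) (v : Pl K) :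
    adjDeg b e j₀ (ordVec I v) = ord v M := by
  rw [hM, ord_prod v _ _ fun j _ => (I j).2.1, adjDeg, Finset.sum_filter]
  refine Finset.sum_congr rfl fun j _ => ?_
  have : Adj b e j₀ j ↔ Adj b e j j₀ := ⟨adj_symm hsl, adj_symm hsl⟩
  simp only [this, ordVec]

theorem SymbolChoices.norm_away {M : Ideal (𝓞 K)} (hM : M ≠ ⊥) (hS : ∀ v ∈ S, ord v M = 0)
    {v : Pl K} (hv : v ∉ S) : ‖D.away M v‖ = 1 := by
  have h := congrArg norm (SymbolChoices.away_sq (D := D) hM hS hv)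
  rw [norm_mul, norm_one, mul_self_eq_one_iff] at h
  exact h.resolve_right (by linarith [norm_nonneg (D.away M v)])

theorem QuadChar.norm_atPrime (v : Pl K) : ‖ψ.atPrime v‖ = 1 := by
  have h := congrArg norm (ψ.atPrime_sq v)
  rw [norm_mul, norm_one, mul_self_eq_one_iff] at h
  exact h.resolve_right (by linarith [norm_nonneg (ψ.atPrime v)])

theorem norm_nrm_cpow (v : Pl K) (s : ℂ) :
    ‖(nrm v.asIdeal : ℂ) ^ (-s)‖ = (nrm v.asIdeal : ℝ) ^ (-s.re) := by
  rw [Complex.norm_natCast_cpow_of_pos (by have := two_le_nrm v; omega), Complex.neg_re]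

theorem norm_localArg {M : Ideal (𝓞 K)} (hM : M ≠ ⊥) (hS : ∀ v ∈ S, ord v M = 0) (s : ℂ)
    {v : Pl K} (hv : v ∉ S) : ‖localArg D ψ M s v‖ = (nrm v.asIdeal : ℝ) ^ (-s.re) := by
  rw [localArg, norm_mul, norm_mul, SymbolChoices.norm_away hM hS hv, ψ.norm_atPrime,
    norm_nrm_cpow, one_mul, one_mul]

theorem nrm_rpow_le_half (v : Pl K) {σ : ℝ} (hσ : 1 < σ) :
    (nrm v.asIdeal : ℝ) ^ (-σ) ≤ 1 / 2 := by
  have h2 : (2 : ℝ) ≤ nrm v.asIdeal := by exact_mod_cast two_le_nrm v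
  calc (nrm v.asIdeal : ℝ) ^ (-σ) ≤ (nrm v.asIdeal : ℝ) ^ (-1 : ℝ) :=
        Real.rpow_le_rpow_of_exponent_le (by linarith) (by linarith)
    _ = 1 / nrm v.asIdeal := by rw [Real.rpow_neg_one, one_div]
    _ ≤ 1 / 2 := one_div_le_one_div_of_le two_pos h2

/-- `1 / (1 - u) ≤ 1 + 2 u` on `[0, 1/2]`. This provides the summable majorant `B` for the Euler
products. -/
theorem tsum_pow_le_one_add {t u : ℝ} (ht : 0 ≤ t) (htu : t ≤ u) (hu : u ≤ 1 / 2) :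
    ∑' l : ℕ, t ^ l ≤ 1 + 2 * u := by
  rw [tsum_geometric_of_lt_one ht (by linarith), inv_le_iff_one_le_mul₀ (by linarith)]
  nlinarith

variable (D e ψ I j₀) in
/-- The polynomial at `v` in the finite Euler product. -/
def localFactor (hsl : b.cartanMatrix.IsSimplyLaced) (M : Ideal (𝓞 K)) (v : Pl K) :
    Polynomial ℂ :=
  Polynomial.C (localSign D b e I j₀ v) *
    (localPoly hsl e (two_le_nrm v) j₀ (ordVec I v)).comp
      (Polynomial.C (D.away M v * ψ.atPrime v) * Polynomial.X)

theorem localFactor_eval (hsl : b.cartanMatrix.IsSimplyLaced) (M : Ideal (𝓞 K)) (v : Pl K)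
    (s : ℂ) : (localFactor D e ψ I j₀ hsl M v).eval ((nrm v.asIdeal : ℂ) ^ (-s)) =
      localSign D b e I j₀ v *
        (localPoly hsl e (two_le_nrm v) j₀ (ordVec I v)).eval (localArg D ψ M s v) := by
  simp only [localFactor, localArg, Polynomial.eval_mul, Polynomial.eval_C, Polynomial.eval_comp,
    Polynomial.eval_X]

theorem ord_eq_zero_of_ord_prod {N : Ideal (𝓞 K)}
    (hN : N = ∏ j with j ≠ j₀, (I j : Ideal (𝓞 K))) {v : Pl K} (hv : ord v N = 0) :
    ∀ j ≠ j₀, ord v (I j : Ideal (𝓞 K)) = 0 := by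
  intro j hj
  rw [hN, ord_prod v _ _ fun j _ => (I j).2.1] at hv
  exact Finset.sum_eq_zero_iff.1 hv j (by simpa using hj)

theorem localFactor_eval_eq_one (hsl : b.cartanMatrix.IsSimplyLaced) (M : Ideal (𝓞 K))
    {N : Ideal (𝓞 K)} (hN : N = ∏ j with j ≠ j₀, (I j : Ideal (𝓞 K))) {v : Pl K}
    (hv : ord v N = 0) (s : ℂ) :
    (localFactor D e ψ I j₀ hsl M v).eval ((nrm v.asIdeal : ℂ) ^ (-s)) = 1 := by
  rw [localFactor_eval, localSign_eq_one (ord_eq_zero_of_ord_prod hN hv),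
    localPoly_eq_one hsl _ _ _ ((restDeg_ordVec hN v).trans hv), Polynomial.eval_one, one_mul]

-- If `ord_v M` is even, `χ_M(v)` equals `away M v`, and the pole `1 / (1 - x)` of the generating
-- function is the Euler factor. If it is odd, `χ_M(v) = 0`, so the Euler factor is `1`, and the
-- generating function has no pole.
open Classical in
theorem hasSum_localTerm (hsl : b.cartanMatrix.IsSimplyLaced) {M : Ideal (𝓞 K)} (hM0 : M ≠ ⊥)
    (hMS : ∀ v ∈ S, ord v M = 0) (hM : M = ∏ j with Adj b e j j₀, (I j : Ideal (𝓞 K)))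
    {s : ℂ} (hs : 1 < s.re) {v : Pl K} (hv : v ∉ S) :
    HasSum (localTerm D b e ψ I j₀ M s v) (eulerFactor D ψ M s v *
      (localFactor D e ψ I j₀ hsl M v).eval ((nrm v.asIdeal : ℂ) ^ (-s))) := by
  have hx : ‖localArg D ψ M s v‖ < 1 := by
    rw [norm_localArg hM0 hMS s hv]
    linarith [nrm_rpow_le_half v hs]
  have h1 := (hasSum_coeff (e := e) hsl (two_le_nrm v) j₀ (ordVec I v) hx).mul_left
    (localSign D b e I j₀ v)
  have h2 : eulerFactor D ψ M s v =
      if Even (adjDeg b e j₀ (ordVec I v)) then (1 - localArg D ψ M s v)⁻¹ else 1 := by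
    rw [adjDeg_ordVec hsl hM, eulerFactor]
    split_ifs with h
    · rw [SymbolChoices.chi_of_even hM0 hMS hv h, localArg, mul_comm (ψ.atPrime v)]
    · rw [SymbolChoices.chi_of_odd hM0 hMS hv (Nat.not_even_iff_odd.1 h), Int.cast_zero, mul_zero,
        zero_mul, sub_zero, inv_one]
  rw [localFactor_eval, h2, mul_left_comm]
  exact h1

theorem SymbolChoices.norm_chi_le {M : Ideal (𝓞 K)} (v : Pl K) : ‖(D.chi M v : ℂ)‖ ≤ 1 := by
  rw [chi, quadSym]
  split_ifs <;> simp

/-- The general Euler product with geometric local series and no exceptional primes. -/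
theorem multipliable_eulerFactor (M : Ideal (𝓞 K)) {s : ℂ} (hs : 1 < s.re) :
    Multipliable (fun v : {v : Pl K // v ∉ S} => eulerFactor D ψ M s v) := by
  set t : {v : Pl K // v ∉ S} → ℂ := fun v =>
    ψ.atPrime v * (D.chi M v : ℂ) * (nrm v.1.asIdeal : ℂ) ^ (-s) with ht
  have ht1 : ∀ v, ‖t v‖ ≤ (nrm v.1.asIdeal : ℝ) ^ (-s.re) := fun v => by
    rw [ht, norm_mul, norm_mul, ψ.norm_atPrime, norm_nrm_cpow, one_mul]
    exact mul_le_of_le_one_left (by positivity) (SymbolChoices.norm_chi_le _)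
  have ht2 : ∀ v, ‖t v‖ < 1 := fun v => by linarith [ht1 v, nrm_rpow_le_half v.1 hs]
  obtain ⟨a, -, ha⟩ := exists_hasSum_hasProd (h := fun v l => t v ^ l) (T₀ := ∅)
    (B := fun v => 2 * (nrm v.1.asIdeal : ℝ) ^ (-s.re)) (fun v _ => pow_zero _)
    (fun v => by simpa using summable_geometric_of_lt_one (norm_nonneg _) (ht2 v))
    (fun v => by positivity)
    (((summable_nrm_rpow K hs).comp_injective Subtype.val_injective).mul_left 2)
    (fun v _ => by
      simp only [norm_pow]
      exact tsum_pow_le_one_add (norm_nonneg _) (ht1 v) (nrm_rpow_le_half v.1 hs))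
  refine HasProd.multipliable (a := a) ?_
  simp only [tsum_geometric_of_norm_lt_one (ht2 _)] at ha
  exact ha

-- The exceptional set `T₀` consists of the primes dividing `N`; at all other primes the local
-- series is geometric and begins with `1`. The factors `localFactor` are `1` outside `T₀`, so they
-- can be split off as a finite product from the product for `L(s, ψ χ_M)`.
open Classical in
theorem hasSum_dirichlet (hsl : b.cartanMatrix.IsSimplyLaced)
    (hj₀ : ∀ j, Adj b e j j₀ → j < j₀) {M N : Ideal (𝓞 K)}
    (hN : N = ∏ j with j ≠ j₀, (I j : Ideal (𝓞 K)))
    (hM : M = ∏ j with Adj b e j j₀, (I j : Ideal (𝓞 K))) {s : ℂ} (hs : 1 < s.re) :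
    HasSum (fun J : IntegralIdeals S =>
        H b e D (Function.update (fun j => (I j : Ideal (𝓞 K))) j₀ J) *
          ψ.atIdeal J / (nrm (J : Ideal (𝓞 K)) : ℂ) ^ s)
      (partialL D ψ M s * ∏ᶠ (v : Pl K) (_ : v.asIdeal ∣ N),
        (localFactor D e ψ I j₀ hsl M v).eval ((nrm v.asIdeal : ℂ) ^ (-s))) := by
  have hN0 : N ≠ ⊥ := hN ▸ Finset.prod_ne_zero_iff.2 fun j _ => (I j).2.1
  have hM0 : M ≠ ⊥ := hM ▸ Finset.prod_ne_zero_iff.2 fun j _ => (I j).2.1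
  have hMS : ∀ v ∈ S, ord v M = 0 := fun v hv => by
    rw [hM, ord_prod v _ _ fun j _ => (I j).2.1]
    exact Finset.sum_eq_zero fun j _ => ord_of_mem (I j) v hv
  have hNS : ∀ v ∈ S, ord v N = 0 := fun v hv => by
    rw [hN, ord_prod v _ _ fun j _ => (I j).2.1]
    exact Finset.sum_eq_zero fun j _ => ord_of_mem (I j) v hv
  set T₀ : Finset {v : Pl K // v ∉ S} := (ord_finite hN0).toFinset.subtype (· ∉ S) with hT₀
  have hmem : ∀ v : {v : Pl K // v ∉ S}, v ∈ T₀ ↔ ord v.1 N ≠ 0 := fun v => by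
    rw [hT₀, Finset.mem_subtype]
    simp
  set F : Pl K → ℂ := fun v =>
    (localFactor D e ψ I j₀ hsl M v).eval ((nrm v.asIdeal : ℂ) ^ (-s)) with hF
  set h : {v : Pl K // v ∉ S} → ℕ → ℂ := fun v => localTerm D b e ψ I j₀ M s v with hh
  have htsum : ∀ v, HasSum (h v) (eulerFactor D ψ M s v * F v) :=
    fun v => hasSum_localTerm hsl hM0 hMS hM hs v.2
  have hout : ∀ v ∉ T₀, ∀ l, h v l = localArg D ψ M s v ^ l := fun v hv l => by
    have h0 : ord v.1 N = 0 := by simpa [hmem] using hv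
    rw [hh]
    dsimp only
    rw [localTerm, localSign_eq_one (ord_eq_zero_of_ord_prod hN h0),
      coeff_update_eq_one hsl (two_le_nrm v.1) ((restDeg_ordVec hN v.1).trans h0), one_mul, one_mul]
  have h0 : ∀ v ∉ T₀, h v 0 = 1 := fun v hv => by rw [hout v hv, pow_zero]
  obtain ⟨a, ha, ha'⟩ := exists_hasSum_hasProd (h := h) (T₀ := T₀)
    (B := fun v => 2 * (nrm v.1.asIdeal : ℝ) ^ (-s.re)) h0 (fun v => (htsum v).summable.norm)
    (fun v => by positivity)
    (((summable_nrm_rpow K hs).comp_injective Subtype.val_injective).mul_left 2)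
    (fun v hv => by
      simp only [hout v hv, norm_pow]
      exact tsum_pow_le_one_add (norm_nonneg _) (norm_localArg hM0 hMS s v.2).le
        (nrm_rpow_le_half v.1 hs))
  have hQ : (∏ᶠ (v : Pl K) (_ : v.asIdeal ∣ N), F v) = ∏ v ∈ T₀, F v := by
    rw [finprod_eq_prod_of_mulSupport_subset (s := T₀.map (Function.Embedding.subtype _)),
      Finset.prod_map]
    · refine Finset.prod_congr rfl fun v hv => ?_
      rw [finprod_eq_if]
      exact if_pos ((ord_ne_zero_iff v.1).1 ((hmem v).1 hv))
    · intro v hv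
      have hv' : v.asIdeal ∣ N := by
        by_contra hc
        exact hv (by dsimp only; rw [finprod_eq_if, if_neg hc])
      have h1 := (ord_ne_zero_iff v).2 hv'
      exact Finset.mem_coe.2 (Finset.mem_map.2
        ⟨⟨v, fun hS => h1 (hNS v hS)⟩, (hmem _).2 h1, rfl⟩)
  have hval : a = partialL D ψ M s * ∏ᶠ (v : Pl K) (_ : v.asIdeal ∣ N), F v := by
    rw [hQ, partialL]
    refine ha'.unique ?_
    have h1 := (multipliable_eulerFactor (D := D) (ψ := ψ) M hs).hasProd
    have h2 : HasProd (fun v : {v : Pl K // v ∉ S} => F v) (∏ v ∈ T₀, F v) :=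
      hasProd_prod_of_ne_finset_one fun v hv => localFactor_eval_eq_one hsl M hN
        (by simpa [hmem] using hv) s
    have h3 : (fun v => ∑' l, h v l) = fun v : {v : Pl K // v ∉ S} =>
        eulerFactor D ψ M s v * F v := funext fun v => (htsum v).tsum_eq
    rw [h3]
    exact h1.mul h2
  -- The sum over ideals `J` becomes the sum over families of exponents. The term of `J` is a
  -- product over `T₀` together with the primes of `J`, a set that contains all primes of the ideals
  -- involved.
  rw [← hval, ← (exponentsEquiv S).symm.hasSum_iff]
  refine Eq.subst (motive := fun f => HasSum f a) (funext fun x => Eq.symm ?_) ha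
  obtain ⟨J, rfl⟩ := (exponentsEquiv S).surjective x
  rw [Function.comp_apply, Equiv.symm_apply_apply,
    dirichletTerm_eq_prod hsl hj₀ hM s J
      (T := (T₀ ∪ (exponentsEquiv S J).support).map (Function.Embedding.subtype _)),
    Finset.prod_map, eulerTerm_eq h0 Finset.subset_union_left Finset.subset_union_right]
  · rfl
  · intro j hj v hv
    have h1 : v ∉ S := fun hS => hv (ord_of_mem (I j) v hS)
    refine Finset.mem_map.2 ⟨⟨v, h1⟩, Finset.mem_union_left _ ((hmem _).2 fun h2 => ?_), rfl⟩
    exact hv (ord_eq_zero_of_ord_prod hN h2 j hj)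
  · intro v hv
    have h1 : v ∉ S := fun hS => hv (ord_of_mem J v hS)
    exact Finset.mem_map.2 ⟨⟨v, h1⟩, Finset.mem_union_right _ (Finsupp.mem_support_iff.2 hv), rfl⟩

end Dirichlet

/-! ### The finite Euler product -/

section FiniteProduct

variable {K : Type*} [Field K] [NumberField K] {S : Finset (Pl K)} {D : SymbolChoices K S}
  {ι V V' : Type*} [Finite ι] [AddCommGroup V] [Module ℝ V] [AddCommGroup V'] [Module ℝ V']
  {P : RootPairing ι ℝ V V'} [P.IsCrystallographic] [P.IsReduced] [P.IsRootSystem] {b : P.Base}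
  {r : ℕ} {e : Fin r ≃ b.support} {ψ : QuadChar K S} {I : Fin r → IntegralIdeals S} {j₀ : Fin r}

theorem finprod_dvd_eq_prod {N : Ideal (𝓞 K)} (hN : N ≠ ⊥) (F : Pl K → ℂ) :
    (∏ᶠ (v : Pl K) (_ : v.asIdeal ∣ N), F v) = ∏ v ∈ (ord_finite hN).toFinset, F v := by
  classical
  rw [finprod_eq_prod_of_mulSupport_subset (s := (ord_finite hN).toFinset)]
  · refine Finset.prod_congr rfl fun v hv => ?_
    rw [finprod_eq_if]
    exact if_pos ((ord_ne_zero_iff v).1 ((ord_finite hN).mem_toFinset.1 hv))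
  · intro v hv
    refine Finset.mem_coe.2 ((ord_finite hN).mem_toFinset.2 ((ord_ne_zero_iff v).2 ?_))
    by_contra hc
    exact hv (by dsimp only; rw [finprod_eq_if, if_neg hc])

theorem ord_le_one_of_squarefree {I : Ideal (𝓞 K)} (hI : Squarefree I) (v : Pl K) :
    ord v I ≤ 1 := by
  by_contra h
  have h1 : v.asIdeal ^ 2 ∣ I := pow_dvd_of_le_multiplicity (by unfold ord at h; omega)
  exact v.prime.not_isUnit (hI v.asIdeal (pow_two v.asIdeal ▸ h1))

/-- `ord_v M` is at most `1` from `M₀` plus twice the order of `M₁ M₂`. -/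
theorem ord_mul_eq_half {M M₀ M₁ M₂ : Ideal (𝓞 K)} (hM : M ≠ ⊥) (h : M = M₀ * M₁ ^ 2 * M₂ ^ 2)
    (h₀ : Squarefree M₀) (v : Pl K) : ord v (M₁ * M₂) = ord v M / 2 := by
  rw [h] at hM ⊢
  have h2 := right_ne_zero_of_mul hM
  have h3 := left_ne_zero_of_mul hM
  have hM₂ : M₂ ≠ ⊥ := ne_zero_pow two_ne_zero h2
  have hM₁ : M₁ ≠ ⊥ := ne_zero_pow two_ne_zero (right_ne_zero_of_mul h3)
  have hM₀ : M₀ ≠ ⊥ := left_ne_zero_of_mul h3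
  rw [ord_mul v h3 h2, ord_mul v hM₀ (pow_ne_zero 2 hM₁), ord_pow v hM₁, ord_pow v hM₂,
    ord_mul v hM₁ hM₂]
  have := ord_le_one_of_squarefree h₀ v
  omega

-- The signs in `localArg` square to `1`. Hence `x ↦ 1 / (q x)` takes the argument for `s` to the
-- one for `1 - s`, and `(√q x)² = q^{1 - 2s}`.
open Classical in
theorem localFactor_functional (hsl : b.cartanMatrix.IsSimplyLaced) {M : Ideal (𝓞 K)}
    (hM0 : M ≠ ⊥) (hMS : ∀ v ∈ S, ord v M = 0)
    (hM : M = ∏ j with Adj b e j j₀, (I j : Ideal (𝓞 K))) (s : ℂ) {v : Pl K} (hv : v ∉ S) :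
    (localFactor D e ψ I j₀ hsl M v).eval ((nrm v.asIdeal : ℂ) ^ (-s)) =
      ((nrm v.asIdeal : ℂ) ^ (1 - 2 * s)) ^ (ord v M / 2) *
        (localFactor D e ψ I j₀ hsl M v).eval ((nrm v.asIdeal : ℂ) ^ (-(1 - s))) := by
  have hq : (nrm v.asIdeal : ℂ) ≠ 0 := by
    exact_mod_cast (by have := two_le_nrm v; omega : nrm v.asIdeal ≠ 0)
  have hc : (D.away M v * ψ.atPrime v) * (D.away M v * ψ.atPrime v) = 1 := by
    rw [mul_mul_mul_comm, SymbolChoices.away_sq hM0 hMS hv, ψ.atPrime_sq, one_mul]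
  have hx : localArg D ψ M s v ≠ 0 :=
    mul_ne_zero (left_ne_zero_of_mul_eq_one hc) (by simp [Complex.cpow_eq_zero_iff, hq])
  have h1 : 1 / ((nrm v.asIdeal : ℂ) * localArg D ψ M s v) = localArg D ψ M (1 - s) v := by
    refine (eq_one_div_of_mul_eq_one_left ?_).symm
    have h2 : (nrm v.asIdeal : ℂ) ^ (-(1 - s)) * ((nrm v.asIdeal : ℂ) * (nrm v.asIdeal : ℂ) ^ (-s)) =
        1 := by
      nth_rewrite 2 [← Complex.cpow_one (nrm v.asIdeal : ℂ)]
      rw [← Complex.cpow_add _ _ hq, ← Complex.cpow_add _ _ hq,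
        show -(1 - s) + (1 + -s) = 0 by ring, Complex.cpow_zero]
    calc _ = ((D.away M v * ψ.atPrime v) * (D.away M v * ψ.atPrime v)) *
          ((nrm v.asIdeal : ℂ) ^ (-(1 - s)) *
            ((nrm v.asIdeal : ℂ) * (nrm v.asIdeal : ℂ) ^ (-s))) := by
          unfold localArg; ring
      _ = 1 := by rw [hc, h2, one_mul]
  have h3 : (rootQ (nrm v.asIdeal) * localArg D ψ M s v) ^ 2 =
      (nrm v.asIdeal : ℂ) ^ (1 - 2 * s) := by
    have h4 : (nrm v.asIdeal : ℂ) ^ (1 - 2 * s) =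
        nrm v.asIdeal * ((nrm v.asIdeal : ℂ) ^ (-s) * (nrm v.asIdeal : ℂ) ^ (-s)) := by
      nth_rewrite 2 [← Complex.cpow_one (nrm v.asIdeal : ℂ)]
      rw [← Complex.cpow_add _ _ hq, ← Complex.cpow_add _ _ hq]
      congr 1
      ring
    calc _ = (rootQ (nrm v.asIdeal) * rootQ (nrm v.asIdeal)) *
          ((D.away M v * ψ.atPrime v) * (D.away M v * ψ.atPrime v)) *
          ((nrm v.asIdeal : ℂ) ^ (-s) * (nrm v.asIdeal : ℂ) ^ (-s)) := by
          unfold localArg; ring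
      _ = _ := by rw [hc, rootQ_mul_self, mul_one, h4]
  rw [localFactor_eval, localFactor_eval, localPoly_eval hsl _ _ _ hx, h1, pow_mul, h3,
    adjDeg_ordVec hsl hM]
  ring

/-- Only primes dividing `N` are considered, so `ord_v N ≥ 1`; together with `q ≥ 2` this allows
every factor of the local bound, even a constant independent of `q`, to be absorbed into a power of
`q^{ord_v N}`. -/
theorem norm_localFactor_eval_le (hsl : b.cartanMatrix.IsSimplyLaced) {g : ℕ}
    (hg : 2 * growthConst P ≤ 2 ^ g) {M N : Ideal (𝓞 K)} (hM0 : M ≠ ⊥)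
    (hMS : ∀ v ∈ S, ord v M = 0) (hN : N = ∏ j with j ≠ j₀, (I j : Ideal (𝓞 K))) {C : ℝ} {s : ℂ}
    (hs : C < s.re) {v : Pl K} (hv : v ∉ S) (hvN : ord v N ≠ 0) :
    ‖(localFactor D e ψ I j₀ hsl M v).eval ((nrm v.asIdeal : ℂ) ^ (-s))‖ ≤
      ((nrm v.asIdeal : ℝ) ^ (((5 + g : ℕ) : ℝ) + max 0 (-C))) ^ ord v N := by
  set q : ℝ := (nrm v.asIdeal : ℝ) with hqdef
  have hq : 2 ≤ q := by rw [hqdef]; exact_mod_cast two_le_nrm v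
  have hq1 : 1 ≤ q := by linarith
  set B : ℝ := q ^ max 0 (-C) with hBdef
  have hB : 1 ≤ B := Real.one_le_rpow hq1 (le_max_left _ _)
  have hx : ‖localArg D ψ M s v‖ ≤ B := by
    rw [norm_localArg hM0 hMS s hv]
    exact Real.rpow_le_rpow_of_exponent_le hq1 ((by linarith : -s.re ≤ -C).trans (le_max_right _ _))
  set k := ord v N with hk
  have h1 := norm_localPoly_eval_le (e := e) hsl (two_le_nrm v) j₀ (ordVec I v) _ hB hx
  rw [restDeg_ordVec hN v, ← hk, ← hqdef] at h1
  have h2 : (k : ℝ) + 1 ≤ q ^ k := by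
    have : k + 1 ≤ 2 ^ k := Nat.lt_two_pow_self
    calc (k : ℝ) + 1 ≤ 2 ^ k := by exact_mod_cast this
      _ ≤ q ^ k := pow_le_pow_left₀ two_pos.le hq k
  have h3 : 2 * growthConst P ≤ (q ^ g) ^ k :=
    calc 2 * growthConst P ≤ 2 ^ g := hg
      _ ≤ q ^ g := pow_le_pow_left₀ two_pos.le hq g
      _ ≤ (q ^ g) ^ k := le_self_pow₀ (one_le_pow₀ hq1) hvN
  have h4 : (2 * Real.sqrt q) ^ (2 * k) ≤ (q ^ 4) ^ k := by
    rw [pow_mul, mul_pow, Real.sq_sqrt (by linarith)]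
    refine pow_le_pow_left₀ (by positivity) ?_ k
    have h5 : (2 : ℝ) ^ 2 ≤ q ^ 2 := pow_le_pow_left₀ two_pos.le hq 2
    have h6 : q ≤ q ^ 2 := le_self_pow₀ hq1 two_ne_zero
    calc 2 ^ 2 * q ≤ q ^ 2 * q ^ 2 := mul_le_mul h5 h6 (by linarith) (by positivity)
      _ = q ^ 4 := by ring
  have hG : 0 ≤ 2 * growthConst P := mul_nonneg two_pos.le growthConst_nonneg
  rw [localFactor_eval, norm_mul, norm_localSign hv, one_mul]
  calc _ ≤ _ := h1
    _ ≤ q ^ k * ((q ^ g) ^ k * (q ^ 4) ^ k) * B ^ k := by gcongr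
    -- The exponent `5` is `1` from the number of coefficients plus `4` from the powers of `2 √q`;
    -- `g` comes from the growth constant.
    _ = (q ^ (5 + g) * B) ^ k := by
      rw [mul_pow, pow_add, mul_pow]
      ring
    _ = _ := by rw [Real.rpow_add (by linarith), Real.rpow_natCast]

end FiniteProduct

end QuadWMDS

end

/-! ### Assembly of the global statement. -/

open QuadWMDS in
theorem proposition5p1 {ι V V' : Type*} [Finite ι] [AddCommGroup V] [Module ℝ V]
    [AddCommGroup V'] [Module ℝ V'] (P : RootPairing ι ℝ V V') [P.IsRootSystem]
    [P.IsCrystallographic] [P.IsReduced] [P.IsIrreducible] (b : P.Base)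
    (hsimplyLaced : b.cartanMatrix.IsSimplyLaced) {r : ℕ} (e : Fin r ≃ b.support)
    (horder : ∀ j, (∀ i, Adj b e i j → i < j) ∨ (∀ i, Adj b e i j → j < i)) :
    ∃ C₃ : ℝ → ℝ, ∀ (j₀ : Fin r) (_ : ∀ j, Adj b e j j₀ → j < j₀)
      (K : Type*) [Field K] [NumberField K] (S : Finset (Pl K))
      (_ : ∀ v : Pl K, (2 : 𝓞 K) ∈ v.asIdeal → v ∈ S)
      (_ : IsPrincipalIdealRing ((S : Set (Pl K)).integer K))
      (D : SymbolChoices K S) (ψ : QuadChar K S)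
      (I : Fin r → IntegralIdeals S) (N M M₀ M₁ M₂ : Ideal (𝓞 K))
      (_ : N = ∏ j with j ≠ j₀, (I j : Ideal (𝓞 K)))
      (_ : M = ∏ᶠ (j) (_ : Adj b e j j₀), (I j : Ideal (𝓞 K)))
      (_ : M = M₀ * M₁ ^ 2 * M₂ ^ 2) (_ : Squarefree M₀) (_ : IsCoprime (M₀ * M₁) M₂),
      ∃ (F : Pl K → Polynomial ℂ) (Q : ℂ → ℂ),
        (∀ s, Q s = ∏ᶠ (v : Pl K) (_ : v.asIdeal ∣ N),
          (F v).eval ((nrm v.asIdeal : ℂ) ^ (-s))) ∧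
        (∀ s : ℂ, 1 < s.re →
          Multipliable (fun v : {v : Pl K // v ∉ S} => eulerFactor D ψ M s v) ∧
          HasSum (fun J : IntegralIdeals S =>
              H b e D (Function.update (fun j => (I j : Ideal (𝓞 K))) j₀ J) *
                ψ.atIdeal J / (nrm (J : Ideal (𝓞 K)) : ℂ) ^ s)
            (partialL D ψ M s * Q s)) ∧
        (∀ s, Q s = (nrm (M₁ * M₂) : ℂ) ^ (1 - 2 * s) * Q (1 - s)) ∧
        ∀ (C₂ : ℝ) (s : ℂ), C₂ < s.re → ‖Q s‖ ≤ (nrm N : ℝ) ^ C₃ C₂ := by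
  classical
  -- `g` is chosen from `growthConst P` before any arithmetic data, so `C₃` depends only on the root
  -- system.
  obtain ⟨g, hg⟩ := pow_unbounded_of_one_lt (2 * growthConst P) one_lt_two
  refine ⟨fun C => ((5 + g : ℕ) : ℝ) + max 0 (-C), ?_⟩
  intro j₀ hj₀ K _ _ S _ _ D ψ I N M M₀ M₁ M₂ hN hM hfac hsq _
  have hM' : M = ∏ j with Adj b e j j₀, (I j : Ideal (𝓞 K)) := by
    rw [hM, finprod_eq_prod_of_fintype, Finset.prod_filter]
    exact Finset.prod_congr rfl fun j _ => finprod_eq_if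
  have hN0 : N ≠ ⊥ := hN ▸ Finset.prod_ne_zero_iff.2 fun j _ => (I j).2.1
  have hM0 : M ≠ ⊥ := hM' ▸ Finset.prod_ne_zero_iff.2 fun j _ => (I j).2.1
  have hMS : ∀ v ∈ S, ord v M = 0 := fun v hv => by
    rw [hM', ord_prod v _ _ fun j _ => (I j).2.1]
    exact Finset.sum_eq_zero fun j _ => ord_of_mem (I j) v hv
  have hNS : ∀ v, ord v N ≠ 0 → v ∉ S := fun v hv hS => by
    rw [hN, ord_prod v _ _ fun j _ => (I j).2.1] at hv
    exact hv (Finset.sum_eq_zero fun j _ => ord_of_mem (I j) v hS)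
  have hmem : ∀ v ∈ (ord_finite hN0).toFinset, ord v N ≠ 0 := fun v hv => by simpa using hv
  have hNT : ∀ v, ord v N ≠ 0 → v ∈ (ord_finite hN0).toFinset := fun v hv => by simpa using hv
  -- The ideals at the neighbours of `j₀` are among the factors of `N`. Hence all primes of `M₁ M₂`
  -- divide `N`, and the norm of `M₁ M₂` can be written as a product over the primes of `N`.
  have hMN : ∀ v, ord v M ≤ ord v N := fun v => by
    rw [← adjDeg_ordVec hsimplyLaced hM' v, ← restDeg_ordVec hN v]
    exact adjDeg_le_restDeg _ _
  have hhalf := ord_mul_eq_half hM0 hfac hsq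
  have hM₁₂ : M₁ * M₂ ≠ ⊥ := by
    rw [hfac, mul_assoc, ← mul_pow] at hM0
    exact ne_zero_pow two_ne_zero (right_ne_zero_of_mul hM0)
  refine ⟨localFactor D e ψ I j₀ hsimplyLaced M, fun s => ∏ᶠ (v : Pl K) (_ : v.asIdeal ∣ N),
    (localFactor D e ψ I j₀ hsimplyLaced M v).eval ((nrm v.asIdeal : ℂ) ^ (-s)),
    fun s => rfl, fun s hs => ⟨multipliable_eulerFactor M hs,
      hasSum_dirichlet hsimplyLaced hj₀ hN hM' hs⟩, fun s => ?_, fun C s hs => ?_⟩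
  · simp only [finprod_dvd_eq_prod hN0]
    rw [nrm_eq_prod hM₁₂ (T := (ord_finite hN0).toFinset), natCast_prod_cpow,
      ← Finset.prod_mul_distrib]
    · refine Finset.prod_congr rfl fun v hv => ?_
      rw [hhalf, localFactor_functional hsimplyLaced hM0 hMS hM' s (hNS v (hmem v hv))]
    · intro v hv
      refine hNT v ?_
      have h1 := hhalf v
      have h2 := hMN v
      omega
  · simp only [finprod_dvd_eq_prod hN0]
    rw [norm_prod, nrm_eq_prod hN0 hNT, Nat.cast_prod, ← Real.finsetProd_rpow _ _ fun v _ => by positivity]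
    refine Finset.prod_le_prod (fun v _ => norm_nonneg _) fun v hv => ?_
    rw [Nat.cast_pow, ← Real.rpow_pow_comm (Nat.cast_nonneg _)]
    exact norm_localFactor_eval_le hsimplyLaced hg.le hM0 hMS hN hs (hNS v (hmem v hv)) (hmem v hv)
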